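/- For $\alpha>0$ and a symbol $p=p(x,\xi)$ on $\mathbb R\times\mathbb R$ let $\mathrm{op}_\alpha(p)$ be the operator on $L^2(\mathbb R)$ given on Schwartz functions $u$ by $$(\mathrm{op}_\alpha(p)u)(x)=\frac{\alpha}{2\pi}\int_{\mathbb R}\int_{\mathbb R}e^{i\alpha(x-y)\xi}\,p(x,\xi)\,u(y)\,dy\,d\xi .$$ Let $\mathbb R_+=(0,\infty)$, $\mathbb R_-=(-\infty,0)$, let $\chi_\pm$ be the characteristic function of $\mathbb R_\pm$, and let $T_\pm=\chi_+(x)\,\mathrm{op}_1(\chi_\pm(\xi))\,\chi_+(x)$, a bounded self-adjoint operator on $L^2(\mathbb R)$. For $g\in C^1(\mathbb R)$, complex-valued, with $g(0)=g(1)=0$, put $$\mathfrak A(g)=\frac1{(2\pi)^2}\int_0^1\frac{g(t)-t\,g(1)}{t(1-t)}\,dt .$$ Let $\mathbf S^{(n,m)}$ be the set of functions $a:\mathbb R\times\mathbb R\to\mathbb C$ that are bounded together with their partial derivatives $\partial_x^j\partial_\xi^k a$, $j\le n$, $k\le m$, and for $L,\rho>0$ let $$N^{(n,m)}(a;L,\rho)=\max_{j\le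 n,\ k\le m}\ \sup_{x,\xi}\ L^j\rho^k|\partial_x^j\partial_\xi^k a(x,\xi)| .$$ **Theorem.** Let $g\in C^1(\mathbb R)$ with $g(0)=g(1)=0$, let $\delta>0$ and $c>0$. There is a constant $C=C(g,\delta,c)>0$ such that the following holds for both signs, all $\alpha,L,\rho>0$ with $\alpha\rho\ge c$, all $r\ge 5$, all $\psi\in C_0^\infty(\mathbb R)$ with $0\le\psi\le1$, $\psi(x)=0$ for $x\notin(1,4r)$ and $\psi(x)=1$ for $x\in(4,r)$, and all $a\in\mathbf S^{(2,2)}$ vanishing outside $\mathbb R\times(-\rho,\rho)$. With $b(x,\xi)=\psi(x)a(x,\xi)$, the operator $\mathrm{op}_\alpha(b)$ is bounded on $L^2(\mathbb R)$, the operator $\mathrm{op}_\alpha(b)\,g(T_\pm)$ is of trace class, and $$\bigl|\operatorname{tr}\bigl(\mathrm{op}_\alpha(b)\,g(T_\pm)\bigr)-\mathfrak A(g)\,a(0,0)\log r\bigr|\le C\Bigl[1+\frac rL+(\alpha\rho)^{-\delta}\log r\Bigr]N^{(1,2)}(a;L,\rho).$$ -/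

import Mathlib

open MeasureTheory Set
open scoped ContDiff InnerProductSpace ENNReal SchwartzMap

noncomputable section

namespace WidomModel

/-- The Hilbert space `L²(ℝ)` of complex-valued functions. -/
abbrev L2 : Type := Lp ℂ 2 (volume : Measure ℝ)

/-- The product `χ_s u` of `u ∈ L²(ℝ)` with the characteristic function of a measurable set `s`. -/
def cut (s : Set ℝ) (hs : MeasurableSet s) (u : L2) : L2 :=
  ((Lp.memLp u).indicator hs).toLp (s.indicator (u : ℝ → ℂ))

theorem coeFn_cut (s : Set ℝ) (hs : MeasurableSet s) (u : L2) :
    (cut s hs u : ℝ → ℂ) =ᵐ[volume] s.indicator (u : ℝ → ℂ) :=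
  MemLp.coeFn_toLp _

theorem cut_add (s : Set ℝ) (hs : MeasurableSet s) (u v : L2) :
    cut s hs (u + v) = cut s hs u + cut s hs v := by
  apply Lp.ext
  filter_upwards [coeFn_cut s hs (u + v), coeFn_cut s hs u, coeFn_cut s hs v,
    Lp.coeFn_add u v, Lp.coeFn_add (cut s hs u) (cut s hs v)] with x h1 h2 h3 h4 h5
  rw [h1, h5, Pi.add_apply, h2, h3]
  by_cases hx : x ∈ s
  · rw [indicator_of_mem hx, indicator_of_mem hx, indicator_of_mem hx, h4, Pi.add_apply]
  · rw [indicator_of_notMem hx, indicator_of_notMem hx, indicator_of_notMem hx, add_zero]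

theorem cut_smul (s : Set ℝ) (hs : MeasurableSet s) (c : ℂ) (u : L2) :
    cut s hs (c • u) = c • cut s hs u := by
  apply Lp.ext
  filter_upwards [coeFn_cut s hs (c • u), coeFn_cut s hs u, Lp.coeFn_smul c u,
    Lp.coeFn_smul c (cut s hs u)] with x h1 h2 h3 h4
  rw [h1, h4, Pi.smul_apply, h2]
  by_cases hx : x ∈ s
  · rw [indicator_of_mem hx, indicator_of_mem hx, h3, Pi.smul_apply]
  · rw [indicator_of_notMem hx, indicator_of_notMem hx, smul_zero]

theorem norm_cut_le (s : Set ℝ) (hs : MeasurableSet s) (u : L2) : ‖cut s hs u‖ ≤ ‖u‖ := by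
  apply Lp.norm_le_norm_of_ae_le
  filter_upwards [coeFn_cut s hs u] with x h1
  rw [h1]
  exact norm_indicator_le_norm_self _ _

/-- Multiplication by the characteristic function of a measurable set `s`, as a bounded
operator on `L²(ℝ)`. -/
def restrictTo (s : Set ℝ) (hs : MeasurableSet s) : L2 →L[ℂ] L2 :=
  LinearMap.mkContinuous
    { toFun := cut s hs
      map_add' := cut_add s hs
      map_smul' := cut_smul s hs }
    1 (fun u => (norm_cut_le s hs u).trans_eq (one_mul _).symm)

/-- The bounded operator `A` on `L²(ℝ)` is the `α`-pseudo-differential operator `op_α^l(a)` with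
(left) symbol `a = a(x, ξ)`: on every Schwartz function `u`,
`(A u)(x) = (α / 2π) ∫ ∫ e^{iα(x - y)ξ} a(x, ξ) u(y) dy dξ`. -/
def IsPDO (α : ℝ) (a : ℝ → ℝ → ℂ) (A : L2 →L[ℂ] L2) : Prop :=
  ∀ u : 𝓢(ℝ, ℂ), (A (u.toLp 2 volume) : ℝ → ℂ) =ᵐ[volume] fun x =>
    ((α / (2 * Real.pi) : ℝ) : ℂ) *
      ∫ ξ : ℝ, ∫ y : ℝ, Complex.exp (Complex.I * ((α * (x - y) * ξ : ℝ) : ℂ)) * a x ξ * u y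

/-- A pseudo-differential operator is determined by its action on Schwartz functions, so there is
at most one bounded operator with a given symbol. -/
theorem IsPDO.unique {α : ℝ} {a : ℝ → ℝ → ℂ} {A B : L2 →L[ℂ] L2}
    (hA : IsPDO α a A) (hB : IsPDO α a B) : A = B := by
  apply DFunLike.coe_injective
  refine DenseRange.equalizer
    (SchwartzMap.denseRange_toLpCLM (F := ℂ) (p := 2) (μ := (volume : Measure ℝ))
      (by norm_num)) A.continuous B.continuous ?_
  funext u
  apply Lp.ext
  exact (hA u).trans (hB u).symm

/-- The symbol `χ_Ω(ξ)`; the operator `op_α(χ_Ω)` is the spectral projection `P_{Ω, α}`. -/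
def charSymbol (Ω : Set ℝ) : ℝ → ℝ → ℂ := fun _ ξ => Ω.indicator (fun _ => (1 : ℂ)) ξ

/-- The compression `χ_{ℝ₊} P χ_{ℝ₊}` to the half-line `ℝ₊ = (0, ∞)`.  With
`P = P_{Ω, 1} = op_1(χ_Ω)` this is the operator `T(1; ℝ₊, Ω)`. -/
def halfLineCompression (P : L2 →L[ℂ] L2) : L2 →L[ℂ] L2 :=
  restrictTo (Ioi 0) measurableSet_Ioi ∘L P ∘L restrictTo (Ioi 0) measurableSet_Ioi

/-- `g(T)` for a self-adjoint `T` and a complex-valued continuous function `g` on `ℝ`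
(continuous functional calculus; the spectrum of `T` is real). -/
def funOfOp (g : ℝ → ℂ) (T : L2 →L[ℂ] L2) : L2 →L[ℂ] L2 :=
  cfc (fun z : ℂ => g z.re) T

/-- The trace class: operators `A = ∑ₙ ⟨xₙ, ·⟩ yₙ` with `∑ₙ ‖xₙ‖ ‖yₙ‖ < ∞`. -/
def IsTraceClass (A : L2 →L[ℂ] L2) : Prop :=
  ∃ x y : ℕ → L2, Summable (fun n => ‖x n‖ * ‖y n‖) ∧
    ∀ u : L2, HasSum (fun n => ⟪x n, u⟫_ℂ • y n) (A u)

/-- `t` is the trace of `A`: `t = ∑ᵢ ⟨eᵢ, A eᵢ⟩` for every orthonormal (Hilbert) basis. -/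
def HasTrace (A : L2 →L[ℂ] L2) (t : ℂ) : Prop :=
  ∀ (ι : Type) (e : HilbertBasis ι ℂ L2), HasSum (fun i => ⟪e i, A (e i)⟫_ℂ) t

/-- The partial derivative `∂_x^j ∂_ξ^k a (x, ξ)`. -/
def mixedDeriv (j k : ℕ) (a : ℝ → ℝ → ℂ) (x ξ : ℝ) : ℂ :=
  iteratedDeriv j (fun x' => iteratedDeriv k (a x') ξ) x

/-- The class `S^{(n, m)}` of symbols which are bounded together with their partial derivatives
up to order `n` in `x` and up to order `m` in `ξ`.  (Continuity of the derivatives of top order is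
not asked for.) -/
structure IsSymbol (n m : ℕ) (a : ℝ → ℝ → ℂ) : Prop where
  diff_snd : ∀ k < m, ∀ x : ℝ, Differentiable ℝ (iteratedDeriv k (a x))
  diff_fst : ∀ j < n, ∀ k ≤ m, ∀ ξ : ℝ, Differentiable ℝ (fun x => mixedDeriv j k a x ξ)
  bounded : ∀ j ≤ n, ∀ k ≤ m, ∃ M : ℝ, ∀ x ξ : ℝ, ‖mixedDeriv j k a x ξ‖ ≤ M

/-- The norm `N^{(n, m)}(a; ℓ, ρ) = max_{j ≤ n, k ≤ m} sup_{x, ξ} ℓ^j ρ^k |∂_x^j ∂_ξ^k a(x, ξ)|`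
on `S^{(n, m)}`. -/
def symbolNorm (n m : ℕ) (a : ℝ → ℝ → ℂ) (ℓ ρ : ℝ) : ℝ :=
  ⨆ p : Fin (n + 1) × Fin (m + 1), ⨆ z : ℝ × ℝ,
    ℓ ^ (p.1 : ℕ) * ρ ^ (p.2 : ℕ) * ‖mixedDeriv p.1 p.2 a z.1 z.2‖

/-- Smooth cutoffs `0 ≤ ψ ≤ 1` vanishing off `(1, 4r)` and equal to `1` on `(4, r)`. -/
structure IsCutoff (r : ℝ) (ψ : ℝ → ℝ) : Prop where
  smooth : ContDiff ℝ ∞ ψ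
  nonneg : ∀ x, 0 ≤ ψ x
  le_one : ∀ x, ψ x ≤ 1
  eq_zero : ∀ x, x ∉ Ioo 1 (4 * r) → ψ x = 0
  eq_one : ∀ x ∈ Ioo 4 r, ψ x = 1

/-- The coefficient `𝔄(g; b) = (2π)⁻² ∫₀¹ (g(bt) - t g(b)) / (t (1 - t)) dt`. -/
def coeffA (g : ℝ → ℂ) (b : ℝ) : ℂ :=
  (1 / (2 * Real.pi) ^ 2 : ℂ) *
    ∫ t in (0 : ℝ)..1, (g (b * t) - (t : ℂ) * g b) / ((t : ℂ) * (1 - (t : ℂ)))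

end WidomModel

end

noncomputable section

namespace WidomModel

/-! ### Hilbert–Schmidt kernels, trace class products and their traces. -/

open ComplexConjugate

/-! The compression $T_\pm$ commutes with dilations of the half-line, so it becomes a Fourier
multiplier in logarithmic coordinates. With $(Uu)(t)=e^{t/2}u(e^t)$ (`logMap`), $UU^*=1$ and
$U^*U=\chi_+$, one has $T_\pm=U^*\mathcal F^{-1}m_\varepsilon\mathcal F U$ with
$m_\varepsilon(s)=(1+e^{-4\pi^2\varepsilon s})^{-1}$, $\varepsilon=\pm1$
(`halfLineCompression_specProj`). This is checked on quadratic forms: in logarithmic variables the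
Fourier transform is a convolution with $e^{t/2}\exp(-ze^t)$ at $z=2\pi i\varepsilon$, whose
multiplier is $z^{-1/2+2\pi is}\,\Gamma(1/2-2\pi is)$, and $|\Gamma(1/2-iy)|^2=\pi/\cosh\pi y$.

Hence $g(T_\pm)$ is the Mellin multiplier with symbol $h=g\circ m_\varepsilon$
(`funOfOp_mellinMul`), with kernel $k(y,x)=(xy)^{-1/2}\,\check h(\log(y/x))$ on the quarter plane,
where $\check h=\mathcal F^{-1}h$. Near the diagonal $k\approx x^{-1}\int h$, and the substitution
$t=m_\varepsilon(s)$ turns $\int h$ into $\mathfrak A(g)$ (`integral_comp_mellinSymbol`). Since $g$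
is $C^1$ and vanishes at $0$ and $1$, both $h$ and $h'$ decay rapidly (`exists_isDecaying`).

The operator with symbol $b$ has kernel $\psi(x)A(x,x-y)$, with $A(x,\cdot)$ of mass $a(x,0)$ and
decay $\sigma(1+\sigma|z|)^{-2}$, $\sigma=\alpha\rho$. Its product with $g(T_\pm)$ splits into two
Hilbert–Schmidt operators: the decay of $h,h'$ supplies square integrability in $s$, and one
derivative in $s$ supplies it in $t$. So the product is trace class with trace $\int\psi(x)\int
A(x,x-y)k(y,x)\,dy\,dx$ (`IsLocalKernel.isTraceClass_hasTrace`).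

Three replacements evaluate this integral (`IsConvKernel.norm_integral_rowTrace_sub_le`). Freezing
$k(y,x)$ to $x^{-1}\int h$ costs $O(\sigma^{-1/2}x^{-3/2})$, integrable on $x>1$. Replacing $a(x,0)$
by $a(0,0)$ costs $O(x/L)$ against $dx/x$ on $(1,4r)$, that is $O(r/L)$. Finally
$\int\psi(x)\,dx/x=\log r+O(1)$. -/

theorem norm_sq_eq_integral (u : L2) : ‖u‖ ^ 2 = ∫ x, ‖u x‖ ^ 2 := by
  have h := inner_self_eq_norm_sq_to_K (𝕜 := ℂ) u
  rw [L2.inner_def] at h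
  have h2 : ∀ x, inner ℂ (u x) (u x) = ((‖u x‖ ^ 2 : ℝ) : ℂ) := fun x => by
    rw [inner_self_eq_norm_sq_to_K]; simp
  simp_rw [h2] at h
  rw [integral_complex_ofReal] at h
  exact Complex.ofReal_injective (by rw [h]; simp)

theorem integrable_norm_sq (u : L2) : Integrable (fun x => ‖u x‖ ^ 2) :=
  (memLp_two_iff_integrable_sq_norm (Lp.memLp u).1).1 (Lp.memLp u)

theorem inner_toLp_left {f : ℝ → ℂ} (hf : MemLp f 2 volume) (u : L2) :
    ⟪hf.toLp f, u⟫_ℂ = ∫ x, conj (f x) * u x := by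
  rw [L2.inner_def]
  refine integral_congr_ae ?_
  filter_upwards [hf.coeFn_toLp] with x hx
  rw [hx, RCLike.inner_apply, mul_comm]

/-- A measurable kernel dominated by a product of two square integrable functions. -/
structure IsHSKernel (k : ℝ → ℝ → ℂ) (a b : ℝ → ℝ) : Prop where
  meas : StronglyMeasurable (Function.uncurry k)
  left : MemLp a 2 volume
  right : MemLp b 2 volume
  bound : ∀ x y, ‖k x y‖ ≤ a x * b y

namespace IsHSKernel

variable {k : ℝ → ℝ → ℂ} {a b : ℝ → ℝ}

theorem conj_flip (hk : IsHSKernel k a b) : IsHSKernel (fun y x => conj (k x y)) b a where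
  meas := Complex.continuous_conj.comp_stronglyMeasurable
    (hk.meas.comp_measurable measurable_swap)
  left := hk.right
  right := hk.left
  bound y x := by rw [RCLike.norm_conj, mul_comm]; exact hk.bound x y

theorem stronglyMeasurable_row (hk : IsHSKernel k a b) (x : ℝ) : StronglyMeasurable (k x) :=
  hk.meas.comp_measurable measurable_prodMk_left

theorem memLp_row (hk : IsHSKernel k a b) (x : ℝ) : MemLp (k x) 2 volume :=
  (hk.right.const_mul (a x)).mono' (hk.stronglyMeasurable_row x).aestronglyMeasurable
    (Filter.Eventually.of_forall (hk.bound x))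

theorem memLp_conj_row (hk : IsHSKernel k a b) (x : ℝ) :
    MemLp (fun y => conj (k x y)) 2 volume := (hk.memLp_row x).star

theorem integral_row_mul (hk : IsHSKernel k a b) (u : L2) (x : ℝ) :
    ∫ y, k x y * u y = ⟪(hk.memLp_conj_row x).toLp _, u⟫_ℂ := by
  rw [inner_toLp_left]
  simp

theorem norm_conj_row_le (hk : IsHSKernel k a b) (x : ℝ) :
    ‖(hk.memLp_conj_row x).toLp _‖ ≤ |a x| * ‖hk.right.toLp b‖ := by
  have : ‖(hk.memLp_conj_row x).toLp _‖ ≤ ‖(a x) • hk.right.toLp b‖ := by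
    apply Lp.norm_le_norm_of_ae_le
    filter_upwards [(hk.memLp_conj_row x).coeFn_toLp, Lp.coeFn_smul (a x) (hk.right.toLp b),
      hk.right.coeFn_toLp] with y h1 h2 h3
    rw [h1, h2, Pi.smul_apply, h3, RCLike.norm_conj, smul_eq_mul]
    exact (hk.bound x y).trans (le_abs_self _)
  rwa [norm_smul] at this

theorem norm_integral_row_le (hk : IsHSKernel k a b) (u : L2) (x : ℝ) :
    ‖∫ y, k x y * u y‖ ≤ |a x| * (‖hk.right.toLp b‖ * ‖u‖) := by
  rw [hk.integral_row_mul, ← mul_assoc]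
  exact (norm_inner_le_norm _ _).trans
    (mul_le_mul_of_nonneg_right (hk.norm_conj_row_le x) (norm_nonneg _))

theorem stronglyMeasurable_integral_row (hk : IsHSKernel k a b) (u : L2) :
    StronglyMeasurable fun x => ∫ y, k x y * u y := by
  refine StronglyMeasurable.integral_prod_right (f := fun x y => k x y * u y) ?_
  exact hk.meas.mul ((Lp.stronglyMeasurable u).comp_measurable measurable_snd)

theorem memLp_integral_row (hk : IsHSKernel k a b) (u : L2) :
    MemLp (fun x => ∫ y, k x y * u y) 2 volume := by
  refine (hk.left.abs.mul_const (‖hk.right.toLp b‖ * ‖u‖)).mono'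
    (hk.stronglyMeasurable_integral_row u).aestronglyMeasurable
    (Filter.Eventually.of_forall fun x => ?_)
  exact hk.norm_integral_row_le u x

/-- The Hilbert–Schmidt operator with kernel `k`. -/
def op (hk : IsHSKernel k a b) : L2 →L[ℂ] L2 :=
  LinearMap.mkContinuous
    { toFun := fun u => (hk.memLp_integral_row u).toLp _
      map_add' := fun u v => by
        rw [← MemLp.toLp_add, MemLp.toLp_eq_toLp_iff]
        refine Filter.Eventually.of_forall fun x => ?_
        simp only [Pi.add_apply]
        rw [hk.integral_row_mul, hk.integral_row_mul, hk.integral_row_mul, inner_add_right]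
      map_smul' := fun c u => by
        rw [RingHom.id_apply, ← MemLp.toLp_const_smul, MemLp.toLp_eq_toLp_iff]
        refine Filter.Eventually.of_forall fun x => ?_
        simp only [Pi.smul_apply]
        rw [hk.integral_row_mul, hk.integral_row_mul, inner_smul_right, smul_eq_mul] }
    (‖hk.left.toLp a‖ * ‖hk.right.toLp b‖) (fun u => by
      have : ‖(hk.memLp_integral_row u).toLp _‖ ≤
          ‖(‖hk.right.toLp b‖ * ‖u‖) • hk.left.toLp a‖ := by
        apply Lp.norm_le_norm_of_ae_le
        filter_upwards [(hk.memLp_integral_row u).coeFn_toLp,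
          Lp.coeFn_smul (‖hk.right.toLp b‖ * ‖u‖) (hk.left.toLp a), hk.left.coeFn_toLp]
          with y h1 h2 h3
        rw [h1, h2, Pi.smul_apply, h3, smul_eq_mul, norm_mul, Real.norm_eq_abs, Real.norm_eq_abs,
          abs_of_nonneg (by positivity), mul_comm]
        exact hk.norm_integral_row_le u y
      rw [norm_smul, Real.norm_of_nonneg (by positivity)] at this
      calc _ ≤ _ := this
        _ = _ := by ring)

theorem coeFn_op (hk : IsHSKernel k a b) (u : L2) :
    (hk.op u : ℝ → ℂ) =ᵐ[volume] fun x => ∫ y, k x y * u y :=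
  (hk.memLp_integral_row u).coeFn_toLp

theorem norm_op_sq (hk : IsHSKernel k a b) (u : L2) :
    ‖hk.op u‖ ^ 2 = ∫ x, ‖⟪(hk.memLp_conj_row x).toLp _, u⟫_ℂ‖ ^ 2 := by
  rw [norm_sq_eq_integral]
  refine integral_congr_ae ?_
  filter_upwards [hk.coeFn_op u] with x hx
  rw [hx, hk.integral_row_mul]

theorem integrable_norm_inner_sq (hk : IsHSKernel k a b) (u : L2) :
    Integrable fun x => ‖⟪(hk.memLp_conj_row x).toLp _, u⟫_ℂ‖ ^ 2 := by
  refine (integrable_norm_sq (hk.op u)).congr ?_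
  filter_upwards [hk.coeFn_op u] with x hx
  rw [hx, hk.integral_row_mul]

/-- Fubini, with the product bound on the kernel as integrable majorant: the conjugate transposed
kernel gives the adjoint. -/
theorem inner_op_conj_flip (hk : IsHSKernel k a b) (u v : L2) :
    ⟪hk.conj_flip.op u, v⟫_ℂ = ⟪u, hk.op v⟫_ℂ := by
  have h1 : ⟪hk.conj_flip.op u, v⟫_ℂ = ∫ y, ∫ x, conj (u x) * k x y * v y := by
    rw [L2.inner_def]
    refine integral_congr_ae ?_
    filter_upwards [hk.conj_flip.coeFn_op u] with y hy
    rw [hy, RCLike.inner_apply, ← integral_conj, mul_comm, ← integral_mul_const]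
    congr 1; ext x; simp only [map_mul, RCLike.conj_conj]; ring
  have h2 : ⟪u, hk.op v⟫_ℂ = ∫ x, ∫ y, conj (u x) * k x y * v y := by
    rw [L2.inner_def]
    refine integral_congr_ae ?_
    filter_upwards [hk.coeFn_op v] with x hx
    rw [hx, RCLike.inner_apply, mul_comm, ← integral_const_mul]
    congr 1; ext y; ring
  rw [h1, h2, integral_integral_swap]
  refine Integrable.mono' (g := fun z : ℝ × ℝ => (‖v z.1‖ * |b z.1|) * (‖u z.2‖ * |a z.2|)) ?_ ?_ ?_
  · exact Integrable.mul_prod ((Lp.memLp v).norm.integrable_mul hk.right.abs)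
      ((Lp.memLp u).norm.integrable_mul hk.left.abs)
  · refine StronglyMeasurable.aestronglyMeasurable ?_
    refine StronglyMeasurable.mul (StronglyMeasurable.mul ?_ ?_) ?_
    · exact Complex.continuous_conj.comp_stronglyMeasurable
        ((Lp.stronglyMeasurable u).comp_measurable measurable_snd)
    · exact hk.meas.comp_measurable measurable_swap
    · exact (Lp.stronglyMeasurable v).comp_measurable measurable_fst
  · refine Filter.Eventually.of_forall fun z => ?_
    simp only [Function.uncurry, norm_mul, RCLike.norm_conj]
    have := (hk.bound z.2 z.1).trans (le_abs_self _)
    rw [abs_mul] at this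
    calc _ ≤ ‖u z.2‖ * (|a z.2| * |b z.1|) * ‖v z.1‖ := by gcongr
      _ = _ := by ring

/-- Bessel's inequality for each row of the kernel, integrated over the row variable. -/
theorem summable_norm_op_sq (hk : IsHSKernel k a b) {ι : Type*} {e : ι → L2}
    (he : Orthonormal ℂ e) : Summable fun i => ‖hk.op (e i)‖ ^ 2 := by
  refine summable_of_sum_le (c := ∫ x, |a x| ^ 2 * ‖hk.right.toLp b‖ ^ 2)
    (fun i => by positivity) fun s => ?_
  simp_rw [hk.norm_op_sq]
  rw [← integral_finsetSum _ fun i _ => hk.integrable_norm_inner_sq (e i)]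
  refine integral_mono (integrable_finsetSum _ fun i _ => hk.integrable_norm_inner_sq (e i)) ?_
    fun x => ?_
  · simp only [sq_abs]
    exact hk.left.integrable_sq.mul_const _
  · simp only
    rw [← mul_pow]
    calc _ = ∑ i ∈ s, ‖⟪e i, (hk.memLp_conj_row x).toLp _⟫_ℂ‖ ^ 2 := by
          refine Finset.sum_congr rfl fun i _ => ?_
          rw [norm_inner_symm]
      _ ≤ _ := he.sum_inner_products_le _
      _ ≤ _ := by gcongr; exact hk.norm_conj_row_le x

end IsHSKernel

/-- Balls of radius $1/2$ around the vectors are disjoint open sets in a separable space. Traces are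
taken over arbitrary Hilbert bases, and exchanging their sums with integrals needs a countable
index. -/
theorem countable_of_orthonormal {ι : Type*} {e : ι → L2} (he : Orthonormal ℂ e) :
    Countable ι := by
  have : Fact ((2 : ENNReal) ≠ ⊤) := ⟨by norm_num⟩
  have hd : ∀ i j, i ≠ j → 1 ≤ dist (e i) (e j) := fun i j hij => by
    have h := norm_sub_sq (𝕜 := ℂ) (e i) (e j)
    rw [he.1 i, he.1 j, he.2 hij] at h
    rw [dist_eq_norm]
    simp only [map_zero, mul_zero, sub_zero] at h
    nlinarith [norm_nonneg (e i - e j)]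
  have : (univ : Set ι).Countable := by
    refine Set.PairwiseDisjoint.countable_of_isOpen (s := fun i => Metric.ball (e i) (1 / 2))
      (fun i _ j _ hij => ?_) (fun i _ => Metric.isOpen_ball)
      (fun i _ => ⟨e i, Metric.mem_ball_self (by norm_num)⟩)
    exact Metric.ball_disjoint_ball (by linarith [hd i j hij])
  exact countable_univ_iff.1 this

section Trace

variable {k₁ k₂ : ℝ → ℝ → ℂ} {a₁ b₁ a₂ b₂ : ℝ → ℝ}

theorem summable_norm_mul_norm {ι : Type*} {f g : ι → ℝ} (hf : Summable fun i => f i ^ 2)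
    (hg : Summable fun i => g i ^ 2) (hf0 : ∀ i, 0 ≤ f i) (hg0 : ∀ i, 0 ≤ g i) :
    Summable fun i => f i * g i := by
  refine Summable.of_nonneg_of_le (fun i => mul_nonneg (hf0 i) (hg0 i)) (fun i => ?_) (hf.add hg)
  nlinarith [sq_nonneg (f i - g i), sq_nonneg (f i + g i)]

/-- Expanding in an orthonormal basis, $AB=\sum_i\langle B^*e_i,\cdot\rangle Ae_i$, and
Cauchy–Schwarz sums the norms. The countable index is embedded in $\mathbb N$ and padded by zeros.
-/
theorem isTraceClass_op_comp_op (h₁ : IsHSKernel k₁ a₁ b₁) (h₂ : IsHSKernel k₂ a₂ b₂) :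
    IsTraceClass (h₁.op ∘L h₂.op) := by
  obtain ⟨w, e, -⟩ := exists_hilbertBasis ℂ L2
  have : Countable w := countable_of_orthonormal e.orthonormal
  obtain ⟨φ, hφ⟩ := exists_injective_nat w
  have hext : ∀ (F : L2 → L2 → ℝ), (∀ y, F 0 y = 0) →
      ∀ n ∉ range φ, F (Function.extend φ (fun i => h₂.conj_flip.op (e i)) 0 n)
        (Function.extend φ (fun i => h₁.op (e i)) 0 n) = 0 := fun F hF n hn => by
    rw [Function.extend_apply' _ _ _ (by simpa using hn)]; exact hF _
  refine ⟨Function.extend φ (fun i => h₂.conj_flip.op (e i)) 0,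
    Function.extend φ (fun i => h₁.op (e i)) 0, ?_, fun u => ?_⟩
  · rw [← hφ.summable_iff]
    · simp only [Function.comp_def, hφ.extend_apply]
      exact summable_norm_mul_norm (h₂.conj_flip.summable_norm_op_sq e.orthonormal)
        (h₁.summable_norm_op_sq e.orthonormal) (fun _ => norm_nonneg _) (fun _ => norm_nonneg _)
    · exact hext (fun x y => ‖x‖ * ‖y‖) (by simp)
  · rw [← hφ.hasSum_iff]
    · simp only [Function.comp_def, hφ.extend_apply, h₂.inner_op_conj_flip]
      have := (e.hasSum_repr (h₂.op u)).mapL h₁.op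
      simpa [e.repr_apply_apply] using this
    · intro n hn
      rw [Function.extend_apply' _ _ _ (by simpa using hn)]; simp

/-- For fixed $s$ the sum over the basis is Parseval's identity for row $s$ of $k_2$ and column $s$
of $k_1$; Hilbert–Schmidt summability permits summing under the integral over $s$. -/
theorem hasTrace_op_comp_op (h₁ : IsHSKernel k₁ a₁ b₁) (h₂ : IsHSKernel k₂ a₂ b₂) :
    HasTrace (h₁.op ∘L h₂.op) (∫ s, ∫ x, k₂ s x * k₁ x s) := by
  intro ι e
  have : Countable ι := countable_of_orthonormal e.orthonormal
  set F : ι → ℝ → ℂ := fun i s => ⟪(h₂.memLp_conj_row s).toLp _, e i⟫_ℂ *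
    ⟪e i, (h₁.conj_flip.memLp_conj_row s).toLp _⟫_ℂ with hF
  have hFae : ∀ i, (fun s => ⟪h₁.conj_flip.op (e i) s, h₂.op (e i) s⟫_ℂ) =ᵐ[volume] F i := by
    intro i
    filter_upwards [h₁.conj_flip.coeFn_op (e i), h₂.coeFn_op (e i)] with s hs1 hs2
    rw [hs1, hs2, RCLike.inner_apply, h₁.conj_flip.integral_row_mul, h₂.integral_row_mul,
      inner_conj_symm]
  have hFint : ∀ i, Integrable (F i) := fun i =>
    (L2.integrable_inner (𝕜 := ℂ) _ _).congr (hFae i)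
  have hFtrace : ∀ i, ⟪e i, (h₁.op ∘L h₂.op) (e i)⟫_ℂ = ∫ s, F i s := by
    intro i
    rw [ContinuousLinearMap.comp_apply, ← h₁.inner_op_conj_flip, L2.inner_def]
    exact integral_congr_ae (hFae i)
  simp_rw [hFtrace]
  have hsum : Summable fun i => ∫ s, ‖F i s‖ := by
    refine Summable.of_nonneg_of_le (fun i => by positivity) (fun i => ?_)
      ((h₂.summable_norm_op_sq e.orthonormal).add
        (h₁.conj_flip.summable_norm_op_sq e.orthonormal))
    rw [h₂.norm_op_sq, h₁.conj_flip.norm_op_sq, ← integral_add (h₂.integrable_norm_inner_sq _)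
      (h₁.conj_flip.integrable_norm_inner_sq _)]
    refine integral_mono (hFint i).norm ((h₂.integrable_norm_inner_sq _).add
      (h₁.conj_flip.integrable_norm_inner_sq _)) fun s => ?_
    simp only [hF, norm_mul]
    rw [norm_inner_symm (e i)]
    nlinarith [norm_nonneg ⟪(h₂.memLp_conj_row s).toLp _, e i⟫_ℂ,
      norm_nonneg ⟪(h₁.conj_flip.memLp_conj_row s).toLp _, e i⟫_ℂ,
      sq_nonneg (‖⟪(h₂.memLp_conj_row s).toLp _, e i⟫_ℂ‖ -
        ‖⟪(h₁.conj_flip.memLp_conj_row s).toLp _, e i⟫_ℂ‖),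
      sq_nonneg (‖⟪(h₂.memLp_conj_row s).toLp _, e i⟫_ℂ‖ +
        ‖⟪(h₁.conj_flip.memLp_conj_row s).toLp _, e i⟫_ℂ‖)]
  have hpt : ∀ s, ∫ x, k₂ s x * k₁ x s = ∑' i, F i s := fun s => by
    simp only [hF]
    rw [e.tsum_inner_mul_inner, inner_toLp_left]
    refine integral_congr_ae ?_
    filter_upwards [(h₁.conj_flip.memLp_conj_row s).coeFn_toLp] with x hx
    rw [hx]; simp
  simp_rw [hpt]
  exact hasSum_integral_of_summable_integral_norm hFint hsum

end Trace

/-! ### The $L^2$ Fourier transform, multiplication operators and momentum projections. -/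

open ComplexConjugate FourierTransform

theorem locallyIntegrable_coeFn (u : L2) : LocallyIntegrable (u : ℝ → ℂ) volume :=
  (Lp.memLp u).locallyIntegrable (by norm_num)

theorem exists_schwartzMap_eq (g : ℝ → ℝ) (hg : ContDiff ℝ ∞ g) (hgc : HasCompactSupport g) :
    ∃ φ : 𝓢(ℝ, ℂ), ∀ x, φ x = (g x : ℂ) := by
  have hφ : HasCompactSupport (fun x => (g x : ℂ)) := hgc.comp_left (g := fun y : ℝ => (y : ℂ)) Complex.ofReal_zero
  have hφs : ContDiff ℝ ∞ (fun x => (g x : ℂ)) := Complex.ofRealCLM.contDiff.comp hg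
  exact ⟨hφ.toSchwartzMap hφs, fun x => rfl⟩

theorem ae_eq_of_integral_schwartz_mul {u w : ℝ → ℂ} (hu : LocallyIntegrable u volume)
    (hw : LocallyIntegrable w volume)
    (h : ∀ φ : 𝓢(ℝ, ℂ), ∫ x, φ x * u x = ∫ x, φ x * w x) : u =ᵐ[volume] w := by
  refine ae_eq_of_integral_contDiff_smul_eq hu hw fun g hg hgc => ?_
  obtain ⟨φ, hφ⟩ := exists_schwartzMap_eq g hg hgc
  simpa only [hφ, Complex.real_smul] using h φ

theorem continuous_fourier {f : ℝ → ℂ} (hf : Integrable f) : Continuous (𝓕 f) :=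
  VectorFourier.fourierIntegral_continuous Real.continuous_fourierChar
    (by exact continuous_inner) hf

theorem continuous_fourierInv {f : ℝ → ℂ} (hf : Integrable f) : Continuous (𝓕⁻ f) := by
  rw [show (𝓕⁻ f) = fun x => 𝓕 f (-x) from funext fun x => Real.fourierInv_eq_fourier_neg f x]
  exact (continuous_fourier hf).comp continuous_neg

theorem integral_fourier_mul_eq {f g : ℝ → ℂ} (hf : Integrable f) (hg : Integrable g) :
    ∫ x, 𝓕 f x * g x = ∫ x, f x * 𝓕 g x := by
  have := VectorFourier.integral_fourierIntegral_smul_eq_flip (L := innerₗ ℝ)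
    (μ := (volume : Measure ℝ)) (ν := volume)
    (e := Real.fourierChar) Real.continuous_fourierChar (by exact continuous_inner) hf hg
  rw [flip_innerₗ] at this
  exact this

theorem integral_fourierInv_mul_eq {f g : ℝ → ℂ} (hf : Integrable f) (hg : Integrable g) :
    ∫ x, 𝓕⁻ f x * g x = ∫ x, f x * 𝓕⁻ g x := by
  have h := integral_fourier_mul_eq hf hg.comp_neg
  rw [← integral_neg_eq_self] at h
  simp only [neg_neg] at h
  simp_rw [Real.fourierInv_eq_fourier_neg f]
  rw [h]
  simp_rw [Real.fourierInv_eq_fourier_comp_neg g]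

/-- The $L^2$ transform and the integral formula define the same tempered distribution: both move
onto the test function. -/
theorem coeFn_fourier_toLp {f : ℝ → ℂ} (h1 : Integrable f) (h2 : MemLp f 2 volume) :
    (𝓕 (h2.toLp f) : L2) =ᵐ[volume] 𝓕 f := by
  refine ae_eq_of_integral_schwartz_mul (locallyIntegrable_coeFn _)
    (continuous_fourier h1).locallyIntegrable fun φ => ?_
  have key := DFunLike.congr_fun (Lp.fourier_toTemperedDistribution_eq (h2.toLp f)) φ
  rw [TemperedDistribution.fourier_apply, Lp.toTemperedDistribution_apply,
    Lp.toTemperedDistribution_apply] at key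
  simp only [smul_eq_mul] at key
  rw [← key, ← integral_fourier_mul_eq φ.integrable h1]
  refine integral_congr_ae ?_
  filter_upwards [h2.coeFn_toLp] with x hx
  rw [hx, SchwartzMap.fourier_coe]

theorem coeFn_fourierInv_toLp {f : ℝ → ℂ} (h1 : Integrable f) (h2 : MemLp f 2 volume) :
    (𝓕⁻ (h2.toLp f) : L2) =ᵐ[volume] 𝓕⁻ f := by
  refine ae_eq_of_integral_schwartz_mul (locallyIntegrable_coeFn _)
    (continuous_fourierInv h1).locallyIntegrable fun φ => ?_
  have key := DFunLike.congr_fun (Lp.fourierInv_toTemperedDistribution_eq (h2.toLp f)) φ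
  rw [TemperedDistribution.fourierInv_apply, Lp.toTemperedDistribution_apply,
    Lp.toTemperedDistribution_apply] at key
  simp only [smul_eq_mul] at key
  rw [← key, ← integral_fourierInv_mul_eq φ.integrable h1]
  refine integral_congr_ae ?_
  filter_upwards [h2.coeFn_toLp] with x hx
  rw [hx, SchwartzMap.fourierInv_coe]

/-- The Fourier transform as a bounded operator. -/
def fourierCLM : L2 →L[ℂ] L2 :=
  ((Lp.fourierTransformₗᵢ ℝ ℂ).toContinuousLinearEquiv : L2 →L[ℂ] L2)

/-- The inverse Fourier transform as a bounded operator. -/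
def fourierInvCLM : L2 →L[ℂ] L2 :=
  ((Lp.fourierTransformₗᵢ ℝ ℂ).symm.toContinuousLinearEquiv : L2 →L[ℂ] L2)

theorem fourierCLM_apply (u : L2) : fourierCLM u = 𝓕 u := rfl

theorem fourierInvCLM_apply (u : L2) : fourierInvCLM u = 𝓕⁻ u := rfl

theorem fourierCLM_fourierInvCLM (u : L2) : fourierCLM (fourierInvCLM u) = u :=
  (Lp.fourierTransformₗᵢ ℝ ℂ).apply_symm_apply u

theorem fourierInvCLM_fourierCLM (u : L2) : fourierInvCLM (fourierCLM u) = u :=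
  (Lp.fourierTransformₗᵢ ℝ ℂ).symm_apply_apply u

theorem inner_fourierInvCLM (u v : L2) : ⟪u, fourierInvCLM v⟫_ℂ = ⟪fourierCLM u, v⟫_ℂ := by
  conv_rhs => rw [← fourierCLM_fourierInvCLM v]
  exact ((Lp.fourierTransformₗᵢ ℝ ℂ).inner_map_map u _).symm

/-- A bounded measurable function on the line. -/
structure IsBddMeas (φ : ℝ → ℂ) (C : ℝ) : Prop where
  meas : StronglyMeasurable φ
  bound : ∀ x, ‖φ x‖ ≤ C

namespace IsBddMeas

variable {φ : ℝ → ℂ} {C : ℝ}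

theorem nonneg (h : IsBddMeas φ C) : 0 ≤ C := (norm_nonneg _).trans (h.bound 0)

theorem memLp_mul (h : IsBddMeas φ C) {f : ℝ → ℂ} {p : ℝ≥0∞} (hf : MemLp f p volume) :
    MemLp (fun x => φ x * f x) p volume := by
  refine (hf.norm.const_mul C).mono' (h.meas.aestronglyMeasurable.mul hf.1)
    (Filter.Eventually.of_forall fun x => ?_)
  rw [norm_mul]
  exact mul_le_mul_of_nonneg_right (h.bound x) (norm_nonneg _)

/-- Multiplication by a bounded measurable function. -/
def mulOp (h : IsBddMeas φ C) : L2 →L[ℂ] L2 :=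
  LinearMap.mkContinuous
    { toFun := fun u => (h.memLp_mul (Lp.memLp u)).toLp _
      map_add' := fun u v => by
        rw [← MemLp.toLp_add, MemLp.toLp_eq_toLp_iff]
        filter_upwards [Lp.coeFn_add u v] with x hx
        simp only [hx, Pi.add_apply, mul_add]
      map_smul' := fun c u => by
        rw [RingHom.id_apply, ← MemLp.toLp_const_smul, MemLp.toLp_eq_toLp_iff]
        filter_upwards [Lp.coeFn_smul c u] with x hx
        simp only [hx, Pi.smul_apply, smul_eq_mul]
        ring }
    C (fun u => by
      have : ‖(h.memLp_mul (Lp.memLp u)).toLp _‖ ≤ ‖C • u‖ := by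
        apply Lp.norm_le_norm_of_ae_le
        filter_upwards [(h.memLp_mul (Lp.memLp u)).coeFn_toLp, Lp.coeFn_smul C u] with y h1 h2
        rw [h1, h2, Pi.smul_apply, norm_mul, norm_smul, Real.norm_of_nonneg h.nonneg]
        exact mul_le_mul_of_nonneg_right (h.bound y) (norm_nonneg _)
      rwa [norm_smul, Real.norm_of_nonneg h.nonneg] at this)

theorem coeFn_mulOp (h : IsBddMeas φ C) (u : L2) :
    (h.mulOp u : ℝ → ℂ) =ᵐ[volume] fun x => φ x * u x :=
  (h.memLp_mul (Lp.memLp u)).coeFn_toLp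

theorem mulOp_toLp (h : IsBddMeas φ C) {f : ℝ → ℂ} (hf : MemLp f 2 volume) :
    h.mulOp (hf.toLp f) = (h.memLp_mul hf).toLp _ := by
  apply Lp.ext
  filter_upwards [h.coeFn_mulOp (hf.toLp f), hf.coeFn_toLp, (h.memLp_mul hf).coeFn_toLp]
    with x h1 h2 h3
  rw [h1, h2, h3]

end IsBddMeas

theorem isBddMeas_indicator {Ω : Set ℝ} (hΩ : MeasurableSet Ω) :
    IsBddMeas (Ω.indicator fun _ => (1 : ℂ)) 1 where
  meas := stronglyMeasurable_const.indicator hΩ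
  bound x := by
    refine (norm_indicator_le_norm_self _ _).trans (by simp)

/-- The spectral projection of the momentum operator for the set `Ω`. -/
def specProj (Ω : Set ℝ) (hΩ : MeasurableSet Ω) : L2 →L[ℂ] L2 :=
  fourierInvCLM ∘L (isBddMeas_indicator hΩ).mulOp ∘L fourierCLM

/-- The symbol calculus uses $e^{i(x-y)\xi}$ while $\mathcal F$ uses $e^{-2\pi iy\eta}$; a set
invariant under positive dilations does not see the change $\xi=2\pi\eta$. -/
theorem isPDO_specProj {Ω : Set ℝ} (hΩ : MeasurableSet Ω)
    (hscale : ∀ c : ℝ, 0 < c → ∀ x, c * x ∈ Ω ↔ x ∈ Ω) :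
    IsPDO 1 (charSymbol Ω) (specProj Ω hΩ) := by
  intro u
  set v : ℝ → ℂ := fun ξ => Ω.indicator (fun _ => (1 : ℂ)) ξ * (𝓕 u) ξ with hv
  have hv2 : MemLp v 2 volume := (isBddMeas_indicator hΩ).memLp_mul ((𝓕 u).memLp 2 volume)
  have hv1 : Integrable v := by
    rw [← memLp_one_iff_integrable]
    exact (isBddMeas_indicator hΩ).memLp_mul ((𝓕 u).memLp 1 volume)
  have h0 : specProj Ω hΩ (u.toLp 2 volume) = 𝓕⁻ (hv2.toLp v) := by
    simp only [specProj, ContinuousLinearMap.comp_apply, fourierCLM_apply, fourierInvCLM_apply]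
    rw [SchwartzMap.toLp_fourier_eq]
    congr 1
    exact (isBddMeas_indicator hΩ).mulOp_toLp ((𝓕 u).memLp 2 volume)
  rw [h0]
  filter_upwards [coeFn_fourierInv_toLp hv1 hv2] with x hx
  rw [hx]
  have h1 : ∀ ξ : ℝ, (∫ y : ℝ, Complex.exp (Complex.I * ((1 * (x - y) * ξ : ℝ) : ℂ)) *
      charSymbol Ω x ξ * u y) =
      Complex.exp (Complex.I * ((x * ξ : ℝ) : ℂ)) * v (ξ / (2 * Real.pi)) := fun ξ => by
    have hind : Ω.indicator (fun _ => (1 : ℂ)) (ξ / (2 * Real.pi)) =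
        Ω.indicator (fun _ => (1 : ℂ)) ξ := by
      have := hscale (2 * Real.pi)⁻¹ (by positivity) ξ
      rw [inv_mul_eq_div] at this
      by_cases h : ξ ∈ Ω
      · rw [indicator_of_mem h, indicator_of_mem (this.2 h)]
      · rw [indicator_of_notMem h, indicator_of_notMem (fun h' => h (this.1 h'))]
    simp only [hv, charSymbol, hind]
    rw [SchwartzMap.fourier_coe, Real.fourier_real_eq_integral_exp_smul, ← mul_assoc,
      ← integral_const_mul]
    congr 1; ext y
    have hexp : Complex.exp (Complex.I * ((1 * (x - y) * ξ : ℝ) : ℂ)) =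
        Complex.exp (Complex.I * ((x * ξ : ℝ) : ℂ)) *
          Complex.exp (((-2 * Real.pi * y * (ξ / (2 * Real.pi)) : ℝ) : ℂ) * Complex.I) := by
      rw [← Complex.exp_add]
      congr 1
      push_cast
      field_simp
      ring
    rw [smul_eq_mul, hexp]
    ring
  simp_rw [h1]
  have h2 : ∀ ξ : ℝ, Complex.exp (Complex.I * ((x * ξ : ℝ) : ℂ)) * v (ξ / (2 * Real.pi)) =
      (fun η : ℝ => Complex.exp (2 * Real.pi * Complex.I * (η * x)) * v η)
        (ξ / (2 * Real.pi)) := fun ξ => by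
    simp only
    congr 2
    push_cast
    field_simp
  simp_rw [h2]
  rw [Measure.integral_comp_div (fun η : ℝ =>
    Complex.exp (2 * Real.pi * Complex.I * (η * x)) * v η) (2 * Real.pi),
    abs_of_pos (by positivity), Real.fourierInv_eq']
  rw [Complex.real_smul, ← mul_assoc, ← Complex.ofReal_mul, one_div,
    inv_mul_cancel₀ (by positivity), Complex.ofReal_one, one_mul]
  congr 1; ext η
  rw [smul_eq_mul]
  congr 2
  simp
  ring

theorem inner_specProj {Ω : Set ℝ} (hΩ : MeasurableSet Ω) (u v : L2) :
    ⟪u, specProj Ω hΩ v⟫_ℂ = ∫ ξ in Ω, conj ((𝓕 u : L2) ξ) * (𝓕 v : L2) ξ := by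
  rw [specProj, ContinuousLinearMap.comp_apply, inner_fourierInvCLM, L2.inner_def,
    ← integral_indicator hΩ]
  refine integral_congr_ae ?_
  filter_upwards [(isBddMeas_indicator hΩ).coeFn_mulOp (fourierCLM v)] with ξ hξ
  rw [ContinuousLinearMap.comp_apply, hξ, RCLike.inner_apply, fourierCLM_apply, fourierCLM_apply]
  by_cases h : ξ ∈ Ω
  · simp [h, mul_comm]
  · simp [h]

/-! ### The substitution $y=e^t$. -/

section ExpSubstitution

variable {E : Type*} [NormedAddCommGroup E] [NormedSpace ℝ E]

theorem image_exp_univ : Real.exp '' univ = Ioi 0 := by rw [image_univ, Real.range_exp]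

theorem integral_comp_exp (g : ℝ → E) :
    ∫ t, Real.exp t • g (Real.exp t) = ∫ y in Ioi 0, g y := by
  have h := integral_image_eq_integral_abs_deriv_smul (f := Real.exp) (f' := Real.exp)
    MeasurableSet.univ (fun x _ => (Real.hasDerivAt_exp x).hasDerivWithinAt)
    Real.exp_injective.injOn g
  rw [image_exp_univ] at h
  rw [h]
  simp [abs_of_pos (Real.exp_pos _)]

theorem integrable_comp_exp {g : ℝ → E} :
    Integrable (fun t => Real.exp t • g (Real.exp t)) ↔ IntegrableOn g (Ioi 0) := by
  have h := integrableOn_image_iff_integrableOn_abs_deriv_smul (f := Real.exp) (f' := Real.exp)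
    MeasurableSet.univ (fun x _ => (Real.hasDerivAt_exp x).hasDerivWithinAt)
    Real.exp_injective.injOn g
  rw [image_exp_univ] at h
  rw [h]
  simp [abs_of_pos (Real.exp_pos _)]

end ExpSubstitution

/-- Preimages of null sets under `Real.exp` are images under `Real.log`, which is differentiable on
the half-line. This lets almost everywhere identities be pulled back to logarithmic variables. -/
theorem quasiMeasurePreserving_exp :
    Measure.QuasiMeasurePreserving Real.exp volume volume where
  measurable := Real.measurable_exp
  absolutelyContinuous := by
    refine Measure.AbsolutelyContinuous.mk fun s hs h0 => ?_
    rw [Measure.map_apply Real.measurable_exp hs]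
    have h1 : volume (s ∩ Ioi 0) = 0 := measure_mono_null inter_subset_left h0
    have h2 := addHaar_image_eq_zero_of_differentiableOn_of_addHaar_eq_zero (f := Real.log)
      volume (s := s ∩ Ioi 0) (fun x hx =>
        (Real.differentiableAt_log (ne_of_gt hx.2)).differentiableWithinAt) h1
    refine measure_mono_null (fun t ht => ?_) h2
    exact ⟨Real.exp t, ⟨ht, Real.exp_pos t⟩, Real.log_exp t⟩

theorem integrable_exp_neg_abs_half : Integrable fun t : ℝ => Real.exp (-|t| / 2) := by
  refine (integrable_inv_one_add_sq.const_mul 8).mono' (by fun_prop)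
    (Filter.Eventually.of_forall fun t => ?_)
  rw [Real.norm_of_nonneg (Real.exp_pos _).le, neg_div, Real.exp_neg, ← div_eq_mul_inv,
    ← one_div, div_le_div_iff₀ (Real.exp_pos _) (by positivity)]
  have := Real.quadratic_le_exp_of_nonneg (x := |t| / 2) (by positivity)
  nlinarith [abs_nonneg t, sq_abs t]

/-! ### The Laplace transform in logarithmic variables and its Gamma multiplier. -/

section Gamma

variable {a : ℂ}

theorem integrableOn_cpow_mul_exp {s : ℂ} (hs : -1 < s.re) {z : ℂ} (hz : 0 < z.re) :
    IntegrableOn (fun t : ℝ => (t : ℂ) ^ s * Complex.exp (-(z * t))) (Ioi 0) := by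
  have h := integrableOn_rpow_mul_exp_neg_mul_rpow hs one_pos hz
  refine Integrable.mono' h ?_ ?_
  · refine ContinuousOn.aestronglyMeasurable (fun t ht => ?_) measurableSet_Ioi
    refine ContinuousAt.continuousWithinAt ?_
    exact (Complex.continuousAt_ofReal_cpow_const _ _ (Or.inr (ne_of_gt ht))).mul (by fun_prop)
  · filter_upwards [ae_restrict_mem measurableSet_Ioi] with t ht
    rw [norm_mul, Complex.norm_cpow_eq_rpow_re_of_pos ht, Complex.norm_exp]
    simp

/-- Both sides are holomorphic in the right half-plane and agree for real $z$, in particular along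
$1+1/(n+1)\to1$; the identity theorem does the rest. -/
theorem integral_cpow_mul_exp_neg_mul (ha : 0 < a.re) {z : ℂ} (hz : 0 < z.re) :
    ∫ t in Ioi (0 : ℝ), (t : ℂ) ^ (a - 1) * Complex.exp (-(z * t)) =
      z ^ (-a) * Complex.Gamma a := by
  set U : Set ℂ := {z | 0 < z.re} with hU
  have hUo : IsOpen U := isOpen_lt continuous_const Complex.continuous_re
  have hUc : IsPreconnected U := (convex_halfSpace_re_gt 0).isPreconnected
  have hsub : -1 < (a - 1).re := by simpa using ha
  have hd : DifferentiableOn ℂ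
      (fun z : ℂ => ∫ t in Ioi (0 : ℝ), (t : ℂ) ^ (a - 1) * Complex.exp (-(z * t))) U := by
    intro z hz
    have hz' : 0 < z.re := hz
    refine DifferentiableAt.differentiableWithinAt ?_
    refine (hasDerivAt_integral_of_dominated_loc_of_deriv_le
      (μ := volume.restrict (Ioi 0)) (s := {w : ℂ | z.re / 2 < w.re})
      (F := fun w (t : ℝ) => (t : ℂ) ^ (a - 1) * Complex.exp (-(w * t)))
      (F' := fun w t => (t : ℂ) ^ (a - 1) * (Complex.exp (-(w * t)) * (-t)))
      (bound := fun t => t ^ a.re * Real.exp (-(z.re / 2) * t ^ (1 : ℝ)))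
      ((isOpen_lt continuous_const Complex.continuous_re).mem_nhds (by simpa using hz'))
      ?_ (integrableOn_cpow_mul_exp hsub hz') ?_ ?_ ?_ ?_).2.differentiableAt
    · filter_upwards [hUo.mem_nhds hz] with w hw
      exact (integrableOn_cpow_mul_exp hsub hw).1
    · refine ContinuousOn.aestronglyMeasurable (fun t ht => ?_) measurableSet_Ioi
      refine ContinuousAt.continuousWithinAt ?_
      exact (Complex.continuousAt_ofReal_cpow_const _ _ (Or.inr (ne_of_gt ht))).mul (by fun_prop)
    · filter_upwards [ae_restrict_mem measurableSet_Ioi] with t ht w hw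
      have ht' : (0 : ℝ) < t := ht
      rw [norm_mul, norm_mul, Complex.norm_cpow_eq_rpow_re_of_pos ht, Complex.norm_exp, norm_neg,
        Complex.norm_real, Real.norm_of_nonneg ht'.le, Real.rpow_one,
        mul_comm (Real.exp _), ← mul_assoc]
      have h1 : t ^ (a - 1).re * t = t ^ a.re := by
        rw [← Real.rpow_add_one (ne_of_gt ht)]; simp
      rw [h1]
      gcongr
      simp only [Complex.neg_re, Complex.mul_re, Complex.ofReal_re, Complex.ofReal_im, mul_zero,
        sub_zero, neg_mul, neg_le_neg_iff]
      have : z.re / 2 < w.re := hw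
      gcongr
    · exact integrableOn_rpow_mul_exp_neg_mul_rpow (by linarith) one_pos (by linarith)
    · refine Filter.Eventually.of_forall fun t w _ => ?_
      refine HasDerivAt.const_mul _ ?_
      have := ((hasDerivAt_id w).mul_const (t : ℂ)).neg.cexp
      simpa using this
  have hd2 : DifferentiableOn ℂ (fun z : ℂ => z ^ (-a) * Complex.Gamma a) U := by
    intro z hz
    refine DifferentiableAt.differentiableWithinAt ?_
    exact (differentiableAt_id.cpow_const (Or.inl hz)).mul_const _
  refine AnalyticOnNhd.eqOn_of_preconnected_of_frequently_eq (z₀ := 1)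
    (hd.analyticOnNhd hUo) (hd2.analyticOnNhd hUo) hUc (by simp [hU]) ?_ hz
  have hreal : ∀ r : ℝ, 0 < r → ∫ t in Ioi (0 : ℝ), (t : ℂ) ^ (a - 1) *
      Complex.exp (-((r : ℂ) * t)) = (r : ℂ) ^ (-a) * Complex.Gamma a := fun r hr => by
    rw [Complex.integral_cpow_mul_exp_neg_mul_Ioi ha hr, one_div, Complex.inv_cpow,
      Complex.cpow_neg]
    rw [Complex.arg_ofReal_of_nonneg hr.le]
    exact Real.pi_pos.ne
  have htend : Filter.Tendsto (fun n : ℕ => ((1 + 1 / ((n : ℝ) + 1) : ℝ) : ℂ)) Filter.atTop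
      (nhdsWithin 1 {1}ᶜ) := by
    rw [tendsto_nhdsWithin_iff]
    constructor
    · have := (tendsto_one_div_add_atTop_nhds_zero_nat (𝕜 := ℝ)).const_add 1
      rw [add_zero] at this
      exact (Complex.continuous_ofReal.tendsto _).comp this
    · refine Filter.Eventually.of_forall fun n => ?_
      simp only [mem_compl_iff, mem_singleton_iff, Complex.ofReal_eq_one]
      have : (0 : ℝ) < 1 / ((n : ℝ) + 1) := by positivity
      linarith
  exact htend.frequently (Filter.Frequently.of_forall fun n => hreal _ (by positivity))

end Gamma

/-- The kernel of the Laplace transform in logarithmic variables. -/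
def laplaceKernel (z : ℂ) (t : ℝ) : ℂ := Real.exp (t / 2) * Complex.exp (-(z * Real.exp t))

theorem continuous_laplaceKernel (z : ℂ) : Continuous (laplaceKernel z) := by
  unfold laplaceKernel; fun_prop

theorem norm_laplaceKernel_le {z : ℂ} (hz : 0 ≤ z.re) (t : ℝ) :
    ‖laplaceKernel z t‖ ≤ Real.exp (t / 2) := by
  rw [laplaceKernel, norm_mul, Complex.norm_real, Real.norm_of_nonneg (Real.exp_pos _).le,
    Complex.norm_exp]
  refine mul_le_of_le_one_right (Real.exp_pos _).le (Real.exp_le_one_iff.2 ?_)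
  simp only [Complex.neg_re, Complex.mul_re, Complex.ofReal_re, Complex.ofReal_im, mul_zero,
    sub_zero, neg_nonpos]
  positivity

theorem exp_smul_mellin_integrand (z : ℂ) (s t : ℝ) :
    Complex.exp ((-2 * Real.pi * t * s : ℝ) * Complex.I) • laplaceKernel z t =
      Real.exp t • ((Real.exp t : ℂ) ^ ((1 / 2 - 2 * Real.pi * s * Complex.I : ℂ) - 1) *
        Complex.exp (-(z * (Real.exp t : ℝ)))) := by
  rw [Complex.cpow_def_of_ne_zero (by exact_mod_cast (Real.exp_pos t).ne'),
    ← Complex.ofReal_log (Real.exp_pos t).le, Real.log_exp, laplaceKernel, Complex.real_smul,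
    smul_eq_mul, Complex.ofReal_exp, Complex.ofReal_exp, ← mul_assoc, ← mul_assoc,
    ← Complex.exp_add _ ((t / 2 : ℝ) : ℂ), ← Complex.exp_add (t : ℂ)]
  congr 2
  push_cast
  ring

theorem integrable_laplaceKernel {z : ℂ} (hz : 0 < z.re) : Integrable (laplaceKernel z) := by
  have h := integrable_comp_exp.2
    (integrableOn_cpow_mul_exp (s := (1 / 2 : ℂ) - 1) (by norm_num) hz)
  refine h.congr (Filter.Eventually.of_forall fun t => ?_)
  have := exp_smul_mellin_integrand z 0 t
  simp only [mul_zero, Complex.ofReal_zero, zero_mul, Complex.exp_zero, one_smul, sub_zero] at this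
  exact this.symm

theorem fourier_laplaceKernel {z : ℂ} (hz : 0 < z.re) (s : ℝ) :
    𝓕 (laplaceKernel z) s = z ^ (-(1 / 2 - 2 * Real.pi * s * Complex.I : ℂ)) *
      Complex.Gamma (1 / 2 - 2 * Real.pi * s * Complex.I) := by
  rw [Real.fourier_real_eq_integral_exp_smul]
  simp_rw [exp_smul_mellin_integrand]
  rw [← integral_cpow_mul_exp_neg_mul (by simp) hz]
  exact integral_comp_exp (fun y : ℝ => (y : ℂ) ^ ((1 / 2 - 2 * Real.pi * s * Complex.I : ℂ) - 1) *
    Complex.exp (-(z * y)))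

/-- The reflection formula: on the line $\operatorname{Re}w=1/2$ one has $\bar w=1-w$. -/
theorem norm_Gamma_half_sq (y : ℝ) :
    ‖Complex.Gamma (1 / 2 - y * Complex.I)‖ ^ 2 = Real.pi / Real.cosh (Real.pi * y) := by
  have hconj : conj (1 / 2 - y * Complex.I : ℂ) = 1 - (1 / 2 - y * Complex.I) := by
    have h2 : conj (1 / 2 : ℂ) = 1 / 2 := by
      rw [map_div₀, map_one, Complex.conj_ofNat]
    rw [map_sub, map_mul, Complex.conj_I, Complex.conj_ofReal, h2]; ring
  have h := Complex.Gamma_mul_Gamma_one_sub (1 / 2 - y * Complex.I)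
  rw [← hconj, Complex.Gamma_conj, Complex.mul_conj, Complex.normSq_eq_norm_sq] at h
  have hsin : Complex.sin (Real.pi * (1 / 2 - y * Complex.I)) =
      ((Real.cosh (Real.pi * y) : ℝ) : ℂ) := by
    rw [show (Real.pi * (1 / 2 - y * Complex.I) : ℂ) =
      Real.pi / 2 - ((Real.pi * y : ℝ) : ℂ) * Complex.I by push_cast; ring,
      Complex.sin_pi_div_two_sub, Complex.cos_mul_I, Complex.ofReal_cosh]
  rw [hsin] at h
  exact_mod_cast h

/-- The multiplier diagonalising the truncated half-line projections. -/
def mellinSymbol (ε s : ℝ) : ℝ := (1 + Real.exp (-(4 * Real.pi ^ 2 * (ε * s))))⁻¹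

/-- The power contributes $(2\pi)^{-1}e^{-2\pi^2\varepsilon s}$ since the base has argument
$\varepsilon\pi/2$, and the Gamma factor contributes $\pi/\cosh(2\pi^2s)$; the product is
$(1+e^{4\pi^2\varepsilon s})^{-1}$. -/
theorem norm_sq_boundary_multiplier {ε : ℝ} (hε : ε = 1 ∨ ε = -1) (s : ℝ) :
    ‖((2 * Real.pi * ε : ℝ) * Complex.I : ℂ) ^ (-(1 / 2 - 2 * Real.pi * s * Complex.I : ℂ)) *
      Complex.Gamma (1 / 2 - 2 * Real.pi * s * Complex.I)‖ ^ 2 = mellinSymbol ε (-s) := by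
  have hpi := Real.pi_pos
  have hG := norm_Gamma_half_sq (2 * Real.pi * s)
  push_cast at hG
  have hne : ((2 * Real.pi * ε : ℝ) * Complex.I : ℂ) ≠ 0 := by
    rcases hε with rfl | rfl <;> simp [hpi.ne']
  have hnorm : ‖((2 * Real.pi * ε : ℝ) * Complex.I : ℂ)‖ = 2 * Real.pi := by
    rw [norm_mul, Complex.norm_I, mul_one, Complex.norm_real, Real.norm_eq_abs]
    rcases hε with rfl | rfl
    · rw [mul_one, abs_of_pos (by positivity)]
    · rw [mul_neg, mul_one, abs_neg, abs_of_pos (by positivity)]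
  have harg : Complex.arg ((2 * Real.pi * ε : ℝ) * Complex.I : ℂ) = ε * (Real.pi / 2) := by
    rcases hε with rfl | rfl
    · rw [mul_one, Complex.arg_real_mul _ (by positivity), Complex.arg_I, one_mul]
    · rw [show (((2 * Real.pi * (-1) : ℝ) : ℂ) * Complex.I) =
        ((2 * Real.pi : ℝ) : ℂ) * (-Complex.I) by push_cast; ring,
        Complex.arg_real_mul _ (by positivity), Complex.arg_neg_I]
      ring
  rw [norm_mul, mul_pow, hG, Complex.norm_cpow_of_ne_zero hne, hnorm, harg]
  have hre : (-(1 / 2 - 2 * Real.pi * s * Complex.I : ℂ)).re = -(1 / 2) := by simp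
  have him : (-(1 / 2 - 2 * Real.pi * s * Complex.I : ℂ)).im = 2 * Real.pi * s := by simp
  rw [hre, him, div_pow, ← Real.rpow_natCast, ← Real.rpow_mul (by positivity)]
  rw [show (-(1 / 2 : ℝ)) * ((2 : ℕ) : ℝ) = -1 by norm_num, Real.rpow_neg_one, ← Real.exp_nat_mul,
    Real.cosh_eq, mellinSymbol]
  have h1 : Real.exp (((2 : ℕ) : ℝ) * (ε * (Real.pi / 2) * (2 * Real.pi * s))) =
      Real.exp (ε * (2 * Real.pi ^ 2 * s)) := by congr 1; push_cast; ring
  have h2 : Real.exp (-(4 * Real.pi ^ 2 * (ε * -s))) =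
      Real.exp (ε * (2 * Real.pi ^ 2 * s)) * Real.exp (ε * (2 * Real.pi ^ 2 * s)) := by
    rw [← Real.exp_add]; congr 1; ring
  have h3 : Real.exp (Real.pi * (2 * Real.pi * s)) + Real.exp (-(Real.pi * (2 * Real.pi * s))) =
      Real.exp (ε * (2 * Real.pi ^ 2 * s)) + (Real.exp (ε * (2 * Real.pi ^ 2 * s)))⁻¹ := by
    rw [← Real.exp_neg]
    rcases hε with rfl | rfl
    · congr 2 <;> ring
    · rw [add_comm]; congr 2 <;> ring
  rw [h1, h2, h3]
  have hE := Real.exp_pos (ε * (2 * Real.pi ^ 2 * s))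
  set E := Real.exp (ε * (2 * Real.pi ^ 2 * s))
  field_simp
  ring

/-- The Laplace transform in logarithmic variables. -/
def logLaplace (z : ℂ) (f : ℝ → ℂ) (τ : ℝ) : ℂ := ∫ t, laplaceKernel z (t + τ) * f t

section LogLaplace

variable {f : ℝ → ℂ}

/-- As a function of $\tau$ this is the convolution of the kernel with the reflection of $f$, hence
the argument $-s$. -/
theorem fourier_logLaplace {z : ℂ} (hz : 0 < z.re) (hf : Integrable f) (s : ℝ) :
    𝓕 (logLaplace z f) s = 𝓕 (laplaceKernel z) s * 𝓕 f (-s) := by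
  have h := Real.fourier_mul_convolution_eq hf.comp_neg (integrable_laplaceKernel hz) s
  rw [← Real.fourierInv_eq_fourier_comp_neg, Real.fourierInv_eq_fourier_neg, mul_comm] at h
  rw [← h]
  refine congrFun (congrArg _ (funext fun τ => ?_)) s
  rw [logLaplace, ← integral_neg_eq_self]
  simp only [convolution, ContinuousLinearMap.mul_apply']
  congr 1
  ext t
  rw [mul_comm, neg_add_eq_sub]

theorem integrable_laplaceKernel_mul (hf : ContDiff ℝ ∞ f) (hc : HasCompactSupport f)
    (z : ℂ) (τ : ℝ) :
    Integrable fun t => laplaceKernel z (t + τ) * f t :=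
  (((continuous_laplaceKernel z).comp (continuous_add_const τ)).mul hf.continuous)
    |>.integrable_of_hasCompactSupport hc.mul_left

theorem integrable_exp_mul_norm (hf : ContDiff ℝ ∞ f) (hc : HasCompactSupport f)
    (c : ℝ) : Integrable fun t => Real.exp (c * t) * ‖f t‖ :=
  ((by fun_prop : Continuous fun t => Real.exp (c * t)).mul hf.continuous.norm)
    |>.integrable_of_hasCompactSupport hc.norm.mul_left

theorem norm_logLaplace_le_exp (hf : ContDiff ℝ ∞ f) (hc : HasCompactSupport f)
    {z : ℂ} (hz : 0 ≤ z.re) (τ : ℝ) :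
    ‖logLaplace z f τ‖ ≤ (∫ t, Real.exp (1 / 2 * t) * ‖f t‖) * Real.exp (τ / 2) := by
  rw [logLaplace, ← integral_mul_const]
  refine norm_integral_le_of_norm_le ((integrable_exp_mul_norm hf hc _).mul_const _)
    (Filter.Eventually.of_forall fun t => ?_)
  rw [norm_mul]
  calc _ ≤ Real.exp ((t + τ) / 2) * ‖f t‖ := by gcongr; exact norm_laplaceKernel_le hz _
    _ = _ := by rw [add_div, Real.exp_add, one_div_mul_eq_div]; ring

/-- The kernel is $-z^{-1}e^{-(t+\tau)/2}$ times the $t$-derivative of the bounded factor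
$\exp(-ze^{t+\tau})$, so one integration by parts turns growth in $\tau$ into decay. -/
theorem norm_logLaplace_le_exp_neg (hf : ContDiff ℝ ∞ f) (hc : HasCompactSupport f)
    {z : ℂ} (hz : 0 ≤ z.re) (hz1 : 1 ≤ ‖z‖) (τ : ℝ) :
    ‖logLaplace z f τ‖ ≤
      (∫ t, Real.exp (-1 / 2 * t) * (‖f t‖ + ‖deriv f t‖)) * Real.exp (-τ / 2) := by
  have hz0 : z ≠ 0 := by rintro rfl; simp at hz1; linarith
  set φ : ℝ → ℂ := fun t => -z⁻¹ * (Real.exp (-(t + τ) / 2) * f t) with hφ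
  set φ' : ℝ → ℂ := fun t => -z⁻¹ * (((Real.exp (-(t + τ) / 2) * (-1 / 2) : ℝ) : ℂ) * f t +
    Real.exp (-(t + τ) / 2) * deriv f t) with hφ'
  set K : ℝ → ℂ := fun t => Complex.exp (-(z * Real.exp (t + τ))) with hK
  set K' : ℝ → ℂ := fun t => Complex.exp (-(z * Real.exp (t + τ))) *
    (-(z * Real.exp (t + τ))) with hK'
  have hdf : Continuous (deriv f) := hf.continuous_deriv (by simp)
  have hcdf : HasCompactSupport (deriv f) := hc.deriv
  have hKd : ∀ t, HasDerivAt K (K' t) t := fun t => by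
    have h1 : HasDerivAt (fun t : ℝ => Real.exp (t + τ)) (Real.exp (t + τ)) t := by
      simpa using ((hasDerivAt_id t).add_const τ).exp
    exact ((h1.ofReal_comp).const_mul z).neg.cexp
  have hφd : ∀ t, HasDerivAt φ (φ' t) t := fun t => by
    have h1 : HasDerivAt (fun t : ℝ => Real.exp (-(t + τ) / 2))
        (Real.exp (-(t + τ) / 2) * (-1 / 2)) t := by
      simpa using (((hasDerivAt_id t).add_const τ).neg.div_const 2).exp
    exact ((h1.ofReal_comp).mul (hf.differentiable (by simp) t).hasDerivAt).const_mul _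
  have hφc : HasCompactSupport φ := hc.mul_left.mul_left
  have hφ'c : HasCompactSupport φ' := (hc.mul_left.add hcdf.mul_left).mul_left
  have hcf := hf.continuous
  have hφcont : Continuous φ := by fun_prop
  have hφ'cont : Continuous φ' := by fun_prop
  have hKcont : Continuous K := by fun_prop
  have hK'cont : Continuous K' := by fun_prop
  have hpart := integral_mul_deriv_eq_deriv_mul_of_integrable (u := φ) (v := K)
    (fun t _ => hφd t) (fun t _ => hKd t)
    ((hφcont.mul hK'cont).integrable_of_hasCompactSupport hφc.mul_right)
    ((hφ'cont.mul hKcont).integrable_of_hasCompactSupport hφ'c.mul_right)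
    ((hφcont.mul hKcont).integrable_of_hasCompactSupport hφc.mul_right)
  have heq : logLaplace z f τ = ∫ t, φ t * K' t := by
    rw [logLaplace]
    congr 1
    ext t
    simp only [laplaceKernel, hφ, hK']
    have : (Real.exp ((t + τ) / 2) : ℂ) = Real.exp (-(t + τ) / 2) * Real.exp (t + τ) := by
      rw [← Complex.ofReal_mul, ← Real.exp_add]; congr 2; ring
    rw [this]
    field_simp
  rw [heq, hpart, norm_neg, ← integral_mul_const]
  refine norm_integral_le_of_norm_le ?_ (Filter.Eventually.of_forall fun t => ?_)
  · refine Integrable.mul_const ?_ _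
    refine Continuous.integrable_of_hasCompactSupport (by fun_prop) ?_
    exact (hc.norm.add hcdf.norm).mul_left
  · have hKn : ‖K t‖ ≤ 1 := by
      rw [hK, Complex.norm_exp]
      refine Real.exp_le_one_iff.2 ?_
      simp only [Complex.neg_re, Complex.mul_re, Complex.ofReal_re, Complex.ofReal_im, mul_zero,
        sub_zero, neg_nonpos]
      positivity
    have hzi : ‖z‖⁻¹ ≤ 1 := inv_le_one_of_one_le₀ hz1
    have hexp : Real.exp (-(t + τ) / 2) = Real.exp (-1 / 2 * t) * Real.exp (-τ / 2) := by
      rw [← Real.exp_add]; congr 1; ring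
    calc ‖φ' t * K t‖ ≤ ‖φ' t‖ * 1 := by rw [norm_mul]; gcongr
      _ ≤ 1 * (Real.exp (-(t + τ) / 2) * ‖f t‖ + Real.exp (-(t + τ) / 2) * ‖deriv f t‖) := by
        rw [mul_one, hφ', norm_mul, norm_neg, norm_inv]
        gcongr
        refine (norm_add_le _ _).trans (add_le_add ?_ ?_)
        · rw [norm_mul, Complex.norm_real]
          gcongr
          rw [Real.norm_eq_abs, abs_mul, abs_of_pos (Real.exp_pos _)]
          have : |(-1 / 2 : ℝ)| ≤ 1 := by rw [abs_le]; constructor <;> norm_num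
          exact mul_le_of_le_one_right (Real.exp_pos _).le this
        · rw [norm_mul, Complex.norm_real, Real.norm_of_nonneg (Real.exp_pos _).le]
      _ = _ := by rw [hexp]; ring

/-- The bound is uniform up to the imaginary axis, where the kernel itself is not absolutely
integrable; it supplies the majorant for the boundary limit. -/
theorem exists_norm_logLaplace_le (hf : ContDiff ℝ ∞ f) (hc : HasCompactSupport f)
    : ∃ C, ∀ z : ℂ, 0 ≤ z.re → 1 ≤ ‖z‖ → ∀ τ,
    ‖logLaplace z f τ‖ ≤ C * Real.exp (-|τ| / 2) := by
  set C₁ := ∫ t, Real.exp (1 / 2 * t) * ‖f t‖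
  set C₂ := ∫ t, Real.exp (-1 / 2 * t) * (‖f t‖ + ‖deriv f t‖)
  refine ⟨max C₁ C₂, fun z hz hz1 τ => ?_⟩
  rcases le_total 0 τ with h | h
  · rw [abs_of_nonneg h]
    refine (norm_logLaplace_le_exp_neg hf hc hz hz1 τ).trans ?_
    gcongr
    exact le_max_right _ _
  · rw [abs_of_nonpos h, neg_neg]
    refine (norm_logLaplace_le_exp hf hc hz τ).trans ?_
    gcongr
    exact le_max_left _ _

theorem stronglyMeasurable_logLaplace (hf : ContDiff ℝ ∞ f) (z : ℂ) : StronglyMeasurable (logLaplace z f) := by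
  refine StronglyMeasurable.integral_prod_right (f := fun τ t => laplaceKernel z (t + τ) * f t) ?_
  refine Continuous.stronglyMeasurable ?_
  have := continuous_laplaceKernel z
  have := hf.continuous
  fun_prop

theorem integrable_logLaplace (hf : ContDiff ℝ ∞ f) (hc : HasCompactSupport f)
    {z : ℂ} (hz : 0 ≤ z.re) (hz1 : 1 ≤ ‖z‖) :
    Integrable (logLaplace z f) := by
  obtain ⟨C, hC⟩ := exists_norm_logLaplace_le hf hc
  exact (integrable_exp_neg_abs_half.const_mul C).mono'
    (stronglyMeasurable_logLaplace hf z).aestronglyMeasurable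
    (Filter.Eventually.of_forall (hC z hz hz1))

theorem memLp_logLaplace (hf : ContDiff ℝ ∞ f) (hc : HasCompactSupport f)
    {z : ℂ} (hz : 0 ≤ z.re) (hz1 : 1 ≤ ‖z‖) :
    MemLp (logLaplace z f) 2 volume := by
  obtain ⟨C, hC⟩ := exists_norm_logLaplace_le hf hc
  rw [memLp_two_iff_integrable_sq_norm (stronglyMeasurable_logLaplace hf z).aestronglyMeasurable]
  refine (integrable_exp_neg_abs_half.const_mul (C ^ 2)).mono'
    ((stronglyMeasurable_logLaplace hf z).norm.pow 2).aestronglyMeasurable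
    (Filter.Eventually.of_forall fun τ => ?_)
  rw [Real.norm_of_nonneg (by positivity)]
  calc _ ≤ (C * Real.exp (-|τ| / 2)) ^ 2 := by gcongr; exact hC z hz hz1 τ
    _ = C ^ 2 * (Real.exp (-|τ| / 2) * Real.exp (-|τ| / 2)) := by ring
    _ ≤ C ^ 2 * (Real.exp (-|τ| / 2) * 1) := by
      gcongr
      exact Real.exp_le_one_iff.2 (by linarith [abs_nonneg τ])
    _ = _ := by ring

/-- The convolution theorem applies at $z=\eta+2\pi i\varepsilon$ with $\eta>0$. As
$\eta\downarrow0$ the left side converges by dominated convergence and the power is continuous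
because $\pm2\pi i$ lies off the cut. -/
theorem fourier_logLaplace_boundary (hf : ContDiff ℝ ∞ f) (hc : HasCompactSupport f)
    {ε : ℝ} (hε : ε = 1 ∨ ε = -1) (s : ℝ) :
    𝓕 (logLaplace ((2 * Real.pi * ε : ℝ) * Complex.I) f) s =
      ((2 * Real.pi * ε : ℝ) * Complex.I : ℂ) ^ (-(1 / 2 - 2 * Real.pi * s * Complex.I : ℂ)) *
      Complex.Gamma (1 / 2 - 2 * Real.pi * s * Complex.I) * 𝓕 f (-s) := by
  obtain ⟨C, hC⟩ := exists_norm_logLaplace_le hf hc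
  have hpi : (3 : ℝ) < Real.pi := Real.pi_gt_three
  set z₀ : ℂ := (2 * Real.pi * ε : ℝ) * Complex.I with hz₀
  set z : ℝ → ℂ := fun η => (η : ℂ) + z₀ with hz
  have hre0 : z₀.re = 0 := by simp [hz₀]
  have him0 : z₀.im = 2 * Real.pi * ε := by simp [hz₀]
  have hre : ∀ η, (z η).re = η := fun η => by simp [hz, hre0]
  have hnorm : ∀ η, 1 ≤ ‖z η‖ := fun η => by
    refine le_trans ?_ (Complex.abs_im_le_norm _)
    have : (z η).im = 2 * Real.pi * ε := by simp [hz, him0]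
    rw [this]
    rcases hε with rfl | rfl
    · rw [mul_one, abs_of_pos (by positivity)]; linarith
    · rw [mul_neg, mul_one, abs_neg, abs_of_pos (by positivity)]; linarith
  have hz0 : z 0 = z₀ := by simp [hz]
  have hzcont : Continuous z := by fun_prop
  have hslit : z₀ ∈ Complex.slitPlane := by
    refine Or.inr ?_
    rw [him0]
    rcases hε with rfl | rfl <;> simp [Real.pi_ne_zero]
  have hpos : ∀ᶠ η : ℝ in nhdsWithin 0 (Ioi 0), 0 < η := eventually_mem_nhdsWithin
  have hpt : ∀ τ, Filter.Tendsto (fun η => logLaplace (z η) f τ) (nhdsWithin 0 (Ioi 0))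
      (nhds (logLaplace z₀ f τ)) := fun τ => by
    refine tendsto_integral_filter_of_dominated_convergence
      (fun t => Real.exp (1 / 2 * t) * ‖f t‖ * Real.exp (τ / 2)) ?_ ?_ ?_ ?_
    · exact Filter.Eventually.of_forall fun η =>
        (integrable_laplaceKernel_mul hf hc (z η) τ).1
    · filter_upwards [hpos] with η hη
      refine Filter.Eventually.of_forall fun t => ?_
      rw [norm_mul]
      calc _ ≤ Real.exp ((t + τ) / 2) * ‖f t‖ := by
            gcongr; exact norm_laplaceKernel_le (by rw [hre]; exact hη.le) _
        _ = _ := by rw [add_div, Real.exp_add, one_div_mul_eq_div]; ring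
    · exact (integrable_exp_mul_norm hf hc _).mul_const _
    · refine Filter.Eventually.of_forall fun t => ?_
      have hcont : Continuous fun η => laplaceKernel (z η) (t + τ) * f t := by
        unfold laplaceKernel; fun_prop
      have := (hcont.tendsto 0).mono_left (nhdsWithin_le_nhds (s := Ioi 0))
      rwa [hz0] at this
  have hlim1 : Filter.Tendsto (fun η => 𝓕 (logLaplace (z η) f) s) (nhdsWithin 0 (Ioi 0))
      (nhds (𝓕 (logLaplace z₀ f) s)) := by
    simp_rw [Real.fourier_real_eq_integral_exp_smul]
    refine tendsto_integral_filter_of_dominated_convergence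
      (fun τ => C * Real.exp (-|τ| / 2)) ?_ ?_ (integrable_exp_neg_abs_half.const_mul C) ?_
    · refine Filter.Eventually.of_forall fun η => ?_
      refine AEStronglyMeasurable.smul
        (by fun_prop : Continuous fun τ : ℝ =>
          Complex.exp (((-2 * Real.pi * τ * s : ℝ) : ℂ) * Complex.I)).aestronglyMeasurable ?_
      exact (stronglyMeasurable_logLaplace hf _).aestronglyMeasurable
    · filter_upwards [hpos] with η hη
      refine Filter.Eventually.of_forall fun τ => ?_
      rw [norm_smul, Complex.norm_exp_ofReal_mul_I, one_mul]
      exact hC _ (by rw [hre]; exact hη.le) (hnorm η) τ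
    · exact Filter.Eventually.of_forall fun τ => (hpt τ).const_smul _
  have hlim2 : Filter.Tendsto (fun η => 𝓕 (logLaplace (z η) f) s) (nhdsWithin 0 (Ioi 0))
      (nhds (z₀ ^ (-(1 / 2 - 2 * Real.pi * s * Complex.I : ℂ)) *
        Complex.Gamma (1 / 2 - 2 * Real.pi * s * Complex.I) * 𝓕 f (-s))) := by
    have hcpow : Filter.Tendsto (fun η : ℝ => (z η) ^ (-(1 / 2 - 2 * Real.pi * s * Complex.I : ℂ)))
        (nhdsWithin 0 (Ioi 0)) (nhds (z₀ ^ (-(1 / 2 - 2 * Real.pi * s * Complex.I : ℂ)))) := by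
      have h1 : ContinuousAt (fun w : ℂ => w ^ (-(1 / 2 - 2 * Real.pi * s * Complex.I : ℂ))) z₀ :=
        (hasStrictDerivAt_id z₀).cpow_const hslit |>.hasDerivAt.continuousAt
      refine h1.tendsto.comp ?_
      have := (hzcont.tendsto 0).mono_left (nhdsWithin_le_nhds (s := Ioi 0))
      rwa [hz0] at this
    refine ((hcpow.mul_const _).mul_const _).congr' ?_
    filter_upwards [hpos] with η hη
    have hη' : 0 < (z η).re := by rw [hre]; exact hη
    rw [fourier_logLaplace hη' (hf.continuous.integrable_of_hasCompactSupport hc),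
      fourier_laplaceKernel hη']
  exact tendsto_nhds_unique hlim1 hlim2

theorem integral_norm_sq_logLaplace_boundary (hf : ContDiff ℝ ∞ f) (hc : HasCompactSupport f)
    {ε : ℝ} (hε : ε = 1 ∨ ε = -1) :
    ∫ τ, ‖logLaplace ((2 * Real.pi * ε : ℝ) * Complex.I) f τ‖ ^ 2 =
      ∫ s, mellinSymbol ε s * ‖𝓕 f s‖ ^ 2 := by
  have hre : 0 ≤ ((2 * Real.pi * ε : ℝ) * Complex.I : ℂ).re := by simp
  have hn : 1 ≤ ‖((2 * Real.pi * ε : ℝ) * Complex.I : ℂ)‖ := by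
    have hpi : (3 : ℝ) < Real.pi := Real.pi_gt_three
    rw [norm_mul, Complex.norm_I, mul_one, Complex.norm_real, Real.norm_eq_abs]
    rcases hε with rfl | rfl
    · rw [mul_one, abs_of_pos (by positivity)]; linarith
    · rw [mul_neg, mul_one, abs_neg, abs_of_pos (by positivity)]; linarith
  set G := logLaplace ((2 * Real.pi * ε : ℝ) * Complex.I) f with hG
  have h1 : Integrable G := integrable_logLaplace hf hc hre hn
  have h2 : MemLp G 2 volume := memLp_logLaplace hf hc hre hn
  have hpl : ‖(𝓕 (h2.toLp G) : L2)‖ = ‖h2.toLp G‖ := Lp.norm_fourier_eq _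
  have e1 : ‖h2.toLp G‖ ^ 2 = ∫ τ, ‖G τ‖ ^ 2 := by
    rw [norm_sq_eq_integral]
    refine integral_congr_ae ?_
    filter_upwards [h2.coeFn_toLp] with x hx
    rw [hx]
  have e2 : ‖(𝓕 (h2.toLp G) : L2)‖ ^ 2 = ∫ s, ‖𝓕 G s‖ ^ 2 := by
    rw [norm_sq_eq_integral]
    refine integral_congr_ae ?_
    filter_upwards [coeFn_fourier_toLp h1 h2] with x hx
    rw [hx]
  rw [← e1, ← hpl, e2, ← integral_neg_eq_self]
  congr 1
  ext s
  rw [hG, fourier_logLaplace_boundary hf hc hε, norm_mul, mul_pow, neg_neg]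
  have := norm_sq_boundary_multiplier hε (-s)
  rw [neg_neg] at this
  rw [this]

end LogLaplace

/-! ### The logarithmic change of variables as a partial isometry. -/

/-- The function `t ↦ e^{t/2} u(e^t)`. -/
def expPull (u : ℝ → ℂ) (t : ℝ) : ℂ := Real.exp (t / 2) * u (Real.exp t)

theorem conj_expPull_mul (u v : ℝ → ℂ) (t : ℝ) :
    conj (expPull u t) * expPull v t =
      Real.exp t • (conj (u (Real.exp t)) * v (Real.exp t)) := by
  have : (Real.exp t : ℂ) = Real.exp (t / 2) * Real.exp (t / 2) := by
    rw [← Complex.ofReal_mul, ← Real.exp_add]; congr 2; ring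
  rw [expPull, expPull, map_mul, Complex.conj_ofReal, Complex.real_smul, this]
  ring

theorem norm_expPull_sq (u : ℝ → ℂ) (t : ℝ) :
    ‖expPull u t‖ ^ 2 = Real.exp t • ‖u (Real.exp t)‖ ^ 2 := by
  have : Real.exp t = Real.exp (t / 2) ^ 2 := by
    rw [← Real.exp_nat_mul]; congr 1; push_cast; ring
  rw [expPull, norm_mul, Complex.norm_real, Real.norm_of_nonneg (Real.exp_pos _).le, mul_pow,
    ← this, smul_eq_mul]

theorem expPull_congr_ae {u v : ℝ → ℂ} (h : u =ᵐ[volume] v) :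
    expPull u =ᵐ[volume] expPull v := by
  filter_upwards [quasiMeasurePreserving_exp.ae h] with t ht
  rw [expPull, expPull, ht]

theorem memLp_expPull {u : ℝ → ℂ} (hu : MemLp u 2 volume) : MemLp (expPull u) 2 volume := by
  have hm : AEStronglyMeasurable (expPull u) volume :=
    AEStronglyMeasurable.mul (by fun_prop : Continuous fun t : ℝ =>
      ((Real.exp (t / 2) : ℝ) : ℂ)).aestronglyMeasurable
      (hu.1.comp_quasiMeasurePreserving quasiMeasurePreserving_exp)
  rw [memLp_two_iff_integrable_sq_norm hm]
  simp_rw [norm_expPull_sq]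
  exact (integrable_comp_exp (g := fun y => ‖u y‖ ^ 2)).2
    ((memLp_two_iff_integrable_sq_norm hu.1).1 hu).integrableOn

theorem integral_norm_expPull_sq (u : ℝ → ℂ) :
    ∫ t, ‖expPull u t‖ ^ 2 = ∫ y in Ioi 0, ‖u y‖ ^ 2 := by
  simp_rw [norm_expPull_sq]
  exact integral_comp_exp (fun y => ‖u y‖ ^ 2)

/-- The unitary change of variables `L²(0, ∞) → L²(ℝ)`, extended by zero to `L²(ℝ)`. -/
def logMap : L2 →L[ℂ] L2 :=
  LinearMap.mkContinuous
    { toFun := fun u => (memLp_expPull (Lp.memLp u)).toLp _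
      map_add' := fun u v => by
        rw [← MemLp.toLp_add, MemLp.toLp_eq_toLp_iff]
        filter_upwards [expPull_congr_ae (Lp.coeFn_add u v)] with t ht
        rw [ht, Pi.add_apply]
        simp only [expPull, Pi.add_apply, mul_add]
      map_smul' := fun c u => by
        rw [RingHom.id_apply, ← MemLp.toLp_const_smul, MemLp.toLp_eq_toLp_iff]
        filter_upwards [expPull_congr_ae (Lp.coeFn_smul c u)] with t ht
        rw [ht, Pi.smul_apply]
        simp only [expPull, Pi.smul_apply, smul_eq_mul]
        ring }
    1 (fun u => by
      refine le_of_sq_le_sq ?_ (by positivity)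
      rw [one_mul]
      change ‖(memLp_expPull (Lp.memLp u)).toLp _‖ ^ 2 ≤ _
      rw [norm_sq_eq_integral, norm_sq_eq_integral u,
        integral_congr_ae (g := fun t => ‖expPull u t‖ ^ 2) (by
          filter_upwards [(memLp_expPull (Lp.memLp u)).coeFn_toLp] with t ht; rw [ht]),
        integral_norm_expPull_sq]
      exact setIntegral_le_integral (integrable_norm_sq u)
        (Filter.Eventually.of_forall fun x => by positivity))

theorem coeFn_logMap (u : L2) : (logMap u : ℝ → ℂ) =ᵐ[volume] expPull u :=
  (memLp_expPull (Lp.memLp u)).coeFn_toLp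

theorem logMap_toLp {u : ℝ → ℂ} (hu : MemLp u 2 volume) :
    logMap (hu.toLp u) = (memLp_expPull hu).toLp _ := by
  apply Lp.ext
  filter_upwards [coeFn_logMap (hu.toLp u), (memLp_expPull hu).coeFn_toLp,
    expPull_congr_ae hu.coeFn_toLp] with t h1 h2 h3
  rw [h1, h2, h3]

/-- The orthogonal projection onto `L²(0, ∞)`. -/
abbrev halfLine : L2 →L[ℂ] L2 := restrictTo (Ioi 0) measurableSet_Ioi

theorem coeFn_halfLine (u : L2) :
    (halfLine u : ℝ → ℂ) =ᵐ[volume] (Ioi 0).indicator (u : ℝ → ℂ) :=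
  coeFn_cut (Ioi 0) measurableSet_Ioi u

theorem inner_halfLine_right (u v : L2) :
    ⟪u, halfLine v⟫_ℂ = ∫ y in Ioi 0, conj (u y) * v y := by
  rw [L2.inner_def, ← integral_indicator measurableSet_Ioi]
  refine integral_congr_ae ?_
  filter_upwards [coeFn_halfLine v] with y hy
  rw [hy, RCLike.inner_apply]
  by_cases h : y ∈ Ioi (0 : ℝ)
  · rw [indicator_of_mem h, indicator_of_mem h, mul_comm]
  · rw [indicator_of_notMem h, indicator_of_notMem h, zero_mul]

theorem inner_logMap_logMap (u v : L2) : ⟪logMap u, logMap v⟫_ℂ = ⟪u, halfLine v⟫_ℂ := by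
  rw [inner_halfLine_right, ← integral_comp_exp, L2.inner_def]
  refine integral_congr_ae ?_
  filter_upwards [coeFn_logMap u, coeFn_logMap v] with t h1 h2
  rw [h1, h2, RCLike.inner_apply, mul_comm, conj_expPull_mul]

open ContinuousLinearMap (adjoint)

theorem adjoint_logMap_logMap (u : L2) : adjoint logMap (logMap u) = halfLine u := by
  refine ext_inner_left ℂ fun v => ?_
  rw [ContinuousLinearMap.adjoint_inner_right, inner_logMap_logMap]

theorem logMap_halfLine (u : L2) : logMap (halfLine u) = logMap u := by
  apply Lp.ext
  filter_upwards [coeFn_logMap (halfLine u), coeFn_logMap u,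
    expPull_congr_ae (coeFn_halfLine u)] with t h1 h2 h3
  rw [h1, h2, h3, expPull, expPull, indicator_of_mem (show Real.exp t ∈ Ioi 0 from Real.exp_pos t)]

theorem logMap_adjoint_logMap (u : L2) : logMap (adjoint logMap (logMap u)) = logMap u := by
  rw [adjoint_logMap_logMap, logMap_halfLine]

/-- The function `x ↦ x^{-1/2} f(log x)` on the half-line, extended by zero. -/
def logPush (f : ℝ → ℂ) (x : ℝ) : ℂ :=
  if 0 < x then Real.exp (-Real.log x / 2) * f (Real.log x) else 0

theorem expPull_logPush (f : ℝ → ℂ) : expPull (logPush f) = f := by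
  ext t
  rw [expPull, logPush, if_pos (Real.exp_pos t), Real.log_exp, ← mul_assoc, ← Complex.ofReal_mul,
    ← Real.exp_add]
  ring_nf
  simp

theorem exists_logPush_eq_zero {f : ℝ → ℂ} (hc : HasCompactSupport f) :
    ∃ R : ℝ, ∀ x, x ∉ Icc (Real.exp (-R)) (Real.exp R) → logPush f x = 0 := by
  obtain ⟨R, hR⟩ := hc.isCompact.isBounded.subset_closedBall 0
  refine ⟨R, fun x hx => ?_⟩
  rw [logPush]
  split_ifs with h0
  · have : f (Real.log x) = 0 := by
      by_contra hne
      have h1 := hR (subset_tsupport f hne)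
      rw [Metric.mem_closedBall, dist_zero_right, Real.norm_eq_abs, abs_le] at h1
      refine hx ⟨?_, ?_⟩
      · rw [← Real.exp_log h0]; exact Real.exp_le_exp.2 h1.1
      · rw [← Real.exp_log h0]; exact Real.exp_le_exp.2 h1.2
    rw [this, mul_zero]
  · rfl

theorem hasCompactSupport_logPush {f : ℝ → ℂ} (hc : HasCompactSupport f) :
    HasCompactSupport (logPush f) := by
  obtain ⟨R, hR⟩ := exists_logPush_eq_zero hc
  exact HasCompactSupport.intro isCompact_Icc hR

theorem contDiff_logPush {f : ℝ → ℂ} (hf : ContDiff ℝ ∞ f) (hc : HasCompactSupport f) :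
    ContDiff ℝ ∞ (logPush f) := by
  obtain ⟨R, hR⟩ := exists_logPush_eq_zero hc
  rw [contDiff_iff_contDiffAt]
  intro x
  rcases lt_or_ge 0 x with h | h
  · have hlog : ContDiffAt ℝ ∞ Real.log x := Real.contDiffAt_log.2 h.ne'
    have h1 : ContDiffAt ℝ ∞ (fun x => (Real.exp (-Real.log x / 2) : ℂ) * f (Real.log x)) x := by
      refine ContDiffAt.mul ?_ (hf.contDiffAt.comp x hlog)
      exact Complex.ofRealCLM.contDiff.contDiffAt.comp x (hlog.neg.div_const 2).exp
    refine h1.congr_of_eventuallyEq ?_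
    filter_upwards [lt_mem_nhds h] with y hy
    rw [logPush, if_pos hy]
  · refine (contDiffAt_const (c := (0 : ℂ))).congr_of_eventuallyEq ?_
    filter_upwards [gt_mem_nhds (h.trans_lt (Real.exp_pos (-R)))] with y hy
    exact hR y fun h' => absurd h'.1 (not_le.2 hy)

/-- `L²` classes of smooth compactly supported functions. -/
def testVectors : Set L2 :=
  {u | ∃ (f : ℝ → ℂ) (h : MemLp f 2 volume), ContDiff ℝ ∞ f ∧ HasCompactSupport f ∧ u = h.toLp f}

theorem dense_testVectors : Dense testVectors := by
  intro u
  refine (mem_closure_iff_nhds_basis Metric.nhds_basis_closedBall).2 fun ε hε => ?_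
  obtain ⟨g, hg₁, hg₂, hg₃⟩ := MemLp.exist_eLpNorm_sub_le (by norm_num) (by norm_num)
    (Lp.memLp u) hε
  have hg : MemLp g 2 volume := hg₂.continuous.memLp_of_hasCompactSupport hg₁
  refine ⟨hg.toLp g, ⟨g, hg, hg₂, hg₁, rfl⟩, ?_⟩
  have : ((hg.toLp g : L2) : ℝ → ℂ) - (u : ℝ → ℂ) =ᵐ[volume] g - (u : ℝ → ℂ) := by
    filter_upwards [hg.coeFn_toLp] with x hx
    rw [Pi.sub_apply, Pi.sub_apply, hx]
  rw [Metric.mem_closedBall, Lp.dist_def, eLpNorm_congr_ae this, eLpNorm_sub_comm]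
  exact ENNReal.toReal_le_of_le_ofReal hε.le hg₃

/-- Polarisation over $\mathbb C$ plus density. Thus the diagonalisation of $T_\pm$ only requires
comparing quadratic forms, that is, integrals of squared moduli. -/
theorem eq_zero_of_inner_testVectors (X : L2 →L[ℂ] L2) (h : ∀ u ∈ testVectors, ⟪X u, u⟫_ℂ = 0) :
    X = 0 := by
  have hall : ∀ u, ⟪X u, u⟫_ℂ = 0 := fun u =>
    dense_testVectors.induction (P := fun u => ⟪X u, u⟫_ℂ = 0) h
      (isClosed_eq (X.continuous.inner continuous_id) continuous_const) u
  ext1 u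
  have := (inner_map_self_eq_zero (X : L2 →ₗ[ℂ] L2)).1 hall
  exact DFunLike.congr_fun this u

/-- The partial isometry identity $UU^*U=U$ gives the claim on the range of $U$, which contains the
dense set of test functions $f=U(\mathtt{logPush}\,f)$. -/
theorem logMap_comp_adjoint (u : L2) : logMap (adjoint logMap u) = u := by
  have h : ∀ u ∈ testVectors, logMap (adjoint logMap u) = u := by
    rintro u ⟨f, hf, hfs, hfc, rfl⟩
    have hv : MemLp (logPush f) 2 volume :=
      (contDiff_logPush hfs hfc).continuous.memLp_of_hasCompactSupport
        (hasCompactSupport_logPush hfc)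
    have : hf.toLp f = logMap (hv.toLp _) := by
      rw [logMap_toLp, MemLp.toLp_eq_toLp_iff, expPull_logPush]
    rw [this, logMap_adjoint_logMap]
  exact dense_testVectors.induction (P := fun u => logMap (adjoint logMap u) = u) h
    (isClosed_eq ((logMap.continuous).comp (adjoint logMap).continuous) continuous_id) u

theorem adjoint_logMap_toLp {f : ℝ → ℂ} (hf : MemLp f 2 volume)
    (hv : MemLp (logPush f) 2 volume) : adjoint logMap (hf.toLp f) = hv.toLp (logPush f) := by
  have : hf.toLp f = logMap (hv.toLp _) := by
    rw [logMap_toLp, MemLp.toLp_eq_toLp_iff, expPull_logPush]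
  rw [this, adjoint_logMap_logMap]
  apply Lp.ext
  filter_upwards [coeFn_halfLine (hv.toLp (logPush f)), hv.coeFn_toLp] with x h1 h2
  rw [h1]
  by_cases h : x ∈ Ioi (0 : ℝ)
  · rw [indicator_of_mem h]
  · rw [indicator_of_notMem h, h2, logPush, if_neg (show ¬ 0 < x from h)]

/-- With $x=e^t$ and $\xi=\varepsilon e^\tau$ the phase depends only on $t+\tau$, so the Fourier
transform becomes the Laplace transform at the imaginary point $2\pi i\varepsilon$. -/
theorem fourier_logPush (f : ℝ → ℂ) {ε τ : ℝ} :
    expPull (fun ξ => 𝓕 (logPush f) (ε * ξ)) τ =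
      logLaplace ((2 * Real.pi * ε : ℝ) * Complex.I) f τ := by
  have h1 : 𝓕 (logPush f) (ε * Real.exp τ) =
      ∫ x in Ioi 0, Complex.exp ((-2 * Real.pi * x * (ε * Real.exp τ) : ℝ) * Complex.I) •
        logPush f x := by
    rw [Real.fourier_real_eq_integral_exp_smul, ← integral_indicator measurableSet_Ioi]
    congr 1
    ext x
    by_cases h : x ∈ Ioi (0 : ℝ)
    · rw [indicator_of_mem h]
    · rw [indicator_of_notMem h, logPush, if_neg (show ¬ 0 < x from h), smul_zero]
  rw [expPull, h1, ← integral_comp_exp, ← integral_const_mul, logLaplace]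
  congr 1
  ext t
  have h2 : Real.exp t • logPush f (Real.exp t) = (Real.exp (t / 2) : ℂ) * f t := by
    have := congrFun (expPull_logPush f) t
    rw [expPull] at this
    rw [← this, Complex.real_smul, ← mul_assoc, ← Complex.ofReal_mul, ← Real.exp_add, add_halves]
  rw [smul_comm, h2, laplaceKernel, add_div, Real.exp_add, Real.exp_add, smul_eq_mul]
  have h3 : Complex.exp ((-2 * Real.pi * Real.exp t * (ε * Real.exp τ) : ℝ) * Complex.I) =
      Complex.exp (-((2 * Real.pi * ε : ℝ) * Complex.I * ((Real.exp t * Real.exp τ : ℝ) : ℂ))) := by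
    congr 1
    push_cast
    ring
  rw [h3, Complex.ofReal_mul (Real.exp (t / 2))]
  ring

theorem setIntegral_Iio_zero (F : ℝ → ℝ) : ∫ ξ in Iio 0, F ξ = ∫ ξ in Ioi 0, F (-ξ) := by
  rw [← integral_Iic_eq_integral_Iio]
  simp

theorem setIntegral_norm_fourier_logPush {f : ℝ → ℂ} (hf : ContDiff ℝ ∞ f)
    (hc : HasCompactSupport f) {ε : ℝ} (hε : ε = 1 ∨ ε = -1) :
    ∫ ξ in Ioi 0, ‖𝓕 (logPush f) (ε * ξ)‖ ^ 2 = ∫ s, mellinSymbol ε s * ‖𝓕 f s‖ ^ 2 := by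
  rw [← integral_norm_sq_logLaplace_boundary hf hc hε, ← integral_norm_expPull_sq]
  simp_rw [fourier_logPush]

/-! ### Mellin multipliers and the diagonalisation of the half-line compression. -/

theorem mellinSymbol_pos (ε s : ℝ) : 0 < mellinSymbol ε s := by
  unfold mellinSymbol; positivity

theorem mellinSymbol_le_one (ε s : ℝ) : mellinSymbol ε s ≤ 1 :=
  inv_le_one_of_one_le₀ (by linarith [Real.exp_pos (-(4 * Real.pi ^ 2 * (ε * s)))])

theorem continuous_mellinSymbol (ε : ℝ) : Continuous (mellinSymbol ε) := by
  unfold mellinSymbol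
  exact Continuous.inv₀ (by fun_prop) fun s => by positivity

theorem isBddMeas_mellinSymbol (ε : ℝ) : IsBddMeas (fun s => (mellinSymbol ε s : ℂ)) 1 where
  meas := (Complex.continuous_ofReal.comp (continuous_mellinSymbol ε)).stronglyMeasurable
  bound s := by
    rw [Complex.norm_real, Real.norm_of_nonneg (mellinSymbol_pos ε s).le]
    exact mellinSymbol_le_one ε s

/-- The operator on `L²(0, ∞)` which acts as multiplication by `φ` after a Mellin transform. -/
def mellinMul {φ : ℝ → ℂ} {C : ℝ} (h : IsBddMeas φ C) : L2 →L[ℂ] L2 :=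
  adjoint logMap ∘L fourierInvCLM ∘L h.mulOp ∘L fourierCLM ∘L logMap

theorem inner_specProj_logPush {Ω : Set ℝ} (hΩ : MeasurableSet Ω) {ε : ℝ}
    (hε : (ε = 1 ∧ Ω = Ioi 0) ∨ (ε = -1 ∧ Ω = Iio 0)) {f : ℝ → ℂ} (hf : ContDiff ℝ ∞ f)
    (hc : HasCompactSupport f) (hv : MemLp (logPush f) 2 volume) :
    ⟪hv.toLp (logPush f), specProj Ω hΩ (hv.toLp (logPush f))⟫_ℂ =
      ((∫ s, mellinSymbol ε s * ‖𝓕 f s‖ ^ 2 : ℝ) : ℂ) := by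
  have hv1 : Integrable (logPush f) :=
    (contDiff_logPush hf hc).continuous.integrable_of_hasCompactSupport
      (hasCompactSupport_logPush hc)
  have hsq : ∀ z : ℂ, conj z * z = ((‖z‖ ^ 2 : ℝ) : ℂ) := fun z => by
    rw [mul_comm, Complex.mul_conj, Complex.normSq_eq_norm_sq]
  rw [inner_specProj]
  have h1 : ∫ ξ in Ω, conj ((𝓕 (hv.toLp (logPush f)) : L2) ξ) *
      (𝓕 (hv.toLp (logPush f)) : L2) ξ = ((∫ ξ in Ω, ‖𝓕 (logPush f) ξ‖ ^ 2 : ℝ) : ℂ) := by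
    rw [← integral_complex_ofReal]
    refine setIntegral_congr_ae hΩ ?_
    filter_upwards [coeFn_fourier_toLp hv1 hv] with ξ hξ _
    rw [hξ, hsq]
  rw [h1]
  congr 1
  rcases hε with ⟨rfl, rfl⟩ | ⟨rfl, rfl⟩
  · rw [← setIntegral_norm_fourier_logPush hf hc (Or.inl rfl)]
    simp
  · rw [← setIntegral_norm_fourier_logPush hf hc (Or.inr rfl), setIntegral_Iio_zero]
    simp

theorem inner_mulOp_mellinSymbol (ε : ℝ) {f : ℝ → ℂ} (h1 : Integrable f) (hf : MemLp f 2 volume) :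
    ⟪hf.toLp f, fourierInvCLM ((isBddMeas_mellinSymbol ε).mulOp (fourierCLM (hf.toLp f)))⟫_ℂ =
      ((∫ s, mellinSymbol ε s * ‖𝓕 f s‖ ^ 2 : ℝ) : ℂ) := by
  have hsq : ∀ z : ℂ, z * conj z = ((‖z‖ ^ 2 : ℝ) : ℂ) := fun z => by
    rw [Complex.mul_conj, Complex.normSq_eq_norm_sq]
  rw [inner_fourierInvCLM, L2.inner_def, ← integral_complex_ofReal]
  refine integral_congr_ae ?_
  filter_upwards [coeFn_fourier_toLp h1 hf,
    (isBddMeas_mellinSymbol ε).coeFn_mulOp (fourierCLM (hf.toLp f))] with s hs hs2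
  rw [hs2, fourierCLM_apply, hs, RCLike.inner_apply, mul_assoc, hsq, ← Complex.ofReal_mul]

/-- The truncated half-line projection is diagonalised by the Mellin transform. -/
theorem halfLineCompression_specProj {Ω : Set ℝ} (hΩ : MeasurableSet Ω) {ε : ℝ}
    (hε : (ε = 1 ∧ Ω = Ioi 0) ∨ (ε = -1 ∧ Ω = Iio 0)) :
    halfLineCompression (specProj Ω hΩ) = mellinMul (isBddMeas_mellinSymbol ε) := by
  set A : L2 →L[ℂ] L2 := specProj Ω hΩ with hA
  set Mm : L2 →L[ℂ] L2 :=
    fourierInvCLM ∘L (isBddMeas_mellinSymbol ε).mulOp ∘L fourierCLM with hMm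
  -- On a test function $f$ both forms equal $\int m_\varepsilon|\hat f|^2$. Conjugating back
  -- afterwards uses $U^*U=\chi_+$, which produces the two cutoffs of the compression.
  have hX : logMap ∘L A ∘L adjoint logMap = Mm := by
    rw [← sub_eq_zero]
    refine eq_zero_of_inner_testVectors _ ?_
    rintro u ⟨f, hf, hfs, hfc, rfl⟩
    have hv : MemLp (logPush f) 2 volume :=
      (contDiff_logPush hfs hfc).continuous.memLp_of_hasCompactSupport
        (hasCompactSupport_logPush hfc)
    rw [← inner_conj_symm, sub_apply, inner_sub_right]
    simp only [ContinuousLinearMap.comp_apply, hMm]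
    rw [← ContinuousLinearMap.adjoint_inner_left, adjoint_logMap_toLp hf hv,
      inner_specProj_logPush hΩ hε hfs hfc hv,
      inner_mulOp_mellinSymbol ε (hfs.continuous.integrable_of_hasCompactSupport hfc) hf,
      sub_self, map_zero]
  have h2 : mellinMul (isBddMeas_mellinSymbol ε) = adjoint logMap ∘L Mm ∘L logMap := rfl
  rw [h2, ← hX]
  ext1 u
  simp only [halfLineCompression, ContinuousLinearMap.comp_apply, adjoint_logMap_logMap]

/-! ### Functional calculus for Mellin multipliers. -/

theorem mulOp_congr {φ φ' : ℝ → ℂ} {C C' : ℝ} (h : IsBddMeas φ C) (h' : IsBddMeas φ' C')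
    (heq : φ = φ') : h.mulOp = h'.mulOp := by
  subst heq
  ext1 u
  apply Lp.ext
  exact (h.coeFn_mulOp u).trans (h'.coeFn_mulOp u).symm

theorem mellinMul_congr {φ φ' : ℝ → ℂ} {C C' : ℝ} (h : IsBddMeas φ C) (h' : IsBddMeas φ' C')
    (heq : φ = φ') : mellinMul h = mellinMul h' := by
  rw [mellinMul, mellinMul, mulOp_congr h h' heq]

theorem mellinMul_apply {φ : ℝ → ℂ} {C : ℝ} (h : IsBddMeas φ C) (u : L2) :
    mellinMul h u = adjoint logMap (fourierInvCLM (h.mulOp (fourierCLM (logMap u)))) := rfl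

theorem inner_mellinMul {φ : ℝ → ℂ} {C : ℝ} (h : IsBddMeas φ C) (u v : L2) :
    ⟪u, mellinMul h v⟫_ℂ =
      ∫ s, conj (fourierCLM (logMap u) s) * (φ s * fourierCLM (logMap v) s) := by
  rw [mellinMul_apply, ContinuousLinearMap.adjoint_inner_right, inner_fourierInvCLM, L2.inner_def]
  refine integral_congr_ae ?_
  filter_upwards [h.coeFn_mulOp (fourierCLM (logMap v))] with s hs
  rw [hs, RCLike.inner_apply, mul_comm]

theorem isBddMeas_boundedContinuous (f : BoundedContinuousFunction ℝ ℂ) : IsBddMeas f ‖f‖ where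
  meas := f.continuous.stronglyMeasurable
  bound := f.norm_coe_le_norm

/-- The representation of bounded continuous functions by Mellin multipliers. -/
def mellinRep : BoundedContinuousFunction ℝ ℂ →⋆ₙₐ[ℂ] (L2 →L[ℂ] L2) where
  toFun f := mellinMul (isBddMeas_boundedContinuous f)
  map_smul' c f := by
    ext1 u
    refine ext_inner_left ℂ fun v => ?_
    rw [MonoidHom.id_apply, smul_apply, inner_smul_right, inner_mellinMul,
      inner_mellinMul, ← integral_const_mul]
    congr 1
    ext s
    rw [BoundedContinuousFunction.coe_smul]
    simp only [smul_eq_mul]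
    ring
  map_zero' := by
    ext1 u
    refine ext_inner_left ℂ fun v => ?_
    simp [inner_mellinMul]
  map_add' f g := by
    ext1 u
    refine ext_inner_left ℂ fun v => ?_
    have hint : ∀ f : BoundedContinuousFunction ℝ ℂ, Integrable fun s =>
        conj (fourierCLM (logMap v) s) * (f s * fourierCLM (logMap u) s) := fun f => by
      refine (L2.integrable_inner (𝕜 := ℂ) (fourierCLM (logMap v))
        ((isBddMeas_boundedContinuous f).mulOp (fourierCLM (logMap u)))).congr ?_
      filter_upwards [(isBddMeas_boundedContinuous f).coeFn_mulOp (fourierCLM (logMap u))]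
        with s hs
      rw [hs, RCLike.inner_apply, mul_comm]
    rw [add_apply, inner_add_right, inner_mellinMul,
      inner_mellinMul, inner_mellinMul, ← integral_add (hint f) (hint g)]
    congr 1
    ext s
    rw [BoundedContinuousFunction.coe_add, Pi.add_apply]
    ring
  map_mul' f g := by
    ext1 u
    rw [mul_apply_eq_comp]
    simp only [mellinMul_apply, logMap_comp_adjoint, fourierCLM_fourierInvCLM]
    congr 2
    apply Lp.ext
    filter_upwards [(isBddMeas_boundedContinuous (f * g)).coeFn_mulOp (fourierCLM (logMap u)),
      (isBddMeas_boundedContinuous g).coeFn_mulOp (fourierCLM (logMap u)),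
      (isBddMeas_boundedContinuous f).coeFn_mulOp
        ((isBddMeas_boundedContinuous g).mulOp (fourierCLM (logMap u)))] with s h1 h2 h3
    rw [h1, h3, h2, BoundedContinuousFunction.coe_mul, Pi.mul_apply, mul_assoc]
  map_star' f := by
    rw [ContinuousLinearMap.star_eq_adjoint, ContinuousLinearMap.eq_adjoint_iff]
    intro u v
    rw [inner_mellinMul, ← inner_conj_symm, inner_mellinMul, ← integral_conj]
    congr 1
    ext s
    rw [BoundedContinuousFunction.star_apply, map_mul, map_mul, Complex.conj_conj,
      RCLike.star_def, Complex.conj_conj]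
    ring

/-- Evaluation at $s$ is a continuous star homomorphism to $\mathbb C$, and the functional calculus
commutes with such maps. -/
theorem cfc_boundedContinuous_apply {G : ℂ → ℂ} (hG : Continuous G)
    (f : BoundedContinuousFunction ℝ ℂ) (s : ℝ) : cfc G f s = G (f s) := by
  set ev : BoundedContinuousFunction ℝ ℂ →⋆ₐ[ℂ] ℂ :=
    { toFun := fun f => f s
      map_one' := rfl
      map_mul' := fun _ _ => rfl
      map_zero' := rfl
      map_add' := fun _ _ => rfl
      commutes' := fun _ => rfl
      map_star' := fun _ => rfl } with hev
  have hcont : Continuous ev := continuous_eval_const s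
  have h := StarAlgHom.map_cfc ev G f hG.continuousOn hcont (by exact ⟨mul_comm _ _⟩)
    (by exact ⟨mul_comm _ _⟩)
  have h2 : cfc G (ev f) = G (ev f) := by
    simpa using cfc_algebraMap (A := ℂ) (ev f) G
  rw [h2] at h
  exact h

theorem isSelfAdjoint_mellinMul {φ : ℝ → ℝ} {C : ℝ} (h : IsBddMeas (fun s => (φ s : ℂ)) C) :
    IsSelfAdjoint (mellinMul h) := by
  rw [ContinuousLinearMap.isSelfAdjoint_iff', eq_comm, ContinuousLinearMap.eq_adjoint_iff]
  intro u v
  rw [inner_mellinMul, ← inner_conj_symm, inner_mellinMul, ← integral_conj]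
  congr 1
  ext s
  rw [map_mul, map_mul, Complex.conj_conj, Complex.conj_ofReal]
  ring

/-- Functions of an operator diagonalised by the Mellin transform. -/
theorem funOfOp_mellinMul {g : ℝ → ℂ} (hg : Continuous g) (hg0 : g 0 = 0) {φ : ℝ → ℝ} {C C' : ℝ}
    (hφ : Continuous φ) (h : IsBddMeas (fun s => (φ s : ℂ)) C)
    (h' : IsBddMeas (fun s => g (φ s)) C') :
    funOfOp g (mellinMul h) = mellinMul h' := by
  set f : BoundedContinuousFunction ℝ ℂ :=
    BoundedContinuousFunction.ofNormedAddCommGroup (fun s => (φ s : ℂ))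
      (Complex.continuous_ofReal.comp hφ) C h.bound with hf
  have hG : Continuous fun z : ℂ => g z.re := hg.comp Complex.continuous_re
  have hT : mellinMul h = mellinRep f := mellinMul_congr _ _ rfl
  have hfn : IsStarNormal f := ⟨mul_comm _ _⟩
  have hTn : IsStarNormal (mellinRep f) := hT ▸ (isSelfAdjoint_mellinMul h).isStarNormal
  have hcont : Continuous mellinRep := AddMonoidHomClass.continuous_of_bound mellinRep 1 fun f => by
    rw [one_mul]; exact NonUnitalStarAlgHom.norm_apply_le mellinRep f
  -- The Mellin representation sends $1$ to the projection $\chi_+$, not to the identity, so it only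
  -- commutes with the non-unital calculus; $g(0)=0$ makes the two calculi agree.
  rw [funOfOp, hT, ← cfcₙ_eq_cfc (hG.continuousOn) (by simpa using hg0),
    ← NonUnitalStarAlgHom.map_cfcₙ mellinRep (fun z : ℂ => g z.re) f hG.continuousOn
      (by simpa using hg0) hcont hfn hTn, cfcₙ_eq_cfc hG.continuousOn (by simpa using hg0)]
  refine mellinMul_congr _ _ ?_
  ext s
  rw [cfc_boundedContinuous_apply hG]
  simp [hf]

/-! ### Hilbert–Schmidt factorisation of a localised kernel times a Mellin multiplier. -/

/-- The Lorentz weight `(1 + s²)⁻¹`. -/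
abbrev lorentz (s : ℝ) : ℝ := (1 + s ^ 2)⁻¹

theorem lorentz_pos (s : ℝ) : 0 < lorentz s := by unfold lorentz; positivity

theorem lorentz_le_one (s : ℝ) : lorentz s ≤ 1 :=
  inv_le_one_of_one_le₀ (by nlinarith [sq_nonneg s])

theorem continuous_lorentz : Continuous lorentz :=
  Continuous.inv₀ (by fun_prop) fun s => by positivity

theorem integrable_lorentz_sq : Integrable fun s => lorentz s ^ 2 := by
  refine integrable_inv_one_add_sq.mono' (continuous_lorentz.pow 2).aestronglyMeasurable
    (Filter.Eventually.of_forall fun s => ?_)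
  rw [Real.norm_of_nonneg (sq_nonneg _), sq]
  exact mul_le_of_le_one_right (lorentz_pos s).le (lorentz_le_one s)

theorem memLp_lorentz : MemLp lorentz 2 volume :=
  (memLp_two_iff_integrable_sq continuous_lorentz.aestronglyMeasurable).2 integrable_lorentz_sq

theorem memLp_two_of_le_lorentz_sq {q : ℝ → ℂ} (hq : AEStronglyMeasurable q volume) {C : ℝ}
    (h : ∀ s, ‖q s‖ ≤ C * lorentz s ^ 2) : MemLp q 2 volume := by
  refine (memLp_lorentz.const_mul |C|).mono' hq (Filter.Eventually.of_forall fun s => ?_)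
  refine (h s).trans ?_
  rw [sq, ← mul_assoc]
  have h1 := lorentz_pos s
  refine (mul_le_of_le_one_right ?_ (lorentz_le_one s)).trans' ?_
  · positivity
  · gcongr
    exact le_abs_self C

theorem integrable_of_le_lorentz_sq {q : ℝ → ℂ} (hq : AEStronglyMeasurable q volume) {C : ℝ}
    (h : ∀ s, ‖q s‖ ≤ C * lorentz s ^ 2) : Integrable q :=
  (integrable_lorentz_sq.const_mul C).mono' hq (Filter.Eventually.of_forall h)

theorem logPush_of_notMem (f : ℝ → ℂ) {x : ℝ} (hx : x ∉ Ioi (0 : ℝ)) : logPush f x = 0 :=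
  if_neg hx

theorem memLp_logPush {f : ℝ → ℂ} (hf : StronglyMeasurable f) (h : MemLp f 2 volume) :
    MemLp (logPush f) 2 volume := by
  have hm : StronglyMeasurable (logPush f) := by
    refine StronglyMeasurable.ite measurableSet_Ioi ?_ stronglyMeasurable_const
    refine StronglyMeasurable.mul ?_ (hf.comp_measurable Real.measurable_log)
    exact (by fun_prop : Measurable fun x => ((Real.exp (-Real.log x / 2) : ℝ) : ℂ)).stronglyMeasurable
  rw [memLp_two_iff_integrable_sq_norm hm.aestronglyMeasurable]
  have h1 : IntegrableOn (fun x => ‖logPush f x‖ ^ 2) (Ioi 0) := by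
    rw [← integrable_comp_exp]
    simp_rw [← norm_expPull_sq, expPull_logPush]
    exact (memLp_two_iff_integrable_sq_norm h.1).1 h
  rw [← integrable_indicator_iff measurableSet_Ioi] at h1
  refine h1.congr (Filter.Eventually.of_forall fun x => ?_)
  by_cases hx : x ∈ Ioi (0 : ℝ)
  · rw [indicator_of_mem hx]
  · simp [indicator_of_notMem hx, logPush_of_notMem f hx]

theorem integral_logPush_mul (f u : ℝ → ℂ) :
    ∫ y, logPush f y * u y = ∫ t, f t * expPull u t := by
  have h1 : ∫ y, logPush f y * u y = ∫ y in Ioi 0, logPush f y * u y := by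
    rw [← integral_indicator measurableSet_Ioi]
    congr 1
    ext y
    by_cases hy : y ∈ Ioi (0 : ℝ)
    · rw [indicator_of_mem hy]
    · rw [indicator_of_notMem hy, logPush_of_notMem f hy, zero_mul]
  rw [h1, ← integral_comp_exp]
  congr 1
  ext t
  have h2 := congrFun (expPull_logPush f) t
  rw [expPull] at h2
  rw [← h2, expPull, Complex.real_smul, mul_mul_mul_comm, mul_mul_mul_comm]
  rw [show (Real.exp t : ℂ) = Real.exp (t / 2) * Real.exp (t / 2) by
    rw [← Complex.ofReal_mul, ← Real.exp_add, add_halves]]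
  ring

theorem inner_fourierCLM_right (a v : L2) : ⟪a, fourierCLM v⟫_ℂ = ⟪fourierInvCLM a, v⟫_ℂ := by
  have h := inner_fourierInvCLM (fourierInvCLM a) (fourierCLM v)
  rw [fourierCLM_fourierInvCLM, fourierInvCLM_fourierCLM] at h
  exact h.symm

theorem fourierInv_conj (q : ℝ → ℂ) (t : ℝ) : 𝓕⁻ (fun s => conj (q s)) t = conj (𝓕 q t) := by
  rw [Real.fourierInv_eq', Real.fourier_eq', ← integral_conj]
  congr 1
  ext s
  rw [smul_eq_mul, smul_eq_mul, map_mul, ← Complex.exp_conj]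
  simp [Complex.conj_ofNat]

theorem fourier_conj (q : ℝ → ℂ) (t : ℝ) : 𝓕 (fun s => conj (q s)) t = conj (𝓕⁻ q t) := by
  have := fourierInv_conj q (-t)
  rw [Real.fourierInv_eq_fourier_neg, neg_neg] at this
  rw [this, Real.fourierInv_eq_fourier_neg]

/-- Duality between the `L¹ ∩ L²` and the `L²` Fourier transforms. -/
theorem integral_mul_fourierCLM {q : ℝ → ℂ} (h1 : Integrable q) (h2 : MemLp q 2 volume) (v : L2) :
    ∫ s, q s * fourierCLM v s = ∫ t, 𝓕 q t * v t := by
  have h1' : Integrable fun s => conj (q s) := by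
    rw [← memLp_one_iff_integrable] at h1 ⊢
    exact h1.star
  have h2' : MemLp (fun s => conj (q s)) 2 volume := h2.star
  have e := inner_fourierCLM_right (h2'.toLp _) v
  rw [inner_toLp_left, fourierInvCLM_apply, L2.inner_def] at e
  simp only [Complex.conj_conj] at e
  rw [e]
  refine integral_congr_ae ?_
  filter_upwards [coeFn_fourierInv_toLp h1' h2'] with t ht
  rw [ht, RCLike.inner_apply, fourierInv_conj, Complex.conj_conj, mul_comm]

/-- Adding the derivative multiplies the transform by $1+2\pi it$, which never vanishes and has
square integrable inverse: a derivative in $s$ is traded for integrability in $t$. -/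
theorem fourier_add_deriv {q q' : ℝ → ℂ} (hd : ∀ s, HasDerivAt q (q' s) s) (hq : Integrable q)
    (hq' : Integrable q') (t : ℝ) :
    𝓕 (fun s => q s + q' s) t = (1 + 2 * Real.pi * Complex.I * t) * 𝓕 q t := by
  have hder : deriv q = q' := funext fun s => (hd s).deriv
  have h := congrFun (Real.fourier_deriv hq (fun s => (hd s).differentiableAt)
    (by rw [hder]; exact hq')) t
  rw [hder, smul_eq_mul] at h
  have hadd : 𝓕 (fun s => q s + q' s) t = 𝓕 q t + 𝓕 q' t := by
    exact congrFun (VectorFourier.fourierIntegral_add Real.continuous_fourierChar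
      (L := innerₗ ℝ) (by exact continuous_inner) hq hq') t
  rw [hadd, h]
  ring

/-- A measurable kernel localised in `1 ≤ x ≤ X` with quadratic decay in `y`. -/
structure IsLocalKernel (b : ℝ → ℝ → ℂ) (M X : ℝ) : Prop where
  meas : StronglyMeasurable (Function.uncurry b)
  bound : ∀ x y, ‖b x y‖ ≤ M * (Icc 1 X).indicator (fun _ => (1 : ℝ)) x * lorentz y

/-- A continuously differentiable function decaying quartically together with its derivative. -/
structure IsDecaying (h h' : ℝ → ℂ) (H : ℝ) : Prop where
  hasDeriv : ∀ s, HasDerivAt h (h' s) s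
  cont : Continuous h'
  bound : ∀ s, ‖h s‖ ≤ H * lorentz s ^ 2
  bound' : ∀ s, ‖h' s‖ ≤ H * lorentz s ^ 2

theorem memLp_indicator_Icc (M X : ℝ) :
    MemLp (fun x => M * (Icc 1 X).indicator (fun _ => (1 : ℝ)) x) 2 volume :=
  (memLp_indicator_const 2 measurableSet_Icc (1 : ℝ) (Or.inr (by simp))).const_mul M

namespace IsLocalKernel

variable {b : ℝ → ℝ → ℂ} {M X : ℝ}

theorem isHSKernel (hb : IsLocalKernel b M X) :
    IsHSKernel b (fun x => M * (Icc 1 X).indicator (fun _ => (1 : ℝ)) x) lorentz where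
  meas := hb.meas
  left := memLp_indicator_Icc M X
  right := memLp_lorentz
  bound := hb.bound

theorem nonneg_mul (hb : IsLocalKernel b M X) (x : ℝ) :
    0 ≤ M * (Icc 1 X).indicator (fun _ => (1 : ℝ)) x := by
  have := (norm_nonneg _).trans (hb.bound x 0)
  simpa [lorentz] using this

theorem stronglyMeasurable_expPull (hb : IsLocalKernel b M X) :
    StronglyMeasurable (Function.uncurry fun x t => expPull (b x) t) := by
  refine StronglyMeasurable.mul ?_ ?_
  · exact (by fun_prop : Continuous fun p : ℝ × ℝ =>
      ((Real.exp (p.2 / 2) : ℝ) : ℂ)).stronglyMeasurable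
  · exact hb.meas.comp_measurable
      (by fun_prop : Measurable fun p : ℝ × ℝ => (p.1, Real.exp p.2))

/-- For $t\le0$ the factor $e^{t/2}$ suffices; for $t\ge0$ one has $(1+e^{2t})^{-1}\le e^{-t}$.
Exponential decay in $t$ makes the Mellin transform of a row differentiable. -/
theorem norm_expPull_le (hb : IsLocalKernel b M X) (x t : ℝ) :
    ‖expPull (b x) t‖ ≤
      M * (Icc 1 X).indicator (fun _ => (1 : ℝ)) x * Real.exp (-|t| / 2) := by
  rw [expPull, norm_mul, Complex.norm_real, Real.norm_of_nonneg (Real.exp_pos _).le]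
  calc _ ≤ Real.exp (t / 2) * (M * (Icc 1 X).indicator (fun _ => (1 : ℝ)) x *
        lorentz (Real.exp t)) := by gcongr; exact hb.bound x _
    _ = M * (Icc 1 X).indicator (fun _ => (1 : ℝ)) x *
        (Real.exp (t / 2) * lorentz (Real.exp t)) := by ring
    _ ≤ _ := by
      refine mul_le_mul_of_nonneg_left ?_ (hb.nonneg_mul x)
      rcases le_total 0 t with h | h
      · rw [abs_of_nonneg h]
        calc _ ≤ Real.exp (t / 2) * Real.exp (-t) := by
              gcongr
              rw [Real.exp_neg]
              refine inv_anti₀ (Real.exp_pos _) ?_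
              nlinarith [Real.one_le_exp h]
          _ = _ := by rw [← Real.exp_add]; congr 1; ring
      · rw [abs_of_nonpos h, neg_neg]
        exact mul_le_of_le_one_right (Real.exp_pos _).le (lorentz_le_one _)

theorem integrable_expPull (hb : IsLocalKernel b M X) (x : ℝ) : Integrable (expPull (b x)) :=
  (integrable_exp_neg_abs_half.const_mul _).mono'
    (hb.stronglyMeasurable_expPull.comp_measurable measurable_prodMk_left).aestronglyMeasurable
    (Filter.Eventually.of_forall (hb.norm_expPull_le x))

theorem abs_mul_exp_le (t : ℝ) : |t| * Real.exp (-|t| / 2) ≤ 50 * lorentz t := by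
  rw [neg_div, Real.exp_neg, ← div_eq_mul_inv, ← div_eq_mul_inv,
    div_le_div_iff₀ (Real.exp_pos _) (by positivity)]
  -- With $v=|t|/2$, the bounds $v\le e^v$ and $v^3/6\le e^v$ give $|t|+|t|^3\le(2+48)e^v$.
  have h3 := Real.pow_div_factorial_le_exp (|t| / 2) (by positivity) 3
  have h1 := Real.pow_div_factorial_le_exp (|t| / 2) (by positivity) 1
  norm_num [Nat.factorial] at h3 h1
  have : |t| * (1 + t ^ 2) = |t| + |t| ^ 3 := by rw [← sq_abs]; ring
  rw [this]
  nlinarith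

theorem norm_mul_expPull_le (hb : IsLocalKernel b M X) (x t : ℝ) :
    ‖(-2 * Real.pi * Complex.I * t : ℂ) • expPull (b x) t‖ ≤
      M * (Icc 1 X).indicator (fun _ => (1 : ℝ)) x * (2 * Real.pi * 50 * lorentz t) := by
  have h1 : ‖(-2 * Real.pi * Complex.I * t : ℂ)‖ = 2 * Real.pi * |t| := by
    simp [abs_of_pos Real.pi_pos]
  rw [norm_smul, h1]
  calc _ ≤ 2 * Real.pi * |t| * (M * (Icc 1 X).indicator (fun _ => (1 : ℝ)) x *
        Real.exp (-|t| / 2)) := by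
        gcongr; exact hb.norm_expPull_le x t
    _ = M * (Icc 1 X).indicator (fun _ => (1 : ℝ)) x *
        (2 * Real.pi * (|t| * Real.exp (-|t| / 2))) := by ring
    _ ≤ M * (Icc 1 X).indicator (fun _ => (1 : ℝ)) x * (2 * Real.pi * (50 * lorentz t)) := by
        refine mul_le_mul_of_nonneg_left ?_ (hb.nonneg_mul x)
        exact mul_le_mul_of_nonneg_left (abs_mul_exp_le t) (by positivity)
    _ = _ := by ring

theorem integrable_mul_expPull (hb : IsLocalKernel b M X) (x : ℝ) :
    Integrable fun t : ℝ => (-2 * Real.pi * Complex.I * t : ℂ) • expPull (b x) t := by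
  refine (((integrable_inv_one_add_sq.const_mul (2 * Real.pi * 50))).const_mul
    (M * (Icc 1 X).indicator (fun _ => (1 : ℝ)) x)).mono'
    ?_ (Filter.Eventually.of_forall (hb.norm_mul_expPull_le x))
  exact (by fun_prop : Continuous fun t : ℝ =>
    (-2 * Real.pi * Complex.I * t : ℂ)).aestronglyMeasurable.smul (hb.integrable_expPull x).1

/-- The Mellin transform of the rows of the kernel. -/
def rowMellin (b : ℝ → ℝ → ℂ) (x s : ℝ) : ℂ := 𝓕⁻ (expPull (b x)) s

/-- The derivative of the Mellin transform of the rows of the kernel. -/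
def rowMellinDeriv (b : ℝ → ℝ → ℂ) (x s : ℝ) : ℂ :=
  -𝓕⁻ (fun t : ℝ => (-2 * Real.pi * Complex.I * t : ℂ) • expPull (b x) t) s

theorem hasDerivAt_rowMellin (hb : IsLocalKernel b M X) (x s : ℝ) :
    HasDerivAt (rowMellin b x) (rowMellinDeriv b x s) s := by
  have hi : Integrable fun t : ℝ => t • expPull (b x) t := by
    have := (hb.integrable_mul_expPull x).const_mul (-2 * Real.pi * Complex.I : ℂ)⁻¹
    refine this.congr (Filter.Eventually.of_forall fun t => ?_)
    have : (-2 * Real.pi * Complex.I : ℂ) ≠ 0 := by simp [Real.pi_ne_zero]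
    simp only [smul_eq_mul, Complex.real_smul]
    field_simp
  have h := Real.hasDerivAt_fourier (hb.integrable_expPull x) hi (-s)
  have h2 := h.scomp s (hasDerivAt_neg s)
  have e : rowMellin b x = 𝓕 (expPull (b x)) ∘ Neg.neg := funext fun s =>
    Real.fourierInv_eq_fourier_neg _ s
  rw [e, rowMellinDeriv, Real.fourierInv_eq_fourier_neg]
  simpa using h2

theorem norm_fourierInv_le {f : ℝ → ℂ} {F : ℝ → ℝ} (hF : Integrable F) (h : ∀ t, ‖f t‖ ≤ F t)
    (s : ℝ) : ‖𝓕⁻ f s‖ ≤ ∫ t, F t := by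
  rw [Real.fourierInv_eq']
  refine norm_integral_le_of_norm_le hF (Filter.Eventually.of_forall fun t => ?_)
  rw [norm_smul, Complex.norm_exp_ofReal_mul_I, one_mul]
  exact h t

theorem stronglyMeasurable_fourierInv {F : ℝ → ℝ → ℂ}
    (hF : StronglyMeasurable (Function.uncurry F)) :
    StronglyMeasurable (Function.uncurry fun x s => 𝓕⁻ (F x) s) := by
  simp only [Function.uncurry_def, Real.fourierInv_eq']
  refine StronglyMeasurable.integral_prod_right (f := fun (p : ℝ × ℝ) (t : ℝ) =>
    Complex.exp (((2 * Real.pi * inner ℝ t p.2 : ℝ) : ℂ) * Complex.I) • F p.1 t) ?_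
  refine StronglyMeasurable.smul (𝕜 := ℂ) (β := ℂ) ?_ ?_
  · exact (by fun_prop : Continuous fun z : (ℝ × ℝ) × ℝ =>
      Complex.exp (((2 * Real.pi * inner ℝ z.2 z.1.2 : ℝ) : ℂ) * Complex.I)).stronglyMeasurable
  · exact hF.comp_measurable (by fun_prop : Measurable fun z : (ℝ × ℝ) × ℝ => (z.1.1, z.2))

theorem stronglyMeasurable_rowMellin (hb : IsLocalKernel b M X) :
    StronglyMeasurable (Function.uncurry (rowMellin b)) :=
  stronglyMeasurable_fourierInv hb.stronglyMeasurable_expPull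

theorem stronglyMeasurable_rowMellinDeriv (hb : IsLocalKernel b M X) :
    StronglyMeasurable (Function.uncurry (rowMellinDeriv b)) := by
  refine (stronglyMeasurable_fourierInv (F := fun (x t : ℝ) =>
    (-2 * Real.pi * Complex.I * t : ℂ) • expPull (b x) t) ?_).neg
  refine StronglyMeasurable.smul (𝕜 := ℂ) (β := ℂ) ?_ hb.stronglyMeasurable_expPull
  exact (by fun_prop : Continuous fun z : ℝ × ℝ =>
    (-2 * Real.pi * Complex.I * z.2 : ℂ)).stronglyMeasurable

theorem exists_norm_rowMellin_le (hb : IsLocalKernel b M X) : ∃ D, 0 ≤ D ∧ ∀ x s,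
    ‖rowMellin b x s‖ ≤ D * (Icc 1 X).indicator (fun _ => (1 : ℝ)) x ∧
    ‖rowMellinDeriv b x s‖ ≤ D * (Icc 1 X).indicator (fun _ => (1 : ℝ)) x := by
  set I₀ := ∫ t : ℝ, Real.exp (-|t| / 2)
  set I₁ := ∫ t : ℝ, 2 * Real.pi * 50 * lorentz t
  refine ⟨|M| * max I₀ I₁, ?_, fun x s => ⟨?_, ?_⟩⟩
  · refine mul_nonneg (abs_nonneg _) (le_max_of_le_left ?_)
    exact integral_nonneg fun t => (Real.exp_pos _).le
  · have := norm_fourierInv_le (integrable_exp_neg_abs_half.const_mul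
      (M * (Icc 1 X).indicator (fun _ => (1 : ℝ)) x)) (hb.norm_expPull_le x) s
    rw [integral_const_mul] at this
    refine this.trans ?_
    have hi : 0 ≤ (Icc 1 X).indicator (fun _ => (1 : ℝ)) x :=
      indicator_nonneg (fun _ _ => zero_le_one) x
    have hI : 0 ≤ I₀ := integral_nonneg fun t => (Real.exp_pos _).le
    calc _ ≤ |M| * (Icc 1 X).indicator (fun _ => (1 : ℝ)) x * max I₀ I₁ := by
          gcongr
          · exact le_abs_self M
          · exact le_max_left _ _
      _ = _ := by ring
  · rw [rowMellinDeriv, norm_neg]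
    have := norm_fourierInv_le ((integrable_inv_one_add_sq.const_mul (2 * Real.pi * 50)).const_mul
      (M * (Icc 1 X).indicator (fun _ => (1 : ℝ)) x)) (hb.norm_mul_expPull_le x) s
    rw [integral_const_mul] at this
    refine this.trans ?_
    have hi : 0 ≤ (Icc 1 X).indicator (fun _ => (1 : ℝ)) x :=
      indicator_nonneg (fun _ _ => zero_le_one) x
    have hI : 0 ≤ I₁ := integral_nonneg fun t => by
      have := lorentz_pos t
      have := Real.pi_pos
      simp only [Pi.zero_apply]
      positivity
    calc _ ≤ |M| * (Icc 1 X).indicator (fun _ => (1 : ℝ)) x * max I₀ I₁ := by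
          gcongr
          · exact le_abs_self M
          · exact le_max_right _ _
      _ = _ := by ring

end IsLocalKernel

namespace IsDecaying

variable {h h' : ℝ → ℂ} {H : ℝ}

theorem continuous (hh : IsDecaying h h' H) : Continuous h :=
  continuous_iff_continuousAt.2 fun s => (hh.hasDeriv s).continuousAt

theorem nonneg (hh : IsDecaying h h' H) : 0 ≤ H := by
  have := (norm_nonneg _).trans (hh.bound 0)
  simpa [lorentz] using this

theorem isBddMeas (hh : IsDecaying h h' H) : IsBddMeas h H where
  meas := hh.continuous.stronglyMeasurable
  bound s := (hh.bound s).trans (mul_le_of_le_one_right hh.nonneg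
    (pow_le_one₀ (lorentz_pos s).le (lorentz_le_one s)))

theorem integrable (hh : IsDecaying h h' H) : Integrable h :=
  integrable_of_le_lorentz_sq hh.continuous.aestronglyMeasurable hh.bound

end IsDecaying

/-- The weight `(1 + 2πit)⁻¹`. -/
def logWeight (t : ℝ) : ℂ := (1 + 2 * Real.pi * Complex.I * t)⁻¹

theorem logWeight_ne (t : ℝ) : (1 + 2 * Real.pi * Complex.I * t : ℂ) ≠ 0 := by
  intro h
  have := congrArg Complex.re h
  simp at this

theorem continuous_logWeight : Continuous logWeight :=
  Continuous.inv₀ (by fun_prop) logWeight_ne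

theorem norm_logWeight_sq_le (t : ℝ) : ‖logWeight t‖ ^ 2 ≤ lorentz t := by
  rw [logWeight, norm_inv, inv_pow, ← Complex.normSq_eq_norm_sq]
  refine inv_anti₀ (by positivity) ?_
  rw [Complex.normSq_apply]
  simp
  have := Real.pi_gt_three
  have h1 : 1 ≤ (2 * Real.pi) ^ 2 := by nlinarith
  nlinarith [mul_le_mul_of_nonneg_right h1 (sq_nonneg t)]

theorem memLp_logWeight : MemLp logWeight 2 volume := by
  rw [memLp_two_iff_integrable_sq_norm continuous_logWeight.aestronglyMeasurable]
  refine integrable_inv_one_add_sq.mono' (continuous_logWeight.norm.pow 2).aestronglyMeasurable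
    (Filter.Eventually.of_forall fun t => ?_)
  rw [Real.norm_of_nonneg (by positivity)]
  exact norm_logWeight_sq_le t

/-- The right factor of the Hilbert–Schmidt factorisation. -/
def rightKernel (s y : ℝ) : ℂ :=
  lorentz s * logPush (fun t => Complex.exp ((-2 * Real.pi * t * s : ℝ) * Complex.I) *
    logWeight t) y

theorem isHSKernel_rightKernel :
    IsHSKernel rightKernel lorentz fun y => ‖logPush logWeight y‖ where
  meas := by
    refine StronglyMeasurable.mul ?_ ?_
    · exact (Complex.continuous_ofReal.comp (continuous_lorentz.comp
        continuous_fst)).stronglyMeasurable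
    · refine StronglyMeasurable.ite (measurableSet_lt measurable_const measurable_snd) ?_
        stronglyMeasurable_const
      refine Measurable.stronglyMeasurable ?_
      have := continuous_logWeight.measurable
      fun_prop
  left := memLp_lorentz
  right := (memLp_logPush continuous_logWeight.stronglyMeasurable memLp_logWeight).norm
  bound s y := by
    rw [rightKernel, norm_mul, Complex.norm_real, Real.norm_of_nonneg (lorentz_pos s).le]
    refine le_of_eq ?_
    congr 1
    rw [logPush, logPush]
    split_ifs
    · rw [norm_mul, norm_mul, norm_mul, Complex.norm_exp_ofReal_mul_I, one_mul]
    · rfl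

theorem integral_rightKernel_mul (u : ℝ → ℂ) (s : ℝ) :
    ∫ y, rightKernel s y * u y = lorentz s * 𝓕 (fun t => logWeight t * expPull u t) s := by
  simp only [rightKernel, mul_assoc]
  rw [integral_const_mul, integral_logPush_mul, Real.fourier_real_eq_integral_exp_smul]
  simp only [smul_eq_mul, mul_assoc]

namespace IsLocalKernel

variable {b : ℝ → ℝ → ℂ} {M X : ℝ} {h h' : ℝ → ℂ} {H : ℝ}

/-- The Mellin transform of a row, multiplied by the symbol. -/
def rowSymbol (h : ℝ → ℂ) (b : ℝ → ℝ → ℂ) (x s : ℝ) : ℂ := h s * rowMellin b x s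

/-- The derivative of `rowSymbol`. -/
def rowSymbolDeriv (h h' : ℝ → ℂ) (b : ℝ → ℝ → ℂ) (x s : ℝ) : ℂ :=
  h' s * rowMellin b x s + h s * rowMellinDeriv b x s

theorem hasDerivAt_rowSymbol (hb : IsLocalKernel b M X) (hh : IsDecaying h h' H) (x s : ℝ) :
    HasDerivAt (rowSymbol h b x) (rowSymbolDeriv h h' b x s) s :=
  (hh.hasDeriv s).mul (hb.hasDerivAt_rowMellin x s)

theorem stronglyMeasurable_rowSymbol (hb : IsLocalKernel b M X) (hh : IsDecaying h h' H) :
    StronglyMeasurable (Function.uncurry (rowSymbol h b)) :=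
  ((hh.continuous.comp continuous_snd).stronglyMeasurable).mul hb.stronglyMeasurable_rowMellin

theorem stronglyMeasurable_rowSymbolDeriv (hb : IsLocalKernel b M X) (hh : IsDecaying h h' H) :
    StronglyMeasurable (Function.uncurry (rowSymbolDeriv h h' b)) :=
  (((hh.cont.comp continuous_snd).stronglyMeasurable).mul hb.stronglyMeasurable_rowMellin).add
    (((hh.continuous.comp continuous_snd).stronglyMeasurable).mul
      hb.stronglyMeasurable_rowMellinDeriv)

theorem exists_norm_rowSymbol_le (hb : IsLocalKernel b M X) (hh : IsDecaying h h' H) :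
    ∃ D, 0 ≤ D ∧ ∀ x s,
      ‖rowSymbol h b x s‖ ≤ D * (Icc 1 X).indicator (fun _ => (1 : ℝ)) x * lorentz s ^ 2 ∧
      ‖rowSymbolDeriv h h' b x s‖ ≤
        D * (Icc 1 X).indicator (fun _ => (1 : ℝ)) x * lorentz s ^ 2 := by
  obtain ⟨D, hD0, hD⟩ := hb.exists_norm_rowMellin_le
  have hH := hh.nonneg
  refine ⟨2 * (H * D), by positivity, fun x s => ?_⟩
  have hi : 0 ≤ (Icc 1 X).indicator (fun _ => (1 : ℝ)) x :=
    indicator_nonneg (fun _ _ => zero_le_one) x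
  have hl := lorentz_pos s
  have key : ∀ p q : ℂ, ‖p‖ ≤ H * lorentz s ^ 2 →
      ‖q‖ ≤ D * (Icc 1 X).indicator (fun _ => (1 : ℝ)) x → ‖p * q‖ ≤
        H * D * (Icc 1 X).indicator (fun _ => (1 : ℝ)) x * lorentz s ^ 2 := fun p q hp hq => by
    rw [norm_mul]
    calc _ ≤ (H * lorentz s ^ 2) * (D * (Icc 1 X).indicator (fun _ => (1 : ℝ)) x) := by gcongr
      _ = _ := by ring
  have hpos : 0 ≤ H * D * (Icc 1 X).indicator (fun _ => (1 : ℝ)) x * lorentz s ^ 2 := by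
    positivity
  constructor
  · refine (key _ _ (hh.bound s) (hD x s).1).trans ?_
    linarith
  · refine (norm_add_le _ _).trans ((add_le_add (key _ _ (hh.bound' s) (hD x s).1)
      (key _ _ (hh.bound s) (hD x s).2)).trans ?_)
    linarith

theorem aestronglyMeasurable_rowSymbol (hb : IsLocalKernel b M X) (hh : IsDecaying h h' H)
    (x : ℝ) : AEStronglyMeasurable (rowSymbol h b x) volume :=
  ((hb.stronglyMeasurable_rowSymbol hh).comp_measurable
    measurable_prodMk_left).aestronglyMeasurable

theorem integrable_rowSymbol (hb : IsLocalKernel b M X) (hh : IsDecaying h h' H) (x : ℝ) :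
    Integrable (rowSymbol h b x) := by
  obtain ⟨D, hD0, hD⟩ := hb.exists_norm_rowSymbol_le hh
  exact integrable_of_le_lorentz_sq (hb.aestronglyMeasurable_rowSymbol hh x)
    fun s => (hD x s).1

theorem memLp_rowSymbol (hb : IsLocalKernel b M X) (hh : IsDecaying h h' H) (x : ℝ) :
    MemLp (rowSymbol h b x) 2 volume := by
  obtain ⟨D, hD0, hD⟩ := hb.exists_norm_rowSymbol_le hh
  exact memLp_two_of_le_lorentz_sq (hb.aestronglyMeasurable_rowSymbol hh x)
    fun s => (hD x s).1

theorem integrable_rowSymbolDeriv (hb : IsLocalKernel b M X) (hh : IsDecaying h h' H) (x : ℝ) :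
    Integrable (rowSymbolDeriv h h' b x) := by
  obtain ⟨D, hD0, hD⟩ := hb.exists_norm_rowSymbol_le hh
  exact integrable_of_le_lorentz_sq ((hb.stronglyMeasurable_rowSymbolDeriv hh).comp_measurable
    measurable_prodMk_left).aestronglyMeasurable fun s => (hD x s).2

theorem fourier_rowSymbol (hb : IsLocalKernel b M X) (hh : IsDecaying h h' H) (x t : ℝ) :
    𝓕 (rowSymbol h b x) t =
      logWeight t * 𝓕 (fun s => rowSymbol h b x s + rowSymbolDeriv h h' b x s) t := by
  rw [fourier_add_deriv (hb.hasDerivAt_rowSymbol hh x) (hb.integrable_rowSymbol hh x)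
    (hb.integrable_rowSymbolDeriv hh x), logWeight, ← mul_assoc, inv_mul_cancel₀ (logWeight_ne t),
    one_mul]

/-- The left factor of the Hilbert–Schmidt factorisation. -/
def leftKernel (h h' : ℝ → ℂ) (b : ℝ → ℝ → ℂ) (x s : ℝ) : ℂ :=
  (rowSymbol h b x s + rowSymbolDeriv h h' b x s) * ((1 + s ^ 2 : ℝ) : ℂ)

/-- The symbol and its derivative decay like $(1+s^2)^{-2}$; one factor pays for the weight $1+s^2$
moved here from the right kernel, the other remains as a square integrable bound in $s$. -/
theorem exists_isHSKernel_leftKernel (hb : IsLocalKernel b M X) (hh : IsDecaying h h' H) :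
    ∃ D, IsHSKernel (leftKernel h h' b)
      (fun x => D * (Icc 1 X).indicator (fun _ => (1 : ℝ)) x) lorentz := by
  obtain ⟨D, hD0, hD⟩ := hb.exists_norm_rowSymbol_le hh
  refine ⟨2 * D, ?_, memLp_indicator_Icc _ X, memLp_lorentz, fun x s => ?_⟩
  · refine StronglyMeasurable.mul ((hb.stronglyMeasurable_rowSymbol hh).add
      (hb.stronglyMeasurable_rowSymbolDeriv hh)) ?_
    exact (by fun_prop : Continuous fun p : ℝ × ℝ =>
      ((1 + p.2 ^ 2 : ℝ) : ℂ)).stronglyMeasurable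
  · have hpos : 0 < 1 + s ^ 2 := by positivity
    have hl : lorentz s * (1 + s ^ 2) = 1 := inv_mul_cancel₀ hpos.ne'
    rw [leftKernel, norm_mul, Complex.norm_real, Real.norm_of_nonneg hpos.le]
    calc _ ≤ (D * (Icc 1 X).indicator (fun _ => (1 : ℝ)) x * lorentz s ^ 2 +
          D * (Icc 1 X).indicator (fun _ => (1 : ℝ)) x * lorentz s ^ 2) * (1 + s ^ 2) := by
          gcongr
          exact (norm_add_le _ _).trans (add_le_add (hD x s).1 (hD x s).2)
      _ = 2 * D * (Icc 1 X).indicator (fun _ => (1 : ℝ)) x * lorentz s *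
          (lorentz s * (1 + s ^ 2)) := by ring
      _ = _ := by rw [hl, mul_one]

/-- Duality moves the Fourier transform onto the row symbol, the weight $(1+2\pi it)^{-1}$ is split
off there and attached to $Uu$, and duality moves the transform back. Inserting
$(1+s^2)(1+s^2)^{-1}$ separates the two factors. -/
theorem integral_row_mul_mellinMul (hb : IsLocalKernel b M X) (hh : IsDecaying h h' H) (u : L2)
    (x : ℝ) : ∫ y, b x y * mellinMul hh.isBddMeas u y =
      ∫ s, leftKernel h h' b x s * ∫ y, rightKernel s y * u y := by
  have hrow := hb.isHSKernel.memLp_conj_row x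
  have hconj : expPull (fun y => conj (b x y)) = fun t => conj (expPull (b x) t) := by
    ext t
    rw [expPull, expPull, map_mul, Complex.conj_ofReal]
  have hf1 : Integrable fun t => conj (expPull (b x) t) := by
    have := hb.integrable_expPull x
    rw [← memLp_one_iff_integrable] at this ⊢
    exact this.star
  have e1 : ∫ y, b x y * mellinMul hh.isBddMeas u y =
      ∫ s, rowSymbol h b x s * fourierCLM (logMap u) s := by
    rw [hb.isHSKernel.integral_row_mul, inner_mellinMul, logMap_toLp]
    have hmem := memLp_expPull hrow
    refine integral_congr_ae ?_
    have hF : (fourierCLM (hmem.toLp _) : ℝ → ℂ) =ᵐ[volume]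
        𝓕 (expPull fun y => conj (b x y)) := by
      rw [fourierCLM_apply]
      exact coeFn_fourier_toLp (by rw [hconj]; exact hf1) hmem
    filter_upwards [hF] with s hs
    rw [hs, hconj, fourier_conj, Complex.conj_conj, rowSymbol, rowMellin]
    ring
  have hwU : Integrable fun t => logWeight t * expPull u t :=
    memLp_logWeight.integrable_mul (memLp_expPull (Lp.memLp u))
  rw [e1, integral_mul_fourierCLM (hb.integrable_rowSymbol hh x) (hb.memLp_rowSymbol hh x)]
  have e2 : ∫ t, 𝓕 (rowSymbol h b x) t * logMap u t =
      ∫ t, 𝓕 (fun s => rowSymbol h b x s + rowSymbolDeriv h h' b x s) t *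
        (logWeight t * expPull u t) := by
    refine integral_congr_ae ?_
    filter_upwards [coeFn_logMap u] with t ht
    rw [ht, hb.fourier_rowSymbol hh]
    ring
  rw [e2, integral_fourier_mul_eq
    (f := fun s => rowSymbol h b x s + rowSymbolDeriv h h' b x s) ((hb.integrable_rowSymbol hh x).add
    (hb.integrable_rowSymbolDeriv hh x)) hwU]
  congr 1
  ext s
  rw [integral_rightKernel_mul, leftKernel]
  have hl : (((1 + s ^ 2 : ℝ) : ℂ)) * (lorentz s : ℂ) = 1 := by
    rw [← Complex.ofReal_mul, lorentz, mul_inv_cancel₀ (by positivity), Complex.ofReal_one]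
  rw [mul_assoc, ← mul_assoc ((1 + s ^ 2 : ℝ) : ℂ), hl, one_mul]

/-- The kernel of the Mellin multiplier with symbol `h`. -/
def mellinKernel (h : ℝ → ℂ) (y x : ℝ) : ℂ :=
  if 0 < x then Real.exp (-Real.log x / 2) * logPush (fun t => 𝓕⁻ h (t - Real.log x)) y else 0

/-- Undoes the factorisation on the diagonal: the trace integrand at $x$ is again the kernel $b$
composed with the kernel of the Mellin multiplier. For $x\le0$ both sides vanish. -/
theorem integral_rightKernel_mul_leftKernel (hb : IsLocalKernel b M X) (hh : IsDecaying h h' H)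
    (x : ℝ) : ∫ s, rightKernel s x * leftKernel h h' b x s = ∫ y, b x y * mellinKernel h y x := by
  by_cases hx : 0 < x
  · have e1 : ∀ s, rightKernel s x * leftKernel h h' b x s =
        (Real.exp (-Real.log x / 2) * logWeight (Real.log x)) *
          (Complex.exp ((-2 * Real.pi * s * Real.log x : ℝ) * Complex.I) •
            (rowSymbol h b x s + rowSymbolDeriv h h' b x s)) := fun s => by
      have hl : (lorentz s : ℂ) * (((1 + s ^ 2 : ℝ) : ℂ)) = 1 := by
        rw [← Complex.ofReal_mul, lorentz, inv_mul_cancel₀ (by positivity), Complex.ofReal_one]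
      have hexp : ((-2 * Real.pi * Real.log x * s : ℝ) : ℂ) =
        ((-2 * Real.pi * s * Real.log x : ℝ) : ℂ) := by congr 1; ring
      rw [rightKernel, leftKernel, logPush, if_pos hx, smul_eq_mul, hexp]
      linear_combination ((Real.exp (-Real.log x / 2) * logWeight (Real.log x)) *
          (Complex.exp ((-2 * Real.pi * s * Real.log x : ℝ) * Complex.I) *
            (rowSymbol h b x s + rowSymbolDeriv h h' b x s)) : ℂ) * hl
    have e2 : 𝓕 (rowSymbol h b x) (Real.log x) =
        ∫ t, 𝓕⁻ h (t - Real.log x) * expPull (b x) t := by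
      have hmod : Integrable fun s =>
          Complex.exp ((-2 * Real.pi * s * Real.log x : ℝ) * Complex.I) * h s := by
        refine hh.integrable.bdd_mul (c := 1) (by fun_prop : Continuous fun s : ℝ =>
          Complex.exp ((-2 * Real.pi * s * Real.log x : ℝ) * Complex.I)).aestronglyMeasurable ?_
        exact Filter.Eventually.of_forall fun s => (Complex.norm_exp_ofReal_mul_I _).le
      have hdual := integral_fourierInv_mul_eq (hb.integrable_expPull x) hmod
      have hs : ∀ t, 𝓕⁻ (fun s =>
          Complex.exp ((-2 * Real.pi * s * Real.log x : ℝ) * Complex.I) * h s) t =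
          𝓕⁻ h (t - Real.log x) := fun t => by
        rw [Real.fourierInv_eq', Real.fourierInv_eq']
        congr 1
        ext s
        rw [smul_eq_mul, smul_eq_mul, ← mul_assoc, ← Complex.exp_add]
        congr 2
        simp
        ring
      rw [Real.fourier_real_eq_integral_exp_smul]
      simp_rw [hs] at hdual
      calc _ = ∫ s, 𝓕⁻ (expPull (b x)) s *
            (Complex.exp ((-2 * Real.pi * s * Real.log x : ℝ) * Complex.I) * h s) := by
            congr 1
            ext s
            rw [smul_eq_mul, rowSymbol, rowMellin]
            ring
        _ = _ := by
            rw [hdual]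
            congr 1
            ext t
            ring
    simp_rw [e1]
    rw [integral_const_mul, ← Real.fourier_real_eq_integral_exp_smul, mul_assoc,
      ← hb.fourier_rowSymbol hh, e2, ← integral_logPush_mul, ← integral_const_mul]
    congr 1
    ext y
    rw [mellinKernel, if_pos hx]
    ring
  · have e1 : ∀ s, rightKernel s x = 0 := fun s => by
      rw [rightKernel, logPush_of_notMem _ hx, mul_zero]
    have e2 : ∀ y, mellinKernel h y x = 0 := fun y => if_neg hx
    simp [e1, e2]

/-- Trace class property and trace of the product of a localised integral operator and a Mellin
multiplier. -/
theorem isTraceClass_hasTrace (hb : IsLocalKernel b M X) (hh : IsDecaying h h' H) :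
    IsTraceClass (hb.isHSKernel.op ∘L mellinMul hh.isBddMeas) ∧
    HasTrace (hb.isHSKernel.op ∘L mellinMul hh.isBddMeas)
      (∫ x, ∫ y, b x y * mellinKernel h y x) := by
  obtain ⟨D, hL⟩ := hb.exists_isHSKernel_leftKernel hh
  have hcomp : hb.isHSKernel.op ∘L mellinMul hh.isBddMeas =
      hL.op ∘L isHSKernel_rightKernel.op := by
    ext1 u
    apply Lp.ext
    rw [ContinuousLinearMap.comp_apply, ContinuousLinearMap.comp_apply]
    filter_upwards [hb.isHSKernel.coeFn_op (mellinMul hh.isBddMeas u),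
      hL.coeFn_op (isHSKernel_rightKernel.op u)] with x h1 h2
    rw [h1, h2, hb.integral_row_mul_mellinMul hh]
    refine integral_congr_ae ?_
    filter_upwards [isHSKernel_rightKernel.coeFn_op u] with s hs
    rw [hs]
  rw [hcomp]
  refine ⟨isTraceClass_op_comp_op hL isHSKernel_rightKernel, ?_⟩
  have htr := hasTrace_op_comp_op hL isHSKernel_rightKernel
  -- The trace formula integrates over the intermediate variable $s$ last; the order is exchanged so
  -- that the $s$-integral can be evaluated for each fixed $x$.
  rw [integral_integral_swap] at htr
  · simpa only [hb.integral_rightKernel_mul_leftKernel hh] using htr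
  · refine Integrable.mono' (g := fun z : ℝ × ℝ => (lorentz z.1 * lorentz z.1) *
      (‖logPush logWeight z.2‖ * (D * (Icc 1 X).indicator (fun _ => (1 : ℝ)) z.2))) ?_ ?_ ?_
    · exact (memLp_lorentz.integrable_mul memLp_lorentz).mul_prod
        (isHSKernel_rightKernel.right.integrable_mul (memLp_indicator_Icc D X))
    · exact (isHSKernel_rightKernel.meas.mul
        (hL.meas.comp_measurable measurable_swap)).aestronglyMeasurable
    · refine Filter.Eventually.of_forall fun z => ?_
      rw [Function.uncurry, norm_mul]
      have hl := lorentz_pos z.1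
      calc _ ≤ (lorentz z.1 * ‖logPush logWeight z.2‖) *
            (D * (Icc 1 X).indicator (fun _ => (1 : ℝ)) z.2 * lorentz z.1) := by
            gcongr
            · exact isHSKernel_rightKernel.bound z.1 z.2
            · exact hL.bound z.2 z.1
        _ = _ := by ring

end IsLocalKernel

/-! ### The composed symbol: decay and total integral. -/

theorem hasDerivAt_mellinSymbol (ε s : ℝ) :
    HasDerivAt (mellinSymbol ε)
      (4 * Real.pi ^ 2 * ε * (mellinSymbol ε s * (1 - mellinSymbol ε s))) s := by
  have h1 : HasDerivAt (fun s => 1 + Real.exp (-(4 * Real.pi ^ 2 * (ε * s))))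
      (Real.exp (-(4 * Real.pi ^ 2 * (ε * s))) * (-(4 * Real.pi ^ 2 * ε))) s := by
    have := (((hasDerivAt_id s).const_mul ε).const_mul (4 * Real.pi ^ 2)).neg.exp.const_add 1
    simpa [mul_assoc] using this
  have hpos : 0 < 1 + Real.exp (-(4 * Real.pi ^ 2 * (ε * s))) := by positivity
  refine (h1.fun_inv hpos.ne').congr_deriv ?_
  simp only [mellinSymbol]
  field_simp
  ring

/-- The product is $(2+e^x+e^{-x})^{-1}$ with $|x|=4\pi^2|s|\ge36|s|$, so the quartic term of the
exponential dominates $(1+s^2)^2$. -/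
theorem mellinSymbol_mul_one_sub_le {ε : ℝ} (hε : ε = 1 ∨ ε = -1) (s : ℝ) :
    mellinSymbol ε s * (1 - mellinSymbol ε s) ≤ lorentz s ^ 2 := by
  set x := 4 * Real.pi ^ 2 * (ε * s) with hx
  have hE := Real.exp_pos x
  have h1 : mellinSymbol ε s * (1 - mellinSymbol ε s) = (2 + Real.exp x + Real.exp (-x))⁻¹ := by
    rw [mellinSymbol, ← hx, Real.exp_neg]
    field_simp
    ring
  have hxa : |x| = 4 * Real.pi ^ 2 * |s| := by
    rw [hx, abs_mul (4 * Real.pi ^ 2), abs_of_pos (by positivity : 0 < 4 * Real.pi ^ 2)]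
    rcases hε with rfl | rfl <;> simp
  have h2 : |s| ≤ |x| / 36 := by
    have := Real.pi_gt_three
    have h9 : 9 ≤ Real.pi ^ 2 := by nlinarith
    rw [hxa]
    nlinarith [abs_nonneg s]
  have h4 : |x| ^ 4 / 24 ≤ Real.exp |x| := by
    have := Real.pow_div_factorial_le_exp |x| (abs_nonneg x) 4
    norm_num [Nat.factorial] at this
    linarith
  have h5 : Real.exp |x| ≤ Real.exp x + Real.exp (-x) := by
    rcases abs_cases x with ⟨h, -⟩ | ⟨h, -⟩ <;> rw [h]
    · linarith [Real.exp_pos (-x)]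
    · linarith [Real.exp_pos x]
  have h6 : s ^ 4 ≤ (|x| / 36) ^ 4 := by
    rw [← Even.pow_abs (by decide : Even 4) s]
    gcongr
  rw [h1, lorentz, inv_pow]
  refine inv_anti₀ (by positivity) ?_
  have h7 : 0 ≤ |x| ^ 4 := by positivity
  have h8 : (|x| / 36) ^ 4 = |x| ^ 4 / 1679616 := by ring
  nlinarith [sq_nonneg (1 - s ^ 2)]

theorem mellinSymbol_lt_one (ε s : ℝ) : mellinSymbol ε s < 1 :=
  inv_lt_one_of_one_lt₀ (by linarith [Real.exp_pos (-(4 * Real.pi ^ 2 * (ε * s)))])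

/-- The mean value inequality from the nearer endpoint, where $g$ vanishes; the distance to the
farther one is at least $1/2$, hence the factor $2$. -/
theorem exists_norm_le_mul_one_sub {g : ℝ → ℂ} (hg : ContDiff ℝ 1 g) (hg0 : g 0 = 0)
    (hg1 : g 1 = 0) : ∃ K, 0 ≤ K ∧ ∀ t ∈ Icc (0 : ℝ) 1,
      ‖g t‖ ≤ 2 * K * (t * (1 - t)) ∧ ‖deriv g t‖ ≤ K := by
  obtain ⟨K, hK⟩ := isCompact_Icc.exists_bound_of_continuousOn (s := Icc (0 : ℝ) 1)
    (hg.continuous_deriv le_rfl).continuousOn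
  have hK0 : 0 ≤ K := (norm_nonneg _).trans (hK 0 (by simp))
  have hlip : ∀ s ∈ Icc (0 : ℝ) 1, ∀ t ∈ Icc (0 : ℝ) 1, ‖g t - g s‖ ≤ K * ‖t - s‖ :=
    fun s hs t ht => (convex_Icc (0 : ℝ) 1).norm_image_sub_le_of_norm_deriv_le
      (fun x _ => (hg.differentiable (by simp)) x) hK hs ht
  refine ⟨K, hK0, fun t ht => ⟨?_, hK t ht⟩⟩
  obtain ⟨h0, h1⟩ := ht
  have e0 := hlip 0 (by simp) t ⟨h0, h1⟩
  have e1 := hlip 1 (by simp) t ⟨h0, h1⟩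
  rw [hg0, sub_zero, sub_zero, Real.norm_of_nonneg h0] at e0
  rw [hg1, sub_zero, Real.norm_of_nonpos (by linarith)] at e1
  rcases le_total t (1 / 2) with h | h
  · nlinarith [mul_nonneg hK0 h0]
  · nlinarith [mul_nonneg hK0 (sub_nonneg.2 h1)]

/-- The derivative of `s ↦ g (mellinSymbol ε s)`. -/
def mellinCompDeriv (g : ℝ → ℂ) (ε s : ℝ) : ℂ :=
  (4 * Real.pi ^ 2 * ε * (mellinSymbol ε s * (1 - mellinSymbol ε s))) • deriv g (mellinSymbol ε s)

/-- Both $g\circ m_\varepsilon$ and its derivative carry a factor $m_\varepsilon(1-m_\varepsilon)$,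
from the zeros of $g$ and from $m_\varepsilon'$ respectively. One $H$ serves both signs, so the
final constant does too. -/
theorem exists_isDecaying {g : ℝ → ℂ} (hg : ContDiff ℝ 1 g) (hg0 : g 0 = 0) (hg1 : g 1 = 0) :
    ∃ H, ∀ ε : ℝ, (ε = 1 ∨ ε = -1) →
      IsDecaying (fun s => g (mellinSymbol ε s)) (mellinCompDeriv g ε) H := by
  obtain ⟨K, hK0, hK⟩ := exists_norm_le_mul_one_sub hg hg0 hg1
  refine ⟨(2 + 4 * Real.pi ^ 2) * K, fun ε hε => ⟨fun s => ?_, ?_, fun s => ?_, fun s => ?_⟩⟩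
  · exact HasDerivAt.scomp s ((hg.differentiable (by simp)) _).hasDerivAt
      (hasDerivAt_mellinSymbol ε s)
  · have h1 := continuous_mellinSymbol ε
    have h2 := hg.continuous_deriv le_rfl
    unfold mellinCompDeriv
    fun_prop
  · have hm : mellinSymbol ε s ∈ Icc (0 : ℝ) 1 :=
      ⟨(mellinSymbol_pos ε s).le, mellinSymbol_le_one ε s⟩
    have h1 := (hK _ hm).1
    have h2 := mellinSymbol_mul_one_sub_le hε s
    have h3 : 0 ≤ lorentz s ^ 2 := sq_nonneg _
    calc _ ≤ _ := h1
      _ ≤ 2 * K * lorentz s ^ 2 := by gcongr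
      _ ≤ _ := by
        have : 0 ≤ 4 * Real.pi ^ 2 * K * lorentz s ^ 2 := by positivity
        linarith
  · have hm : mellinSymbol ε s ∈ Icc (0 : ℝ) 1 :=
      ⟨(mellinSymbol_pos ε s).le, mellinSymbol_le_one ε s⟩
    have h1 := (hK _ hm).2
    have h2 := mellinSymbol_mul_one_sub_le hε s
    have h3 : 0 ≤ lorentz s ^ 2 := sq_nonneg _
    have h4 : 0 ≤ mellinSymbol ε s * (1 - mellinSymbol ε s) :=
      mul_nonneg hm.1 (sub_nonneg.2 hm.2)
    have h5 : ‖4 * Real.pi ^ 2 * ε * (mellinSymbol ε s * (1 - mellinSymbol ε s))‖ =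
        4 * Real.pi ^ 2 * (mellinSymbol ε s * (1 - mellinSymbol ε s)) := by
      rw [norm_mul, Real.norm_of_nonneg h4, norm_mul, Real.norm_of_nonneg (by positivity)]
      rcases hε with rfl | rfl <;> simp
    rw [mellinCompDeriv, norm_smul, h5]
    calc _ ≤ 4 * Real.pi ^ 2 * lorentz s ^ 2 * K := by gcongr
      _ ≤ _ := by
        have : 0 ≤ 2 * K * lorentz s ^ 2 := by positivity
        linarith

theorem image_mellinSymbol {ε : ℝ} (hε : ε = 1 ∨ ε = -1) :
    mellinSymbol ε '' univ = Ioo 0 1 := by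
  have hπ : 4 * Real.pi ^ 2 ≠ 0 := by positivity
  have hεε : ε * ε = 1 := by rcases hε with rfl | rfl <;> norm_num
  ext t
  constructor
  · rintro ⟨s, -, rfl⟩
    exact ⟨mellinSymbol_pos ε s, mellinSymbol_lt_one ε s⟩
  · rintro ⟨h0, h1⟩
    have h1' : 0 < 1 - t := by linarith
    refine ⟨-(ε * Real.log ((1 - t) / t)) / (4 * Real.pi ^ 2), mem_univ _, ?_⟩
    have : -(4 * Real.pi ^ 2 * (ε * (-(ε * Real.log ((1 - t) / t)) / (4 * Real.pi ^ 2)))) =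
        Real.log ((1 - t) / t) := by
      field_simp
      linear_combination Real.log ((1 - t) / t) * hεε
    rw [mellinSymbol, this, Real.exp_log (by positivity)]
    field_simp
    ring

theorem injective_mellinSymbol {ε : ℝ} (hε : ε = 1 ∨ ε = -1) :
    Function.Injective (mellinSymbol ε) := by
  intro s t h
  have h1 := inv_injective h
  have h2 := Real.exp_injective (add_left_cancel h1)
  have hπ : 0 < Real.pi ^ 2 := by positivity
  have h3 : ε * s = ε * t := by
    have : 4 * Real.pi ^ 2 * (ε * s) = 4 * Real.pi ^ 2 * (ε * t) := neg_injective h2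
    exact mul_left_cancel₀ (by positivity) this
  rcases hε with rfl | rfl
  · simpa using h3
  · simpa using h3

/-- Substitute $t=m_\varepsilon(s)$, a bijection onto $(0,1)$ with $|dt|=4\pi^2t(1-t)\,ds$; the
factor $4\pi^2$ is the normalisation of the coefficient. -/
theorem integral_comp_mellinSymbol {g : ℝ → ℂ} (hg1 : g 1 = 0) {ε : ℝ} (hε : ε = 1 ∨ ε = -1) :
    ∫ s, g (mellinSymbol ε s) = coeffA g 1 := by
  have h := integral_image_eq_integral_abs_deriv_smul (f := mellinSymbol ε) MeasurableSet.univ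
    (fun s _ => (hasDerivAt_mellinSymbol ε s).hasDerivWithinAt)
    (injective_mellinSymbol hε).injOn (fun t => g t / ((t : ℂ) * (1 - (t : ℂ))))
  rw [image_mellinSymbol hε, setIntegral_univ] at h
  have hpt : ∀ s, |4 * Real.pi ^ 2 * ε * (mellinSymbol ε s * (1 - mellinSymbol ε s))| •
      (g (mellinSymbol ε s) / ((mellinSymbol ε s : ℂ) * (1 - (mellinSymbol ε s : ℂ)))) =
      ((4 * Real.pi ^ 2 : ℝ) : ℂ) * g (mellinSymbol ε s) := fun s => by
    have hm0 := mellinSymbol_pos ε s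
    have hm1 : 0 < 1 - mellinSymbol ε s := sub_pos.2 (mellinSymbol_lt_one ε s)
    have habs : |4 * Real.pi ^ 2 * ε * (mellinSymbol ε s * (1 - mellinSymbol ε s))| =
        4 * Real.pi ^ 2 * (mellinSymbol ε s * (1 - mellinSymbol ε s)) := by
      rw [abs_mul, abs_of_pos (mul_pos hm0 hm1), abs_mul, abs_of_pos (by positivity)]
      rcases hε with rfl | rfl <;> simp
    have c0 : (mellinSymbol ε s : ℂ) ≠ 0 := by exact_mod_cast hm0.ne'
    have c1 : (1 - mellinSymbol ε s : ℂ) ≠ 0 := by exact_mod_cast hm1.ne'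
    rw [habs, Complex.real_smul]
    push_cast
    field_simp
  simp_rw [hpt] at h
  rw [integral_const_mul] at h
  rw [coeffA, intervalIntegral.integral_of_le zero_le_one, integral_Ioc_eq_integral_Ioo]
  simp only [one_mul, hg1, mul_zero, sub_zero]
  rw [h, ← mul_assoc]
  have hπ : (Real.pi : ℂ) ≠ 0 := by exact_mod_cast Real.pi_ne_zero
  have : (1 / (2 * Real.pi) ^ 2 : ℂ) * ((4 * Real.pi ^ 2 : ℝ) : ℂ) = 1 := by
    push_cast
    field_simp
    norm_num
  rw [this, one_mul]

/-! ### The Mellin kernel near the diagonal. -/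

namespace IsDecaying

variable {h h' : ℝ → ℂ} {H : ℝ}

theorem norm_fourierInv_le (hh : IsDecaying h h' H) (τ : ℝ) :
    ‖𝓕⁻ h τ‖ ≤ H * ∫ s, lorentz s := by
  rw [← integral_const_mul]
  refine IsLocalKernel.norm_fourierInv_le (integrable_inv_one_add_sq.const_mul H) (fun s => ?_) τ
  refine (hh.bound s).trans ?_
  have := hh.nonneg
  have h1 := lorentz_pos s
  have h2 := lorentz_le_one s
  gcongr
  nlinarith

/-- From $|e^{i\theta}-1|\le|\theta|$; the extra factor $|s|$ is absorbed by one of the two weights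
bounding $h$. -/
theorem norm_fourierInv_sub_le (hh : IsDecaying h h' H) (τ : ℝ) :
    ‖𝓕⁻ h τ - ∫ s, h s‖ ≤ 2 * Real.pi * (H * ∫ s, lorentz s) * |τ| := by
  have hint : Integrable fun s : ℝ =>
      Complex.exp ((2 * Real.pi * inner ℝ s τ : ℝ) * Complex.I) • h s := by
    refine hh.integrable.bdd_mul (c := 1) (by fun_prop : Continuous fun s : ℝ =>
      Complex.exp ((2 * Real.pi * inner ℝ s τ : ℝ) * Complex.I)).aestronglyMeasurable ?_
    exact Filter.Eventually.of_forall fun s => (Complex.norm_exp_ofReal_mul_I _).le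
  rw [Real.fourierInv_eq', ← integral_sub hint hh.integrable]
  have hrhs : 2 * Real.pi * (H * ∫ s, lorentz s) * |τ| =
      ∫ s, 2 * Real.pi * |τ| * H * lorentz s := by
    rw [integral_const_mul]; ring
  rw [hrhs]
  refine norm_integral_le_of_norm_le (integrable_inv_one_add_sq.const_mul _)
    (Filter.Eventually.of_forall fun s => ?_)
  have e1 : Complex.exp ((2 * Real.pi * inner ℝ s τ : ℝ) * Complex.I) • h s - h s =
      (Complex.exp (Complex.I * ((2 * Real.pi * inner ℝ s τ : ℝ) : ℂ)) - 1) * h s := by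
    rw [smul_eq_mul, mul_comm Complex.I]; ring
  rw [e1, norm_mul]
  have e2 : ‖Complex.exp (Complex.I * ((2 * Real.pi * inner ℝ s τ : ℝ) : ℂ)) - 1‖ ≤
      2 * Real.pi * (|τ| * |s|) := by
    refine (Real.norm_exp_I_mul_ofReal_sub_one_le).trans ?_
    rw [Real.norm_eq_abs, abs_mul, abs_of_pos (by positivity : 0 < 2 * Real.pi)]
    simp [abs_mul]
  have hsl : |s| * lorentz s ≤ 1 := by
    rw [lorentz, ← div_eq_mul_inv, div_le_one (by positivity)]
    nlinarith [sq_abs s, sq_nonneg (|s| - 1)]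
  have hH := hh.nonneg
  have h1 := lorentz_pos s
  calc _ ≤ 2 * Real.pi * (|τ| * |s|) * (H * lorentz s ^ 2) := by
        gcongr
        exact hh.bound s
    _ = 2 * Real.pi * |τ| * H * lorentz s * (|s| * lorentz s) := by ring
    _ ≤ 2 * Real.pi * |τ| * H * lorentz s * 1 := by gcongr
    _ = _ := mul_one _

end IsDecaying

theorem abs_log_le_two_mul {η : ℝ} (h : 1 / 2 ≤ η) : |Real.log η| ≤ 2 * |η - 1| := by
  have hη : 0 < η := by linarith
  have h1 := Real.log_le_sub_one_of_pos hη
  have h2 := Real.one_sub_inv_le_log_of_pos hη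
  have h3 : 1 - η⁻¹ = (η - 1) * η⁻¹ := by field_simp
  have h4 : η⁻¹ ≤ 2 := by rw [inv_le_comm₀ hη (by norm_num)]; linarith
  have h5 : 0 < η⁻¹ := inv_pos.2 hη
  rcases abs_cases (η - 1) with ⟨e, h0⟩ | ⟨e, h0⟩ <;> rw [e, abs_le] <;> constructor <;> nlinarith

theorem abs_one_sub_sqrt_le {η : ℝ} (h : 0 ≤ η) : |1 - √η| ≤ |η - 1| := by
  have h1 : η - 1 = -(1 - √η) * (1 + √η) := by
    have := Real.mul_self_sqrt h
    ring_nf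
    nlinarith
  rw [h1, abs_mul, abs_neg]
  refine le_mul_of_one_le_right (abs_nonneg _) ?_
  rw [abs_of_nonneg (by positivity)]
  linarith [Real.sqrt_nonneg η]

namespace IsDecaying

variable {h h' : ℝ → ℂ} {H : ℝ}

/-- The constant controlling the inverse Fourier transform of a decaying function. -/
def fourierConst (H : ℝ) : ℝ := 2 * Real.pi * (H * ∫ s, lorentz s)

theorem integral_lorentz_nonneg : 0 ≤ ∫ s, lorentz s :=
  integral_nonneg fun s => (lorentz_pos s).le

theorem fourierConst_nonneg (hh : IsDecaying h h' H) : 0 ≤ fourierConst H := by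
  have := hh.nonneg
  have := integral_lorentz_nonneg
  have := Real.pi_pos
  unfold fourierConst
  positivity

theorem norm_fourierInv_le_const (hh : IsDecaying h h' H) (τ : ℝ) :
    ‖𝓕⁻ h τ‖ ≤ fourierConst H := by
  refine (hh.norm_fourierInv_le τ).trans ?_
  unfold fourierConst
  refine le_mul_of_one_le_left (mul_nonneg hh.nonneg integral_lorentz_nonneg) ?_
  linarith [Real.pi_gt_three]

theorem norm_integral_le_const (hh : IsDecaying h h' H) : ‖∫ s, h s‖ ≤ fourierConst H := by
  have h1 := hh.norm_fourierInv_sub_le 0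
  rw [abs_zero, mul_zero] at h1
  have h2 : 𝓕⁻ h 0 = ∫ s, h s := sub_eq_zero.1 (norm_eq_zero.1 (le_antisymm h1 (norm_nonneg _)))
  rw [← h2]
  exact hh.norm_fourierInv_le_const 0

/-- The kernel is homogeneous of degree $-1$: after multiplication by $x$ it depends only on $y/x$.
-/
theorem mul_mellinKernel (h : ℝ → ℂ) {x y : ℝ} (hx : 0 < x) (hy : 0 < y) :
    x * IsLocalKernel.mellinKernel h y x = ((√(y / x))⁻¹ : ℝ) * 𝓕⁻ h (Real.log (y / x)) := by
  have hexp : ∀ z : ℝ, 0 < z → Real.exp (-Real.log z / 2) = (√z)⁻¹ := fun z hz => by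
    rw [neg_div, Real.exp_neg, ← Real.log_sqrt hz.le, Real.exp_log (Real.sqrt_pos.2 hz)]
  rw [IsLocalKernel.mellinKernel, if_pos hx, logPush, if_pos hy, hexp x hx, hexp y hy,
    Real.log_div hy.ne' hx.ne', ← mul_assoc, ← mul_assoc]
  congr 1
  rw [← Complex.ofReal_mul, ← Complex.ofReal_mul, Real.sqrt_div' _ hx.le, inv_div]
  congr 1
  have h1 : 0 < √x := Real.sqrt_pos.2 hx
  have h2 : 0 < √y := Real.sqrt_pos.2 hy
  have h3 := Real.mul_self_sqrt hx.le
  field_simp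
  nlinarith

theorem mellinKernel_of_nonpos (h : ℝ → ℂ) {x y : ℝ} (hy : y ≤ 0) :
    IsLocalKernel.mellinKernel h y x = 0 := by
  rw [IsLocalKernel.mellinKernel, logPush_of_notMem _ (notMem_Ioi.2 hy), mul_zero, ite_self]

/-- Near $y=x$ the error is linear in $y/x-1$, and far away boundedness suffices. Only the weaker
power $1/2$ is kept: against decay of order $|z|^{-2}$ a linear factor would leave a logarithmically
divergent integral. For $y\le0$ the kernel is zero and the conventions $\sqrt{y/x}=0$, $0^{-1}=0$
keep the right side meaningful. -/
theorem norm_mul_mellinKernel_sub_le (hh : IsDecaying h h' H) {x : ℝ} (hx : 0 < x) (y : ℝ) :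
    ‖x * IsLocalKernel.mellinKernel h y x - ∫ s, h s‖ ≤
      3 * fourierConst H * (√|y / x - 1| * (1 + (√(y / x))⁻¹)) := by
  have hK := hh.fourierConst_nonneg
  have hk0 := hh.norm_integral_le_const
  set K := fourierConst H
  set k := ∫ s, h s
  have hfar : 1 / 2 ≤ |y / x - 1| → 1 ≤ 3 * √|y / x - 1| := fun h1 => by
    have : (1 / 3 : ℝ) ≤ √|y / x - 1| := Real.le_sqrt_of_sq_le (by linarith)
    linarith
  rcases le_or_gt y 0 with hy | hy
  · rw [mellinKernel_of_nonpos h hy, mul_zero, zero_sub, norm_neg]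
    have hη : y / x ≤ 0 := div_nonpos_of_nonpos_of_nonneg hy hx.le
    have h1 : 1 / 2 ≤ |y / x - 1| := by rw [abs_of_neg (by linarith)]; linarith
    rw [Real.sqrt_eq_zero_of_nonpos hη, inv_zero, add_zero, mul_one]
    nlinarith [hfar h1]
  have hη : 0 < y / x := div_pos hy hx
  rw [mul_mellinKernel h hx hy]
  set η := y / x
  have hs : 0 < (√η)⁻¹ := inv_pos.2 (Real.sqrt_pos.2 hη)
  have hF := hh.norm_fourierInv_le_const (Real.log η)
  rcases le_or_gt (1 / 2) |η - 1| with h1 | h1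
  · calc _ ≤ (√η)⁻¹ * K + K := by
          refine (norm_sub_le _ _).trans (add_le_add ?_ hk0)
          rw [norm_mul, Complex.norm_real, Real.norm_of_nonneg hs.le]
          gcongr
      _ = 1 * (K * (1 + (√η)⁻¹)) := by ring
      _ ≤ (3 * √|η - 1|) * (K * (1 + (√η)⁻¹)) := by
          gcongr
          exact hfar h1
      _ = _ := by ring
  · have h2 : 1 / 2 ≤ η := by have := (abs_lt.1 h1).1; linarith
    have hsq : |η - 1| ≤ √|η - 1| := by
      refine Real.le_sqrt_of_sq_le ?_
      nlinarith [abs_nonneg (η - 1)]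
    have hss : ((√η)⁻¹ : ℝ) * (√η : ℝ) = 1 := inv_mul_cancel₀ (Real.sqrt_pos.2 hη).ne'
    have e1 : ((√η)⁻¹ : ℝ) * 𝓕⁻ h (Real.log η) - k =
        ((√η)⁻¹ : ℝ) * ((𝓕⁻ h (Real.log η) - k) + k * ((1 - √η : ℝ) : ℂ)) := by
      have : (((√η)⁻¹ : ℝ) : ℂ) * ((√η : ℝ) : ℂ) = 1 := by
        rw [← Complex.ofReal_mul, hss, Complex.ofReal_one]
      push_cast at this ⊢
      linear_combination k * this
    rw [e1, norm_mul, Complex.norm_real, Real.norm_of_nonneg hs.le]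
    calc _ ≤ (√η)⁻¹ * (K * (2 * |η - 1|) + K * |η - 1|) := by
          gcongr
          refine (norm_add_le _ _).trans (add_le_add ?_ ?_)
          · refine (hh.norm_fourierInv_sub_le _).trans ?_
            exact mul_le_mul_of_nonneg_left (abs_log_le_two_mul h2) hK
          · rw [norm_mul, Complex.norm_real, Real.norm_eq_abs]
            exact mul_le_mul hk0 (abs_one_sub_sqrt_le hη.le) (abs_nonneg _) hK
      _ = 3 * K * (|η - 1| * (√η)⁻¹) := by ring
      _ ≤ _ := by
          gcongr
          linarith

theorem stronglyMeasurable_mellinKernel (hh : IsDecaying h h' H) :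
    StronglyMeasurable fun p : ℝ × ℝ => IsLocalKernel.mellinKernel h p.2 p.1 := by
  refine StronglyMeasurable.ite (measurableSet_lt measurable_const measurable_fst) ?_
    stronglyMeasurable_const
  refine Measurable.stronglyMeasurable ?_
  have hF := (continuous_fourierInv hh.integrable).measurable
  refine Measurable.mul (by fun_prop) ?_
  refine Measurable.ite (measurableSet_lt measurable_const measurable_snd) ?_ measurable_const
  fun_prop

end IsDecaying

/-! ### An integrable majorant for the error of freezing the Mellin kernel. -/

/-- The profile `√u (1 + u)⁻²`. -/
def profile (u : ℝ) : ℝ := √u / (1 + u) ^ 2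

theorem profile_nonneg (u : ℝ) : 0 ≤ profile u := by unfold profile; positivity

theorem mul_profile_le_one {u : ℝ} (hu : 0 ≤ u) : u * profile u ≤ 1 := by
  rw [profile, ← mul_div_assoc, div_le_one (by positivity)]
  have : √u ≤ 1 + u := Real.sqrt_le_iff.2 ⟨by positivity, by nlinarith⟩
  nlinarith

theorem measurable_profile : Measurable profile := by unfold profile; fun_prop

theorem integrable_profile_abs : Integrable fun w : ℝ => profile |w| := by
  have h := integrable_one_add_norm (E := ℝ) (μ := volume) (r := 3 / 2) (by norm_num)
  refine h.mono' (measurable_profile.comp measurable_norm).aestronglyMeasurable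
    (Filter.Eventually.of_forall fun w => ?_)
  rw [Real.norm_of_nonneg (profile_nonneg _), profile, Real.norm_eq_abs, div_le_iff₀ (by positivity)]
  have h0 : 0 < 1 + |w| := by positivity
  rw [← Real.rpow_natCast (1 + |w|) 2, ← Real.rpow_add h0, Real.sqrt_eq_rpow]
  norm_num
  gcongr
  linarith

theorem profile_integral_nonneg : 0 ≤ ∫ w : ℝ, profile |w| :=
  integral_nonneg fun _ => profile_nonneg _

/-- The integrable majorant, in `y`, of the error kernel. -/
def majorant (σ x y : ℝ) : ℝ :=
  3 * (x * √x)⁻¹ * √σ * profile |σ * (x - y)| +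
    2 * (x ^ 2)⁻¹ * (√σ)⁻¹ * (Ioc 0 (x / 2)).indicator (fun y => (√y)⁻¹) y

/-- Rescaling by $\sigma$ produces the profile. Off $(0,x/2]$ one has $(y/x)^{-1/2}\le2$, so
$1+2=3$. On $(0,x/2]$ the point is far from the diagonal, where $u\cdot\mathtt{profile}(u)\le1$ with
$u\ge\sigma x/2$ leaves the integrable singularity $y^{-1/2}$. -/
theorem le_majorant {σ x : ℝ} (hσ : 0 < σ) (hx : 0 < x) (y : ℝ) :
    σ / (1 + σ * |x - y|) ^ 2 * (x⁻¹ * (√|y / x - 1| * (1 + (√(y / x))⁻¹))) ≤ majorant σ x y := by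
  have hsx : 0 < √x := Real.sqrt_pos.2 hx
  have hsσ : 0 < √σ := Real.sqrt_pos.2 hσ
  have hσσ := Real.mul_self_sqrt hσ.le
  have hxx := Real.mul_self_sqrt hx.le
  have hu : |σ * (x - y)| = σ * |x - y| := by rw [abs_mul, abs_of_pos hσ]
  have e1 : σ / (1 + σ * |x - y|) ^ 2 * (x⁻¹ * (√|y / x - 1| * (1 + (√(y / x))⁻¹))) =
      (x * √x)⁻¹ * √σ * profile |σ * (x - y)| * (1 + (√(y / x))⁻¹) := by
    have : |y / x - 1| = |x - y| / x := by
      rw [div_sub_one hx.ne', abs_div, abs_of_pos hx, abs_sub_comm]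
    rw [this, profile, hu, Real.sqrt_mul hσ.le, Real.sqrt_div' _ hx.le]
    have h0 : 0 < 1 + σ * |x - y| := by positivity
    nth_rewrite 1 [← hσσ]
    field_simp
  rw [e1, majorant]
  have hp := profile_nonneg |σ * (x - y)|
  have hc : 0 ≤ (x * √x)⁻¹ * √σ * profile |σ * (x - y)| := by positivity
  by_cases hy : y ∈ Ioc 0 (x / 2)
  · rw [indicator_of_mem hy]
    have hsy : 0 < √y := Real.sqrt_pos.2 hy.1
    have h1 : σ * (x / 2) ≤ |σ * (x - y)| := by
      rw [abs_of_nonneg (mul_nonneg hσ.le (by linarith [hy.2]))]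
      gcongr
      linarith [hy.2]
    have h2 : σ * (x / 2) * profile |σ * (x - y)| ≤ 1 :=
      (mul_le_mul_of_nonneg_right h1 hp).trans (mul_profile_le_one (abs_nonneg _))
    have h3 : (x * √x)⁻¹ * √σ * profile |σ * (x - y)| * (√(y / x))⁻¹ ≤
        2 * (x ^ 2)⁻¹ * (√σ)⁻¹ * (√y)⁻¹ := by
      rw [Real.sqrt_div' _ hx.le, inv_div]
      have : (x * √x)⁻¹ * √σ * profile |σ * (x - y)| * (√x / √y) =
          (2 * (x ^ 2)⁻¹ * (√σ)⁻¹ * (√y)⁻¹) * ((√σ * √σ) * (x / 2) * profile |σ * (x - y)|) := by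
        field_simp
      rw [this, hσσ]
      exact mul_le_of_le_one_right (by positivity) h2
    nlinarith
  · rw [indicator_of_notMem hy, mul_zero, add_zero]
    have h1 : (√(y / x))⁻¹ ≤ 2 := by
      rcases le_or_gt y 0 with h0 | h0
      · rw [Real.sqrt_eq_zero_of_nonpos (div_nonpos_of_nonpos_of_nonneg h0 hx.le), inv_zero]
        norm_num
      · have h2 : x / 2 < y := lt_of_not_ge fun h => hy ⟨h0, h⟩
        rw [inv_le_comm₀ (Real.sqrt_pos.2 (div_pos h0 hx)) (by norm_num)]
        refine Real.le_sqrt_of_sq_le ?_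
        rw [le_div_iff₀ hx]
        linarith
    nlinarith

theorem integrableOn_inv_sqrt (R : ℝ) :
    IntegrableOn (fun y : ℝ => (√y)⁻¹) (Ioc 0 R) ∧
      (0 ≤ R → ∫ y in Ioc 0 R, (√y)⁻¹ = 2 * √R) := by
  have e : ∀ y ∈ Ioc 0 R, y ^ (-(1 / 2) : ℝ) = (√y)⁻¹ := fun y hy => by
    rw [Real.rpow_neg hy.1.le, Real.sqrt_eq_rpow]
  constructor
  · rcases le_total 0 R with hR | hR
    · have h := intervalIntegral.intervalIntegrable_rpow' (a := 0) (b := R)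
        (r := -(1 / 2)) (by norm_num)
      rw [intervalIntegrable_iff_integrableOn_Ioc_of_le hR] at h
      exact h.congr_fun e measurableSet_Ioc
    · rw [Ioc_eq_empty (not_lt.2 hR)]
      exact integrableOn_empty
  · intro hR
    rw [← setIntegral_congr_fun measurableSet_Ioc e, ← intervalIntegral.integral_of_le hR,
      integral_rpow (Or.inl (by norm_num)), Real.sqrt_eq_rpow]
    norm_num
    ring

theorem integrable_majorant {σ : ℝ} (hσ : 0 < σ) (x : ℝ) : Integrable (majorant σ x) := by
  refine Integrable.add ?_ ?_
  · refine Integrable.const_mul ?_ _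
    exact (integrable_profile_abs.comp_mul_left' hσ.ne').comp_sub_left x
  · refine Integrable.const_mul ?_ _
    exact (integrable_indicator_iff measurableSet_Ioc).2 (integrableOn_inv_sqrt _).1

/-- The profile term scales to $\sqrt\sigma\cdot\sigma^{-1}$; the singular term uses
$\int_0^{x/2}y^{-1/2}dy\le2\sqrt x$. Both are of size $\sigma^{-1/2}x^{-3/2}$. -/
theorem integral_majorant_le {σ x : ℝ} (hσ : 0 < σ) (hx : 0 < x) :
    ∫ y, majorant σ x y ≤ (3 * (∫ w : ℝ, profile |w|) + 4) * (√σ)⁻¹ * (x * √x)⁻¹ := by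
  have hsx : 0 < √x := Real.sqrt_pos.2 hx
  have hsσ : 0 < √σ := Real.sqrt_pos.2 hσ
  have hσσ := Real.mul_self_sqrt hσ.le
  have hxx := Real.mul_self_sqrt hx.le
  have i1 : Integrable fun y => profile |σ * (x - y)| :=
    (integrable_profile_abs.comp_mul_left' hσ.ne').comp_sub_left x
  have i2 : Integrable ((Ioc 0 (x / 2)).indicator fun y : ℝ => (√y)⁻¹) :=
    (integrable_indicator_iff measurableSet_Ioc).2 (integrableOn_inv_sqrt _).1
  have e1 : ∫ y, profile |σ * (x - y)| = σ⁻¹ * ∫ w : ℝ, profile |w| := by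
    rw [integral_sub_left_eq_self (fun z => profile |σ * z|) volume x,
      Measure.integral_comp_mul_left (fun w => profile |w|), smul_eq_mul,
      abs_of_pos (inv_pos.2 hσ)]
  unfold majorant
  rw [integral_add (i1.const_mul _) (i2.const_mul _), integral_const_mul, integral_const_mul, e1,
    integral_indicator measurableSet_Ioc, (integrableOn_inv_sqrt _).2 (by positivity)]
  have h1 : √(x / 2) ≤ √x := Real.sqrt_le_sqrt (by linarith)
  set I := ∫ w : ℝ, profile |w|
  calc _ ≤ 3 * (x * √x)⁻¹ * √σ * (σ⁻¹ * I) + 2 * (x ^ 2)⁻¹ * (√σ)⁻¹ * (2 * √x) := by gcongr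
    _ = _ := by
      nth_rewrite 2 [← hσσ]
      rw [show x ^ 2 = x * (√x * √x) by rw [hxx]; ring]
      field_simp
      norm_num

/-! ### Asymptotics of the trace integral. -/

open IsLocalKernel

/-- A measurable family of convolution kernels with decay of second order on the scale `σ⁻¹`. -/
structure IsConvKernel (A : ℝ → ℝ → ℂ) (N σ : ℝ) : Prop where
  meas : StronglyMeasurable (Function.uncurry A)
  bound : ∀ x z, ‖A x z‖ ≤ 2 * N * (σ / (1 + σ * |z|) ^ 2)

theorem integrable_decay {σ : ℝ} (hσ : 0 < σ) :
    Integrable fun z : ℝ => σ / (1 + σ * |z|) ^ 2 := by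
  have h := (integrable_one_add_norm (E := ℝ) (μ := volume) (r := 2) (by norm_num)).comp_mul_left'
    hσ.ne'
  refine (h.const_mul σ).congr (Filter.Eventually.of_forall fun z => ?_)
  simp only [Real.norm_eq_abs]
  rw [abs_mul, abs_of_pos hσ, Real.rpow_neg (by positivity), ← div_eq_mul_inv]
  norm_num

namespace IsConvKernel

variable {A : ℝ → ℝ → ℂ} {N σ : ℝ} {h h' : ℝ → ℂ} {H : ℝ}

theorem nonneg (hA : IsConvKernel A N σ) (hσ : 0 < σ) : 0 ≤ N := by
  have h1 := (norm_nonneg _).trans (hA.bound 0 0)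
  rw [abs_zero, mul_zero, add_zero, one_pow, div_one] at h1
  by_contra! hN
  nlinarith

theorem integrable (hA : IsConvKernel A N σ) (hσ : 0 < σ) (x : ℝ) : Integrable (A x) :=
  ((integrable_decay hσ).const_mul (2 * N)).mono'
    (hA.meas.comp_measurable measurable_prodMk_left).aestronglyMeasurable
    (Filter.Eventually.of_forall (hA.bound x))

/-- The product of the convolution kernel and the Mellin kernel, integrated over `y`. -/
def rowTrace (A : ℝ → ℝ → ℂ) (h : ℝ → ℂ) (x : ℝ) : ℂ := ∫ y, A x (x - y) * mellinKernel h y x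

theorem stronglyMeasurable_rowTrace (hA : IsConvKernel A N σ) (hh : IsDecaying h h' H) :
    StronglyMeasurable (rowTrace A h) := by
  refine StronglyMeasurable.integral_prod_right
    (f := fun x y => A x (x - y) * mellinKernel h y x) ?_
  exact (hA.meas.comp_measurable (by fun_prop : Measurable fun p : ℝ × ℝ =>
    (p.1, p.1 - p.2))).mul hh.stronglyMeasurable_mellinKernel

/-- Subtracting the frozen kernel $x^{-1}\int h$ under the integral leaves the majorised error; the
factor $6$ is $2$ from the convolution bound times $3$ from the Mellin kernel. -/
theorem norm_rowTrace_sub_le (hA : IsConvKernel A N σ) (hσ : 0 < σ) (hh : IsDecaying h h' H)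
    {x : ℝ} (hx : 0 < x) :
    ‖rowTrace A h x - (∫ z, A x z) * ((x : ℂ)⁻¹ * ∫ s, h s)‖ ≤
      6 * N * IsDecaying.fourierConst H * ((3 * (∫ w : ℝ, profile |w|) + 4) * (√σ)⁻¹ *
        (x * √x)⁻¹) := by
  have hN := hA.nonneg hσ
  have hK := hh.fourierConst_nonneg
  set K := IsDecaying.fourierConst H
  set k := ∫ s, h s
  have hxc : (x : ℂ) ≠ 0 := by exact_mod_cast hx.ne'
  have hmA : AEStronglyMeasurable (fun y => A x (x - y)) volume :=
    (hA.meas.comp_measurable (by fun_prop : Measurable fun y : ℝ =>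
      (x, x - y))).aestronglyMeasurable
  have hmK : AEStronglyMeasurable (fun y => mellinKernel h y x) volume :=
    (hh.stronglyMeasurable_mellinKernel.comp_measurable
      measurable_prodMk_left).aestronglyMeasurable
  have hpt : ∀ y, ‖A x (x - y) * (mellinKernel h y x - (x : ℂ)⁻¹ * k)‖ ≤
      6 * N * K * majorant σ x y := fun y => by
    have e : mellinKernel h y x - (x : ℂ)⁻¹ * k = (x : ℂ)⁻¹ * (x * mellinKernel h y x - k) := by
      field_simp
    rw [e, norm_mul, norm_mul, norm_inv, Complex.norm_real, Real.norm_of_nonneg hx.le]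
    calc _ ≤ 2 * N * (σ / (1 + σ * |x - y|) ^ 2) *
          (x⁻¹ * (3 * K * (√|y / x - 1| * (1 + (√(y / x))⁻¹)))) := by
          gcongr
          · exact hA.bound _ _
          · exact hh.norm_mul_mellinKernel_sub_le hx y
      _ = 6 * N * K * (σ / (1 + σ * |x - y|) ^ 2 *
          (x⁻¹ * (√|y / x - 1| * (1 + (√(y / x))⁻¹)))) := by ring
      _ ≤ _ := by
          gcongr
          exact le_majorant hσ hx y
  have hmaj := (integrable_majorant hσ x).const_mul (6 * N * K)
  have i1 : Integrable fun y => A x (x - y) * (mellinKernel h y x - (x : ℂ)⁻¹ * k) :=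
    hmaj.mono' (hmA.mul (hmK.sub aestronglyMeasurable_const)) (Filter.Eventually.of_forall hpt)
  have i2 : Integrable fun y => A x (x - y) * ((x : ℂ)⁻¹ * k) :=
    ((hA.integrable hσ x).comp_sub_left x).mul_const _
  have e1 : rowTrace A h x - (∫ z, A x z) * ((x : ℂ)⁻¹ * k) =
      ∫ y, A x (x - y) * (mellinKernel h y x - (x : ℂ)⁻¹ * k) := by
    rw [← integral_sub_left_eq_self (A x) volume x, ← integral_mul_const, sub_eq_iff_eq_add,
      ← integral_add i1 i2, rowTrace]
    congr 1
    ext y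
    ring
  rw [e1]
  refine (norm_integral_le_of_norm_le hmaj (Filter.Eventually.of_forall hpt)).trans ?_
  rw [integral_const_mul]
  gcongr
  exact integral_majorant_le hσ hx

end IsConvKernel

theorem integrableOn_inv_mul_sqrt :
    IntegrableOn (fun x : ℝ => (x * √x)⁻¹) (Ioi 1) ∧ ∫ x in Ioi (1 : ℝ), (x * √x)⁻¹ = 2 := by
  have e : ∀ x ∈ Ioi (1 : ℝ), x ^ (-(3 / 2) : ℝ) = (x * √x)⁻¹ := fun x hx => by
    have h0 : (0 : ℝ) < x := zero_lt_one.trans hx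
    rw [Real.rpow_neg h0.le, Real.sqrt_eq_rpow, ← Real.rpow_one_add' h0.le (by norm_num)]
    norm_num
  constructor
  · exact (integrableOn_Ioi_rpow_of_lt (by norm_num) one_pos).congr_fun e measurableSet_Ioi
  · rw [← setIntegral_congr_fun measurableSet_Ioi e, integral_Ioi_rpow_of_lt (by norm_num) one_pos]
    norm_num

namespace IsCutoff

variable {r : ℝ} {ψ : ℝ → ℝ}

theorem norm_le_one (hψ : IsCutoff r ψ) (x : ℝ) : ‖(ψ x : ℂ)‖ ≤ 1 := by
  rw [Complex.norm_real, Real.norm_of_nonneg (hψ.nonneg x)]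
  exact hψ.le_one x

theorem le_indicator (hψ : IsCutoff r ψ) (x : ℝ) :
    ψ x * x⁻¹ ≤ (Ioc 1 (4 * r)).indicator (fun x => x⁻¹) x := by
  by_cases hx : x ∈ Ioo 1 (4 * r)
  · rw [indicator_of_mem (show x ∈ Ioc 1 (4 * r) from ⟨hx.1, hx.2.le⟩)]
    exact mul_le_of_le_one_left (inv_nonneg.2 (by linarith [hx.1])) (hψ.le_one x)
  · rw [hψ.eq_zero x hx, zero_mul]
    exact indicator_nonneg (fun y hy => inv_nonneg.2 (by linarith [hy.1])) x

theorem nonneg_mul_inv (hψ : IsCutoff r ψ) (x : ℝ) : 0 ≤ ψ x * x⁻¹ := by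
  by_cases hx : x ∈ Ioo 1 (4 * r)
  · exact mul_nonneg (hψ.nonneg x) (inv_nonneg.2 (by linarith [hx.1]))
  · rw [hψ.eq_zero x hx, zero_mul]

theorem integrableOn_inv {p q : ℝ} (hp : 0 < p) :
    IntegrableOn (fun x : ℝ => x⁻¹) (Ioc p q) :=
  ((continuousOn_inv₀.mono fun _ hx => (hp.trans_le hx.1).ne').integrableOn_compact
    isCompact_Icc).mono_set Ioc_subset_Icc_self

theorem integrable_mul_inv (hψ : IsCutoff r ψ) : Integrable fun x => ψ x * x⁻¹ := by
  refine ((integrable_indicator_iff measurableSet_Ioc).2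
    (integrableOn_inv (q := 4 * r) one_pos)).mono' ?_ (Filter.Eventually.of_forall fun x => ?_)
  · exact (hψ.smooth.continuous.measurable.mul measurable_inv).aestronglyMeasurable
  · rw [Real.norm_of_nonneg (hψ.nonneg_mul_inv x)]
    exact hψ.le_indicator x

/-- The cutoff lies between the indicators of $(4,r)$ and $(1,4r)$, so the integral lies within
$\log4\le2$ of $\log r$. -/
theorem abs_integral_mul_inv_sub_log_le (hψ : IsCutoff r ψ) (hr : 5 ≤ r) :
    |(∫ x, ψ x * x⁻¹) - Real.log r| ≤ 2 := by
  have hlog4 : Real.log 4 ≤ 2 := by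
    rw [show (4 : ℝ) = 2 ^ 2 by norm_num, Real.log_pow]
    have := Real.log_two_lt_d9
    push_cast
    linarith
  have hr0 : 0 < r := by linarith
  have hint : ∀ p q : ℝ, 0 < p → p ≤ q →
      ∫ x, (Ioc p q).indicator (fun x => x⁻¹) x = Real.log (q / p) := fun p q hp hpq => by
    rw [integral_indicator measurableSet_Ioc, ← intervalIntegral.integral_of_le hpq,
      integral_inv_of_pos hp (hp.trans_le hpq)]
  have hup : ∫ x, ψ x * x⁻¹ ≤ Real.log (4 * r / 1) := by
    rw [← hint 1 (4 * r) one_pos (by linarith)]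
    exact integral_mono hψ.integrable_mul_inv ((integrable_indicator_iff measurableSet_Ioc).2
      (integrableOn_inv one_pos)) hψ.le_indicator
  have hlow : Real.log (r / 4) ≤ ∫ x, ψ x * x⁻¹ := by
    rw [← hint 4 r (by norm_num) (by linarith)]
    refine integral_mono_ae ((integrable_indicator_iff measurableSet_Ioc).2
      (integrableOn_inv (by norm_num))) hψ.integrable_mul_inv ?_
    -- The plateau of the cutoff is the open interval, so the single endpoint $r$ is discarded as a
    -- null set.
    filter_upwards [compl_mem_ae_iff.2 (measure_singleton r)] with x hx
    by_cases h4 : x ∈ Ioc 4 r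
    · have h5 : x ∈ Ioo 4 r := ⟨h4.1, lt_of_le_of_ne h4.2 hx⟩
      rw [indicator_of_mem h4, hψ.eq_one x h5, one_mul]
    · rw [indicator_of_notMem h4]
      exact hψ.nonneg_mul_inv x
  rw [div_one, Real.log_mul (by norm_num) hr0.ne'] at hup
  rw [Real.log_div hr0.ne' (by norm_num)] at hlow
  rw [abs_le]
  constructor <;> linarith

end IsCutoff

-- The integrand is split into the freezing error `E`, the variation of $a_0$ in `G`, and
-- $a_0(0)\int h$ times $\psi(x)/x$. They contribute respectively $\int_1^\infty x^{-3/2}dx=2$, an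
-- interval of length at most $4r$, and the $O(1)$ error of the logarithm.
open IsConvKernel in
theorem IsConvKernel.norm_integral_rowTrace_sub_le {A : ℝ → ℝ → ℂ} {N σ : ℝ} {h h' : ℝ → ℂ} {H : ℝ}
    (hA : IsConvKernel A N σ) (hσ : 0 < σ) (hh : IsDecaying h h' H) {r L : ℝ} (hr : 5 ≤ r)
    (hL : 0 < L) {ψ : ℝ → ℝ} (hψ : IsCutoff r ψ) {a₀ : ℝ → ℂ} (ha : ∀ x, ∫ z, A x z = a₀ x)
    (ha0 : ‖a₀ 0‖ ≤ N) (hlip : ∀ x, 0 ≤ x → ‖a₀ x - a₀ 0‖ ≤ N / L * x) :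
    ‖(∫ x, ψ x * rowTrace A h x) - (∫ s, h s) * a₀ 0 * Real.log r‖ ≤
      IsDecaying.fourierConst H * (12 * (3 * (∫ w : ℝ, profile |w|) + 4) * (√σ)⁻¹ +
        4 * (r / L) + 2) * N := by
  have hN := hA.nonneg hσ
  have hK := hh.fourierConst_nonneg
  have hk := hh.norm_integral_le_const
  set K := IsDecaying.fourierConst H
  set k := ∫ s, h s
  set D := (3 * (∫ w : ℝ, profile |w|) + 4) * (√σ)⁻¹
  have hD : 0 ≤ D := by
    have := profile_integral_nonneg
    positivity
  have hma : StronglyMeasurable a₀ := by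
    rw [← funext ha]
    exact hA.meas.integral_prod_right
  have hmψ : Measurable fun x => (ψ x : ℂ) :=
    Complex.measurable_ofReal.comp hψ.smooth.continuous.measurable
  -- the three contributions
  set E : ℝ → ℂ := fun x => ψ x * (rowTrace A h x - a₀ x * ((x : ℂ)⁻¹ * k)) with hE
  set G : ℝ → ℂ := fun x => (ψ x * (x : ℂ)⁻¹) * (a₀ x - a₀ 0) with hG
  have hEb : ∀ x, ‖E x‖ ≤
      6 * N * K * D * (Ioi 1).indicator (fun x => (x * √x)⁻¹) x := fun x => by
    by_cases hx : x ∈ Ioo 1 (4 * r)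
    · rw [indicator_of_mem (show x ∈ Ioi 1 from hx.1), hE, norm_mul, ← ha x]
      have hx0 : 0 < x := zero_lt_one.trans hx.1
      refine (mul_le_of_le_one_left (norm_nonneg _) (hψ.norm_le_one x)).trans ?_
      refine (hA.norm_rowTrace_sub_le hσ hh hx0).trans_eq ?_
      ring
    · simp only [hE, hψ.eq_zero x hx, Complex.ofReal_zero, zero_mul, norm_zero]
      refine mul_nonneg (by positivity) (indicator_nonneg (fun y hy => ?_) x)
      have : (0 : ℝ) < y := zero_lt_one.trans hy
      positivity
  have iEb : Integrable fun x => 6 * N * K * D * (Ioi 1).indicator (fun x => (x * √x)⁻¹) x :=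
    ((integrable_indicator_iff measurableSet_Ioi).2 integrableOn_inv_mul_sqrt.1).const_mul _
  have iE : Integrable E := by
    refine iEb.mono' (Measurable.aestronglyMeasurable ?_) (Filter.Eventually.of_forall hEb)
    have := (hA.stronglyMeasurable_rowTrace hh).measurable
    have := hma.measurable
    fun_prop
  have hGb : ∀ x, ‖G x‖ ≤ (Ioc 1 (4 * r)).indicator (fun _ => N / L) x := fun x => by
    by_cases hx : x ∈ Ioo 1 (4 * r)
    · have hx0 : 0 < x := zero_lt_one.trans hx.1
      rw [indicator_of_mem (show x ∈ Ioc 1 (4 * r) from ⟨hx.1, hx.2.le⟩), hG, norm_mul, norm_mul, norm_inv,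
        Complex.norm_real x, Real.norm_of_nonneg hx0.le]
      calc _ ≤ 1 * x⁻¹ * (N / L * x) := by
            gcongr
            · exact hψ.norm_le_one x
            · exact hlip x hx0.le
        _ = _ := by field_simp
    · simp only [hG, hψ.eq_zero x hx, Complex.ofReal_zero, zero_mul, norm_zero]
      exact indicator_nonneg (fun y hy => by positivity) x
  have iGb : Integrable fun x => (Ioc 1 (4 * r)).indicator (fun _ => N / L) x :=
    (integrable_indicator_iff measurableSet_Ioc).2 (by simp)
  have iG : Integrable G := by
    refine iGb.mono' (Measurable.aestronglyMeasurable ?_) (Filter.Eventually.of_forall hGb)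
    have := hma.measurable
    fun_prop
  have iψ : Integrable fun x => ((ψ x * x⁻¹ : ℝ) : ℂ) := hψ.integrable_mul_inv.ofReal
  have hsplit : ∀ x, ψ x * rowTrace A h x =
      E x + (k * G x + (k * a₀ 0) * ((ψ x * x⁻¹ : ℝ) : ℂ)) := fun x => by
    simp only [hE, hG]
    push_cast
    ring
  simp_rw [hsplit]
  have e1 : ∫ x, (E x + (k * G x + (k * a₀ 0) * ((ψ x * x⁻¹ : ℝ) : ℂ))) =
      (∫ x, E x) + (k * (∫ x, G x) + (k * a₀ 0) * ((∫ x, ψ x * x⁻¹ : ℝ) : ℂ)) := by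
    rw [integral_add (g := fun x => k * G x + (k * a₀ 0) * ((ψ x * x⁻¹ : ℝ) : ℂ)) iE
        ((iG.const_mul _).add (iψ.const_mul _)), integral_add (iG.const_mul _) (iψ.const_mul _), integral_const_mul, integral_const_mul,
      integral_complex_ofReal]
  have bE : ‖∫ x, E x‖ ≤ 6 * N * K * D * 2 := by
    refine (norm_integral_le_of_norm_le iEb (Filter.Eventually.of_forall hEb)).trans_eq ?_
    rw [integral_const_mul, integral_indicator measurableSet_Ioi, integrableOn_inv_mul_sqrt.2]
  have bG : ‖∫ x, G x‖ ≤ 4 * r * (N / L) := by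
    refine (norm_integral_le_of_norm_le iGb (Filter.Eventually.of_forall hGb)).trans ?_
    rw [integral_indicator measurableSet_Ioc, setIntegral_const, smul_eq_mul,
      Real.volume_real_Ioc_of_le (by linarith)]
    have : 0 ≤ N / L := by positivity
    gcongr
    linarith
  have bψ := hψ.abs_integral_mul_inv_sub_log_le hr
  have e2 : (∫ x, E x) + (k * (∫ x, G x) + (k * a₀ 0) * ((∫ x, ψ x * x⁻¹ : ℝ) : ℂ)) -
      k * a₀ 0 * Real.log r = (∫ x, E x) + (k * (∫ x, G x) +
        (k * a₀ 0) * (((∫ x, ψ x * x⁻¹) - Real.log r : ℝ) : ℂ)) := by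
    push_cast
    ring
  rw [e1, e2]
  calc _ ≤ 6 * N * K * D * 2 + (K * (4 * r * (N / L)) + K * N * 2) := by
        refine (norm_add_le _ _).trans (add_le_add bE ((norm_add_le _ _).trans
          (add_le_add ?_ ?_)))
        · rw [norm_mul]
          gcongr
        · rw [norm_mul, norm_mul, Complex.norm_real, Real.norm_eq_abs]
          gcongr
    _ = _ := by simp only [D]; ring

/-! ### Symbols and kernels of the pseudo-differential operators. -/

theorem sq_mul_norm_fourierInv_eq {f : ℝ → ℂ} (hf : Integrable f) (d : Differentiable ℝ f)
    (hf' : Integrable (deriv f)) (d' : Differentiable ℝ (deriv f))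
    (hf'' : Integrable (deriv (deriv f))) (ζ : ℝ) :
    (2 * Real.pi * ζ) ^ 2 * ‖𝓕⁻ f ζ‖ = ‖𝓕⁻ (deriv (deriv f)) ζ‖ := by
  rw [Real.fourierInv_eq_fourier_neg, Real.fourierInv_eq_fourier_neg,
    congrFun (Real.fourier_deriv hf' d' hf'') (-ζ), congrFun (Real.fourier_deriv hf d hf') (-ζ),
    norm_smul, norm_smul, ← mul_assoc, ← sq]
  have hn : ‖(2 * Real.pi * Complex.I * ((-ζ : ℝ) : ℂ) : ℂ)‖ = 2 * Real.pi * |ζ| := by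
    simp [abs_of_pos Real.pi_pos]
  rw [hn, mul_pow, mul_pow _ |ζ|, sq_abs]

theorem norm_fourierInv_le_of_support {f : ℝ → ℂ} {ρ M : ℝ} (hρ : 0 ≤ ρ)
    (hf : ∀ ξ, ‖f ξ‖ ≤ (Icc (-ρ) ρ).indicator (fun _ => M) ξ) (ζ : ℝ) :
    ‖𝓕⁻ f ζ‖ ≤ 2 * ρ * M := by
  refine (IsLocalKernel.norm_fourierInv_le
    ((integrable_indicator_iff measurableSet_Icc).2 (by simp)) hf ζ).trans_eq ?_
  rw [integral_indicator measurableSet_Icc, setIntegral_const, smul_eq_mul,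
    Real.volume_real_Icc_of_le (by linarith)]
  ring

theorem mixedDeriv_zero_left (k : ℕ) (a : ℝ → ℝ → ℂ) (x ξ : ℝ) :
    mixedDeriv 0 k a x ξ = iteratedDeriv k (a x) ξ := by
  rw [mixedDeriv, iteratedDeriv_zero]

namespace IsSymbol

variable {a : ℝ → ℝ → ℂ} {α L ρ : ℝ}

/-- A real supremum of an unbounded family defaults to $0$, so boundedness of the derivatives is
what makes this true. -/
theorem le_symbolNorm (ha : IsSymbol 2 2 a) (hL : 0 ≤ L) (hρ : 0 ≤ ρ) {j k : ℕ} (hj : j < 2)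
    (hk : k < 3) (x ξ : ℝ) :
    L ^ j * ρ ^ k * ‖mixedDeriv j k a x ξ‖ ≤ symbolNorm 1 2 a L ρ := by
  have h1 : BddAbove (range fun z : ℝ × ℝ => L ^ j * ρ ^ k * ‖mixedDeriv j k a z.1 z.2‖) := by
    obtain ⟨M, hM⟩ := ha.bounded j (by omega) k (by omega)
    refine ⟨L ^ j * ρ ^ k * M, ?_⟩
    rintro - ⟨z, rfl⟩
    dsimp only
    gcongr
    exact hM _ _
  have h2 := le_ciSup h1 (x, ξ)
  refine h2.trans ?_
  exact le_ciSup (f := fun p : Fin (1 + 1) × Fin (2 + 1) => ⨆ z : ℝ × ℝ,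
    L ^ (p.1 : ℕ) * ρ ^ (p.2 : ℕ) * ‖mixedDeriv p.1 p.2 a z.1 z.2‖)
    (finite_range _).bddAbove (⟨j, hj⟩, ⟨k, hk⟩)

theorem differentiable (ha : IsSymbol 2 2 a) (x : ℝ) : Differentiable ℝ (a x) := by
  simpa using ha.diff_snd 0 (by norm_num) x

theorem differentiable_deriv (ha : IsSymbol 2 2 a) (x : ℝ) : Differentiable ℝ (deriv (a x)) := by
  simpa using ha.diff_snd 1 (by norm_num) x

theorem differentiable_left (ha : IsSymbol 2 2 a) (ξ : ℝ) :
    Differentiable ℝ fun x => a x ξ := by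
  simpa [mixedDeriv] using ha.diff_fst 0 (by norm_num) 0 (by norm_num) ξ

theorem norm_le (ha : IsSymbol 2 2 a) (hL : 0 ≤ L) (hρ : 0 ≤ ρ) (x ξ : ℝ) :
    ‖a x ξ‖ ≤ symbolNorm 1 2 a L ρ := by
  simpa [mixedDeriv] using ha.le_symbolNorm hL hρ (j := 0) (k := 0) (by norm_num) (by norm_num) x ξ

theorem norm_deriv_deriv_le (ha : IsSymbol 2 2 a) (hL : 0 ≤ L) (hρ : 0 < ρ) (x ξ : ℝ) :
    ‖deriv (deriv (a x)) ξ‖ ≤ symbolNorm 1 2 a L ρ / ρ ^ 2 := by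
  rw [le_div_iff₀' (by positivity)]
  have := ha.le_symbolNorm hL hρ.le (j := 0) (k := 2) (by norm_num) (by norm_num) x ξ
  rw [mixedDeriv_zero_left, iteratedDeriv_succ, iteratedDeriv_one] at this
  simpa using this

theorem norm_sub_le (ha : IsSymbol 2 2 a) (hL : 0 < L) (hρ : 0 ≤ ρ) {x : ℝ} (hx : 0 ≤ x) (ξ : ℝ) :
    ‖a x ξ - a 0 ξ‖ ≤ symbolNorm 1 2 a L ρ / L * x := by
  have h := convex_univ.norm_image_sub_le_of_norm_deriv_le (𝕜 := ℝ) (f := fun x => a x ξ)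
    (C := symbolNorm 1 2 a L ρ / L) (fun y _ => ha.differentiable_left ξ y) (fun y _ => ?_)
    (mem_univ 0) (mem_univ x)
  · rwa [sub_zero, Real.norm_of_nonneg hx] at h
  · rw [le_div_iff₀' hL]
    simpa [mixedDeriv] using
      ha.le_symbolNorm hL.le hρ (j := 1) (k := 0) (by norm_num) (by norm_num) y ξ

theorem stronglyMeasurable (ha : IsSymbol 2 2 a) : StronglyMeasurable (Function.uncurry a) :=
  stronglyMeasurable_uncurry_of_continuous_of_stronglyMeasurable
    (u := a) (fun ξ => (ha.differentiable_left ξ).continuous)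
    fun x => (ha.differentiable x).continuous.stronglyMeasurable

theorem tsupport_subset (hsupp : ∀ x ξ : ℝ, a x ξ ≠ 0 → |ξ| < ρ) (x : ℝ) :
    tsupport (a x) ⊆ Icc (-ρ) ρ :=
  closure_minimal (fun ξ hξ => abs_le.1 (hsupp x ξ hξ).le) isClosed_Icc

theorem hasCompactSupport (hsupp : ∀ x ξ : ℝ, a x ξ ≠ 0 → |ξ| < ρ) (x : ℝ) :
    HasCompactSupport (a x) :=
  isCompact_Icc.of_isClosed_subset (isClosed_tsupport _) (tsupport_subset hsupp x)

theorem integrable (ha : IsSymbol 2 2 a) (hsupp : ∀ x ξ : ℝ, a x ξ ≠ 0 → |ξ| < ρ) (x : ℝ) :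
    Integrable (a x) :=
  (ha.differentiable x).continuous.integrable_of_hasCompactSupport (hasCompactSupport hsupp x)

theorem norm_le_indicator_of_tsupport {f : ℝ → ℂ} {M : ℝ} (hs : Function.support f ⊆ Icc (-ρ) ρ)
    (hf : ∀ ξ, ‖f ξ‖ ≤ M) (ξ : ℝ) : ‖f ξ‖ ≤ (Icc (-ρ) ρ).indicator (fun _ => M) ξ := by
  by_cases hξ : ξ ∈ Icc (-ρ) ρ
  · rw [indicator_of_mem hξ]
    exact hf ξ
  · rw [indicator_of_notMem hξ, Function.notMem_support.1 fun h => hξ (hs h), norm_zero]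

theorem norm_fourierInv_le (ha : IsSymbol 2 2 a) (hL : 0 ≤ L) (hρ : 0 ≤ ρ)
    (hsupp : ∀ x ξ : ℝ, a x ξ ≠ 0 → |ξ| < ρ) (x ζ : ℝ) :
    ‖𝓕⁻ (a x) ζ‖ ≤ 2 * ρ * symbolNorm 1 2 a L ρ :=
  norm_fourierInv_le_of_support hρ (norm_le_indicator_of_tsupport
    ((subset_tsupport _).trans (tsupport_subset hsupp x)) (ha.norm_le hL hρ x)) ζ

theorem sq_mul_norm_fourierInv_le (ha : IsSymbol 2 2 a) (hL : 0 ≤ L) (hρ : 0 < ρ)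
    (hsupp : ∀ x ξ : ℝ, a x ξ ≠ 0 → |ξ| < ρ) (x ζ : ℝ) :
    (2 * Real.pi * ζ) ^ 2 * ‖𝓕⁻ (a x) ζ‖ ≤ 2 * ρ * (symbolNorm 1 2 a L ρ / ρ ^ 2) := by
  have hb := norm_le_indicator_of_tsupport (support_deriv_subset.trans
    (tsupport_deriv_subset.trans (tsupport_subset hsupp x))) (ha.norm_deriv_deriv_le hL hρ x)
  rw [sq_mul_norm_fourierInv_eq (ha.integrable hsupp x) (ha.differentiable x)
    ((ha.differentiable_deriv x).continuous.integrable_of_hasCompactSupport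
      (hasCompactSupport hsupp x).deriv) (ha.differentiable_deriv x)]
  · exact norm_fourierInv_le_of_support hρ.le hb ζ
  · exact ((integrable_indicator_iff measurableSet_Icc).2 (by simp)).mono'
      (measurable_deriv _).aestronglyMeasurable (Filter.Eventually.of_forall hb)

/-- The convolution kernels of the pseudo-differential operator with symbol `a`. -/
def convKernel (α : ℝ) (a : ℝ → ℝ → ℂ) (x z : ℝ) : ℂ :=
  ((α / (2 * Real.pi) : ℝ) : ℂ) * 𝓕⁻ (a x) (α * z / (2 * Real.pi))

/-- The trivial bound and two integrations by parts in $\xi$ on a support of length $2\rho$ give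
$F\le2\rho N$ and $(\alpha\rho|z|)^2F\le2\rho N$ for the modulus $F$ of the transform. -/
theorem isConvKernel (ha : IsSymbol 2 2 a) (hα : 0 < α) (hL : 0 ≤ L) (hρ : 0 < ρ)
    (hsupp : ∀ x ξ : ℝ, a x ξ ≠ 0 → |ξ| < ρ) :
    IsConvKernel (convKernel α a) (symbolNorm 1 2 a L ρ) (α * ρ) where
  meas := by
    have h1 := (stronglyMeasurable_fourierInv ha.stronglyMeasurable).comp_measurable
      (by fun_prop : Measurable fun p : ℝ × ℝ => (p.1, α * p.2 / (2 * Real.pi)))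
    simp only [Function.uncurry_def, Function.comp_def] at h1
    simp only [Function.uncurry_def, convKernel]
    exact h1.const_mul _
  bound x z := by
    have h1 := ha.norm_fourierInv_le hL hρ.le hsupp x (α * z / (2 * Real.pi))
    have h2 := ha.sq_mul_norm_fourierInv_le hL hρ hsupp x (α * z / (2 * Real.pi))
    have hπ := Real.pi_gt_three
    rw [show 2 * Real.pi * (α * z / (2 * Real.pi)) = α * z by field_simp] at h2
    have hN : 0 ≤ symbolNorm 1 2 a L ρ := (norm_nonneg _).trans (ha.norm_le hL hρ.le 0 0)
    set N := symbolNorm 1 2 a L ρ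
    set F := ‖𝓕⁻ (a x) (α * z / (2 * Real.pi))‖ with hF
    have hF0 : 0 ≤ F := norm_nonneg _
    have h3 : (α * ρ * |z|) ^ 2 * F ≤ 2 * ρ * N := by
      have : (α * ρ * |z|) ^ 2 * F = ρ ^ 2 * ((α * z) ^ 2 * F) := by
        rw [mul_pow _ |z|, sq_abs]; ring
      rw [this]
      calc _ ≤ ρ ^ 2 * (2 * ρ * (N / ρ ^ 2)) := by gcongr
        _ = _ := by field_simp
    set u := α * ρ * |z|
    have hu : 0 ≤ u := by positivity
    -- Combining the two bounds by $(1+u)^2\le2+2u^2$; after division by $2\pi$ the constant $8$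
    -- becomes at most $2$.
    have h4 : (1 + u) ^ 2 * F ≤ 8 * ρ * N := by
      have : (1 + u) ^ 2 ≤ 2 + 2 * u ^ 2 := by nlinarith [sq_nonneg (1 - u)]
      nlinarith [mul_le_mul_of_nonneg_right this hF0]
    rw [convKernel, norm_mul, Complex.norm_real, Real.norm_of_nonneg (by positivity),
      ← hF, ← mul_div_assoc, le_div_iff₀ (by positivity), div_mul_eq_mul_div, div_mul_eq_mul_div,
      div_le_iff₀ (by positivity)]
    have hc : 0 ≤ α * ρ * N := by positivity
    calc α * F * (1 + u) ^ 2 = α * ((1 + u) ^ 2 * F) := by ring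
      _ ≤ α * (8 * ρ * N) := by gcongr
      _ = 8 * (α * ρ * N) := by ring
      _ ≤ (4 * Real.pi) * (α * ρ * N) := by gcongr; linarith
      _ = _ := by ring

/-- Fourier inversion at the origin; the decay of the convolution kernel supplies the integrability
of the transform that inversion requires. -/
theorem integral_convKernel (ha : IsSymbol 2 2 a) (hα : 0 < α) (hρ : 0 < ρ)
    (hsupp : ∀ x ξ : ℝ, a x ξ ≠ 0 → |ξ| < ρ) (x : ℝ) :
    ∫ z, convKernel α a x z = a x 0 := by
  have hi := (ha.isConvKernel hα zero_le_one hρ hsupp).integrable (by positivity) x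
  have hc : 0 < α / (2 * Real.pi) := by positivity
  have hcc : ((α / (2 * Real.pi) : ℝ) : ℂ) ≠ 0 := by exact_mod_cast hc.ne'
  have e : ∀ z, convKernel α a x z =
      ((α / (2 * Real.pi) : ℝ) : ℂ) * 𝓕⁻ (a x) ((α / (2 * Real.pi)) * z) := fun z => by
    rw [convKernel, div_mul_eq_mul_div]
  have hF : Integrable (𝓕⁻ (a x)) := by
    have h1 : Integrable fun z => 𝓕⁻ (a x) ((α / (2 * Real.pi)) * z) := by
      refine (hi.const_mul ((α / (2 * Real.pi) : ℝ) : ℂ)⁻¹).congr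
        (Filter.Eventually.of_forall fun z => ?_)
      simp only [e]
      rw [inv_mul_cancel_left₀ hcc]
    exact (integrable_comp_mul_left_iff _ hc.ne').1 h1
  have hF' : Integrable (𝓕 (a x)) := by
    refine hF.comp_neg.congr (Filter.Eventually.of_forall fun z => ?_)
    simp only [Real.fourierInv_eq_fourier_neg, neg_neg]
  simp_rw [e]
  rw [integral_const_mul, Measure.integral_comp_mul_left, abs_of_pos (inv_pos.2 hc),
    Complex.real_smul, Complex.ofReal_inv, mul_inv_cancel_left₀ hcc]
  have h0 := congrFun ((ha.differentiable x).continuous.fourier_fourierInv_eq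
    (ha.integrable hsupp x) hF') 0
  rw [← h0, Real.fourier_eq']
  simp

/-- The kernel of the pseudo-differential operator with symbol `ψ a`. -/
def cutoffKernel (α : ℝ) (ψ : ℝ → ℝ) (a : ℝ → ℝ → ℂ) (x y : ℝ) : ℂ :=
  ψ x * convKernel α a x (x - y)

theorem exists_isLocalKernel (ha : IsSymbol 2 2 a) (hα : 0 < α) (hρ : 0 < ρ)
    (hsupp : ∀ x ξ : ℝ, a x ξ ≠ 0 → |ξ| < ρ) {r : ℝ} {ψ : ℝ → ℝ} (hψ : IsCutoff r ψ) :
    ∃ M, IsLocalKernel (cutoffKernel α ψ a) M (4 * r) := by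
  have hA := ha.isConvKernel hα zero_le_one hρ hsupp
  have hσ : 0 < α * ρ := by positivity
  have hN := hA.nonneg hσ
  set N := symbolNorm 1 2 a 1 ρ
  set σ := α * ρ
  set X := 4 * r
  refine ⟨2 * N * (σ * (1 + 2 * X ^ 2) + 2 / σ), ?_, fun x y => ?_⟩
  · have h1 := hA.meas.comp_measurable
      (by fun_prop : Measurable fun p : ℝ × ℝ => (p.1, p.1 - p.2))
    have h2 : StronglyMeasurable fun p : ℝ × ℝ => (ψ p.1 : ℂ) := (Complex.continuous_ofReal.comp
      (hψ.smooth.continuous.comp continuous_fst)).stronglyMeasurable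
    simp only [Function.uncurry_def, Function.comp_def] at h1
    simp only [Function.uncurry_def, cutoffKernel]
    exact h2.mul h1
  · by_cases hx : x ∈ Ioo 1 X
    · have hx' : x ∈ Icc (1 : ℝ) X := Ioo_subset_Icc_self hx
      rw [indicator_of_mem hx', mul_one, cutoffKernel,
        norm_mul]
      refine (mul_le_of_le_one_left (norm_nonneg _) (hψ.norm_le_one x)).trans
        ((hA.bound _ _).trans ?_)
      rw [mul_assoc (2 * N) _ (lorentz y)]
      refine mul_le_mul_of_nonneg_left ?_ (mul_nonneg zero_le_two hN)
      rw [lorentz, ← div_eq_mul_inv, div_le_div_iff₀ (by positivity) (by positivity)]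
      -- From $y^2\le2x^2+2(x-y)^2$ with $|x|\le X$: decay in $x-y$ becomes decay in $y$, since $x$
      -- stays in a bounded interval. The constant $M$ is not uniform, which is harmless as it only
      -- serves the trace class property.
      have hu : σ * y ^ 2 ≤ σ * (2 * X ^ 2) + 2 / σ * (σ * |x - y|) ^ 2 := by
        have e : 2 / σ * (σ * |x - y|) ^ 2 = σ * (2 * (x - y) ^ 2) := by
          rw [mul_pow, sq_abs]; field_simp
        rw [e, ← mul_add]
        gcongr
        have h1 : x ^ 2 ≤ X ^ 2 := by nlinarith [hx.1, hx.2]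
        nlinarith [sq_nonneg (y - 2 * x)]
      set u := σ * |x - y|
      have hu0 : 0 ≤ u := by positivity
      have h1 : 1 ≤ (1 + u) ^ 2 := by nlinarith
      have h2 : u ^ 2 ≤ (1 + u) ^ 2 := by nlinarith
      calc σ * (1 + y ^ 2) ≤ σ * (1 + 2 * X ^ 2) * 1 + 2 / σ * u ^ 2 := by linarith
        _ ≤ σ * (1 + 2 * X ^ 2) * (1 + u) ^ 2 + 2 / σ * (1 + u) ^ 2 := by gcongr
        _ = _ := by ring
    · rw [cutoffKernel, hψ.eq_zero x hx, Complex.ofReal_zero, zero_mul, norm_zero]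
      have : 0 ≤ (Icc 1 X).indicator (fun _ => (1 : ℝ)) x :=
        indicator_nonneg (fun _ _ => zero_le_one) x
      have := lorentz_pos y
      positivity

/-- Fubini in $(\xi,y)$, legitimate because the symbol is integrable in $\xi$ and $u$ is Schwartz;
the $\xi$-integral is then the inverse Fourier transform at $\alpha(x-y)/(2\pi)$. -/
theorem isPDO_op (ha : IsSymbol 2 2 a) (hsupp : ∀ x ξ : ℝ, a x ξ ≠ 0 → |ξ| < ρ) {M X : ℝ}
    {ψ : ℝ → ℝ} (hb : IsLocalKernel (cutoffKernel α ψ a) M X) :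
    IsPDO α (fun x ξ => (ψ x : ℂ) * a x ξ) hb.isHSKernel.op := by
  intro u
  filter_upwards [hb.isHSKernel.coeFn_op (u.toLp 2 volume)] with x hx
  rw [hx]
  have e1 : ∫ y, cutoffKernel α ψ a x y * u.toLp 2 volume y = ∫ y, cutoffKernel α ψ a x y * u y := by
    refine integral_congr_ae ?_
    filter_upwards [u.coeFn_toLp 2 volume] with y hy
    rw [hy]
  have hint : Integrable (Function.uncurry fun ξ y : ℝ =>
      Complex.exp (Complex.I * ((α * (x - y) * ξ : ℝ) : ℂ)) * (ψ x * a x ξ) * u y) := by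
    have h1 : Integrable fun z : ℝ × ℝ => (ψ x * a x z.1) * u z.2 :=
      ((ha.integrable hsupp x).const_mul (ψ x : ℂ)).mul_prod u.integrable
    have h2 : Integrable fun z : ℝ × ℝ =>
        Complex.exp (Complex.I * ((α * (x - z.2) * z.1 : ℝ) : ℂ)) *
          ((ψ x * a x z.1) * u z.2) := by
      refine h1.bdd_mul (c := 1) (by fun_prop : Continuous fun z : ℝ × ℝ =>
        Complex.exp (Complex.I * ((α * (x - z.2) * z.1 : ℝ) : ℂ))).aestronglyMeasurable ?_
      refine Filter.Eventually.of_forall fun z => ?_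
      rw [mul_comm Complex.I, Complex.norm_exp_ofReal_mul_I]
    refine h2.congr (Filter.Eventually.of_forall fun z => ?_)
    simp only [Function.uncurry]
    ring
  rw [e1, integral_integral_swap hint, ← integral_const_mul]
  congr 1
  ext y
  rw [integral_mul_const, cutoffKernel, convKernel, Real.fourierInv_eq']
  have e2 : ∀ ξ : ℝ, Complex.exp (Complex.I * ((α * (x - y) * ξ : ℝ) : ℂ)) * (ψ x * a x ξ) =
      ψ x * (Complex.exp (((2 * Real.pi * inner ℝ ξ (α * (x - y) / (2 * Real.pi)) : ℝ) : ℂ) *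
        Complex.I) • a x ξ) := fun ξ => by
    have : 2 * Real.pi * inner ℝ ξ (α * (x - y) / (2 * Real.pi)) = α * (x - y) * ξ := by
      simp
      field_simp
    rw [this, mul_comm Complex.I, smul_eq_mul]
    ring
  simp_rw [e2]
  rw [integral_const_mul]
  ring

end IsSymbol

end WidomModel

end

/-! ### The trace asymptotics. -/

theorem theorem8p2 (g : ℝ → ℂ) (hg : ContDiff ℝ 1 g) (hg0 : g 0 = 0) (hg1 : g 1 = 0)
    (δ : ℝ) (hδ : 0 < δ) (c : ℝ) (hc : 0 < c) :
    ∃ C : ℝ, 0 < C ∧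
      ∀ (Ω : Set ℝ), (Ω = Set.Ioi 0 ∨ Ω = Set.Iio 0) →
      ∀ (α L ρ r : ℝ), 0 < α → 0 < L → 0 < ρ → c ≤ α * ρ → 5 ≤ r →
      ∀ (ψ : ℝ → ℝ), WidomModel.IsCutoff r ψ →
      ∀ (a : ℝ → ℝ → ℂ), WidomModel.IsSymbol 2 2 a → (∀ x ξ : ℝ, a x ξ ≠ 0 → |ξ| < ρ) →
      ∃ P B : WidomModel.L2 →L[ℂ] WidomModel.L2,
        WidomModel.IsPDO 1 (WidomModel.charSymbol Ω) P ∧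
        WidomModel.IsPDO α (fun x ξ => (ψ x : ℂ) * a x ξ) B ∧
        IsSelfAdjoint (WidomModel.halfLineCompression P) ∧
        WidomModel.IsTraceClass
          (B ∘L WidomModel.funOfOp g (WidomModel.halfLineCompression P)) ∧
        ∃ t : ℂ,
          WidomModel.HasTrace
            (B ∘L WidomModel.funOfOp g (WidomModel.halfLineCompression P)) t ∧
          ‖t - WidomModel.coeffA g 1 * a 0 0 * (Real.log r : ℂ)‖ ≤
            C * (1 + r / L + (α * ρ) ^ (-δ) * Real.log r) *
              WidomModel.symbolNorm 1 2 a L ρ := by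
  open WidomModel in
  obtain ⟨H, hH⟩ := exists_isDecaying hg hg0 hg1
  have hK := (hH 1 (Or.inl rfl)).fourierConst_nonneg
  have hI := profile_integral_nonneg
  set D := 12 * (3 * (∫ w : ℝ, profile |w|) + 4) with hD
  have hD0 : 0 ≤ D := by positivity
  set K := IsDecaying.fourierConst H with hKdef
  -- The factor $(\alpha\rho)^{-1/2}$ is at most $c^{-1/2}$, and $4r/L+2\le6(1+r/L)$; the final $1$
  -- keeps the constant positive when $K=0$.
  refine ⟨K * (D * (√c)⁻¹ + 6) + 1, by positivity, ?_⟩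
  intro Ω hΩ α L ρ r hα hL hρ hcρ hr ψ hψ a ha hsupp
  have hΩm : MeasurableSet Ω := by
    rcases hΩ with rfl | rfl
    · exact measurableSet_Ioi
    · exact measurableSet_Iio
  have hscale : ∀ s : ℝ, 0 < s → ∀ x, s * x ∈ Ω ↔ x ∈ Ω := by
    intro s hs x
    rcases hΩ with rfl | rfl
    · exact mul_pos_iff_of_pos_left hs
    · exact ⟨fun h => neg_of_mul_neg_right h hs.le, fun h => mul_neg_of_pos_of_neg hs h⟩
  obtain ⟨ε, hε⟩ : ∃ ε : ℝ, (ε = 1 ∧ Ω = Ioi 0) ∨ (ε = -1 ∧ Ω = Iio 0) := by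
    rcases hΩ with h | h
    · exact ⟨1, Or.inl ⟨rfl, h⟩⟩
    · exact ⟨-1, Or.inr ⟨rfl, h⟩⟩
  have hε' : ε = 1 ∨ ε = -1 := hε.imp And.left And.left
  have hh := hH ε hε'
  have hT := halfLineCompression_specProj hΩm hε
  have hgT : funOfOp g (halfLineCompression (specProj Ω hΩm)) = mellinMul hh.isBddMeas := by
    rw [hT]
    exact funOfOp_mellinMul hg.continuous hg0 (continuous_mellinSymbol ε) _ _
  have hσ : 0 < α * ρ := by positivity
  have hA := ha.isConvKernel hα hL.le hρ hsupp
  obtain ⟨M, hb⟩ := ha.exists_isLocalKernel hα hρ hsupp hψ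
  obtain ⟨htc, htr⟩ := hb.isTraceClass_hasTrace hh
  refine ⟨specProj Ω hΩm, hb.isHSKernel.op, isPDO_specProj hΩm hscale, ha.isPDO_op hsupp hb, ?_,
    ?_, ∫ x, ∫ y, IsSymbol.cutoffKernel α ψ a x y *
      IsLocalKernel.mellinKernel (fun s => g (mellinSymbol ε s)) y x, ?_, ?_⟩
  · rw [hT]
    exact isSelfAdjoint_mellinMul _
  · rw [hgT]
    exact htc
  · rw [hgT]
    exact htr
  · have e : ∀ x, ∫ y, IsSymbol.cutoffKernel α ψ a x y *
        IsLocalKernel.mellinKernel (fun s => g (mellinSymbol ε s)) y x =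
        ψ x * IsConvKernel.rowTrace (IsSymbol.convKernel α a) (fun s => g (mellinSymbol ε s)) x :=
      fun x => by
        rw [IsConvKernel.rowTrace, ← integral_const_mul]
        simp only [IsSymbol.cutoffKernel, mul_assoc]
    simp_rw [e]
    have hmain := hA.norm_integral_rowTrace_sub_le hσ hh hr hL hψ
      (ha.integral_convKernel hα hρ hsupp) (ha.norm_le hL.le hρ.le 0 0)
      fun x hx => ha.norm_sub_le hL hρ.le hx 0
    rw [integral_comp_mellinSymbol hg1 hε'] at hmain
    refine hmain.trans ?_
    have hN := hA.nonneg hσ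
    refine mul_le_mul_of_nonneg_right ?_ hN
    rw [← hKdef, ← hD]
    have h1 : (√(α * ρ))⁻¹ ≤ (√c)⁻¹ :=
      inv_anti₀ (Real.sqrt_pos.2 hc) (Real.sqrt_le_sqrt hcρ)
    -- The bound already holds without a logarithmic error; this term enters only as a nonnegative
    -- summand on the right.
    have h2 : 0 ≤ (α * ρ) ^ (-δ) * Real.log r :=
      mul_nonneg (Real.rpow_nonneg hσ.le _) (Real.log_nonneg (by linarith))
    have h3 : 0 ≤ r / L := by positivity
    have h4 : 0 ≤ D * (√c)⁻¹ := by positivity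
    calc _ ≤ K * (D * (√c)⁻¹ + 4 * (r / L) + 2) := by gcongr
      _ ≤ K * ((D * (√c)⁻¹ + 6) * (1 + r / L)) := by
          gcongr
          nlinarith
      _ = (K * (D * (√c)⁻¹ + 6)) * (1 + r / L) := by ring
      _ ≤ _ :=
          mul_le_mul (by linarith) (by linarith) (by positivity) (by positivity)
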